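/- Let $1\le k\le n$ and let $W$ be a complex vector space with basis $w_1,\dots,w_{2n}$, equipped with the symplectic form given by $\langle w_i,w_{2n+1-i}\rangle=1$ for $1\le i\le n$ and $\langle w_i,w_j\rangle=0$ for $i+j\ne 2n+1$. Let $Sp_{2n}$ be the group of automorphisms of $W$ preserving the form, $B\subset Sp_{2n}$ the Borel subgroup of upper triangular matrices, and $\mathfrak n^-\subset\mathfrak{sp}_{2n}$ the subalgebra of strictly lower triangular matrices. Let $v=w_1\wedge\dots\wedge w_k$ and let $V_{\omega_k}=U(\mathfrak n^-)v\subset\Lambda^kW$ be the fundamental representation of highest weight $\omega_k$, with its PBW filtration $F_s=\mathrm{span}\{x_1\cdots x_l v: x_i\in\mathfrak n^-,\ l\le s\}$ and associated graded space $V^a_{\omega_k}=\bigoplus_{s\ge 0}F_s/F_{s-1}$ (with $F_{-1}=0$). The abelian Lie algebra $(\mathfrak n^-)^a$ (the vector space $\mathfrak n^-$) acts on $V^a_{\omega_k}$ by operators of degree one, hence so does the commutative group $(N^-)^a=\exp((\mathfrak n^-)^a)$; also $B$ acts on $V^a_{\omega_k}$ by operators of degree zero, and together they define the action of $G^a=B\ltimes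 (N^-)^a$. The degenerate symplectic Grassmannian is the Zariski closure of the orbit of the highest weight line, $$SpGr^a_k(W)=Sp\mathcal F^a_{\omega_k}=\overline{G^a\cdot[v]}\subset\mathbb P(V^a_{\omega_k}).$$ Put $W_{k,1}=\mathrm{span}(w_1,\dots,w_k)$, $W_{k,2}=\mathrm{span}(w_{k+1},\dots,w_{2n-k})$, $W_{k,3}=\mathrm{span}(w_{2n-k+1},\dots,w_{2n})$, let $pr_{1,3}:W\to W_{k,1}\oplus W_{k,3}$ be the projection along $W_{k,2}$, and let $Sp_{2k}\subset Sp_{2n}$ be the subgroup of elements that fix $W_{k,2}$ pointwise and preserve $W_{k,1}\oplus W_{k,3}$. Let $$Z_k=\{U\in Gr_k(W)\mid pr_{1,3}(U)\ \text{is isotropic}\}.$$ For $f\in\mathfrak n^-$ let $f_k$ be the endomorphism of $W$ that is zero on $W_{k,2}\oplus W_{k,3}$ and maps $w\in W_{k,1}$ to the component of $f(w)$ in $W_{k,2}\oplus W_{k,3}$. Then: 1. There is an injective linear map $\iota:V^a_{\omega_k}\to\Lambda^kW$ with $\iota(v)=w_1\wedge\dots\wedge w_k$ which intertwines the action of each $f\in(\mathfrak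 n^-)^a$ with the action of $f_k$ on $\Lambda^k W$ by derivations, and the induced embedding $\mathbb P(V^a_{\omega_k})\hookrightarrow\mathbb P(\Lambda^kW)$ maps $SpGr^a_k(W)$ onto the image of $Z_k$ under the Plücker embedding $Gr_k(W)\hookrightarrow\mathbb P(\Lambda^kW)$, $U\mapsto\Lambda^kU$. In this sense $$SpGr^a_k(W)=\{U\in Gr_k(W)\mid pr_{1,3}(U)\ \text{is isotropic}\}.$$ 2. This variety is irreducible in the Zariski topology (as a subset of $\mathbb P(V^a_{\omega_k})$ and as a subset of $\mathbb P(\Lambda^kW)$). 3. $Z_k=Sp_{2k}\cdot Gr_k(W_{k,1}\oplus W_{k,2})$. -/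

import Mathlib

open scoped LinearAlgebra.Projectivization DirectSum

noncomputable section

namespace DegSymp

/-! ### Zariski topology on a projective space -/

/-- The value at `v` of a polynomial function on `V`, i.e. of a polynomial in the linear forms
on `V`. -/
def polyVal {V : Type*} [AddCommGroup V] [Module ℂ V]
    (p : MvPolynomial (Module.Dual ℂ V) ℂ) (v : V) : ℂ :=
  MvPolynomial.eval (fun φ : Module.Dual ℂ V => φ v) p

/-- The Zariski topology on `ℙ(V)`: the sets `{p ≠ 0}`, for `p` a homogeneous polynomial function
on `V`, form a basis of open sets. -/
@[reducible] def zariski (V : Type*) [AddCommGroup V] [Module ℂ V] : TopologicalSpace (ℙ ℂ V) :=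
  TopologicalSpace.generateFrom
    {O | ∃ (d : ℕ) (p : MvPolynomial (Module.Dual ℂ V) ℂ), p.IsHomogeneous d ∧
      O = {x | polyVal p x.rep ≠ 0}}

/-! ### The PBW filtration on a cyclic module and its associated graded space -/

section PBW

variable {N M : Type*} [AddCommMonoid N] [Module ℂ N] [AddCommGroup M] [Module ℂ M]
  (ρ : N →ₗ[ℂ] Module.End ℂ M) (v : M)

/-- The span of the vectors `x₁ ⋯ x_l v` with `x₁, …, x_l ∈ N` and `l < s`. Thus
`pbwLT ρ v (s + 1)` is the member `F_s` of the PBW filtration of the cyclic module generated by `v`,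
and `pbwLT ρ v 0 = 0` is `F_{-1}`. -/
def pbwLT (s : ℕ) : Submodule ℂ M :=
  Submodule.span ℂ {m | ∃ l : List N, l.length < s ∧ m = (l.map ρ).prod v}

lemma pbwLT_mono : Monotone (pbwLT ρ v) := fun _ _ h =>
  Submodule.span_mono fun _ ⟨l, hl, hm⟩ => ⟨l, hl.trans_le h, hm⟩

lemma word_mem_pbwLT {s : ℕ} (l : List N) (h : l.length < s) :
    (l.map ρ).prod v ∈ pbwLT ρ v s := Submodule.subset_span ⟨l, h, rfl⟩

lemma pbwLT_act (x : N) (s : ℕ) : pbwLT ρ v s ≤ (pbwLT ρ v (s + 1)).comap (ρ x) := by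
  refine Submodule.span_le.2 ?_
  rintro _ ⟨l, hl, rfl⟩
  exact word_mem_pbwLT ρ v (x :: l) (by simpa using hl)

/-- The homogeneous component `F_s / F_{s-1}` of the associated graded space. -/
abbrev PBWPiece (s : ℕ) : Type _ :=
  ↥(pbwLT ρ v (s + 1)) ⧸ (pbwLT ρ v s).submoduleOf (pbwLT ρ v (s + 1))

/-- The associated graded space `⨁_s F_s / F_{s-1}`. -/
def PBWGraded : Type _ := ⨁ s : ℕ, PBWPiece ρ v s

instance : AddCommGroup (PBWGraded ρ v) :=
  (inferInstance : AddCommGroup (⨁ s : ℕ, PBWPiece ρ v s))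

instance : Module ℂ (PBWGraded ρ v) :=
  (inferInstance : Module ℂ (⨁ s : ℕ, PBWPiece ρ v s))

/-- The inclusion of the component of degree `s`. -/
def grOf (s : ℕ) : PBWPiece ρ v s →ₗ[ℂ] PBWGraded ρ v :=
  DirectSum.lof ℂ ℕ (PBWPiece ρ v) s

/-- The class in degree `s` of an element of `F_s`. -/
def pbwClass (s : ℕ) : ↥(pbwLT ρ v (s + 1)) →ₗ[ℂ] PBWGraded ρ v :=
  grOf ρ v s ∘ₗ Submodule.mkQ _

/-- The linear map on the associated graded space with given restrictions to the components. -/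
def grLift {P : Type*} [AddCommGroup P] [Module ℂ P] (T : ∀ s, PBWPiece ρ v s →ₗ[ℂ] P) :
    PBWGraded ρ v →ₗ[ℂ] P :=
  DirectSum.toModule ℂ ℕ P T

lemma grLift_of {P : Type*} [AddCommGroup P] [Module ℂ P] (T : ∀ s, PBWPiece ρ v s →ₗ[ℂ] P)
    (s : ℕ) (y : PBWPiece ρ v s) : grLift ρ v T (grOf ρ v s y) = T s y :=
  DirectSum.toModule_lof ℂ (φ := T) s y

lemma gr_ext {P : Type*} [AddCommGroup P] [Module ℂ P] {S T : PBWGraded ρ v →ₗ[ℂ] P}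
    (h : ∀ s (y : PBWPiece ρ v s), S (grOf ρ v s y) = T (grOf ρ v s y)) : S = T :=
  DirectSum.linearMap_ext ℂ (M := PBWPiece ρ v) fun s => LinearMap.ext fun y => h s y

/-- The map `F_s / F_{s-1} → F_{s+d} / F_{s+d-1}` induced by an operator `T` that raises the
filtration degree by at most `d`. -/
def grPiece (T : Module.End ℂ M) (d : ℕ)
    (h : ∀ s, pbwLT ρ v s ≤ (pbwLT ρ v (s + d)).comap T) (s : ℕ) :
    PBWPiece ρ v s →ₗ[ℂ] PBWPiece ρ v (s + d) :=
  Submodule.mapQ _ _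
    (T.restrict (p := pbwLT ρ v (s + 1)) (q := pbwLT ρ v (s + d + 1))
      (fun _ hx => by rw [Nat.add_right_comm]; exact h (s + 1) hx))
    (fun _ hx => h s hx)

/-- The operator of degree `d` on the associated graded space induced by an operator `T` that
raises the filtration degree by at most `d`. -/
def grOp (T : Module.End ℂ M) (d : ℕ)
    (h : ∀ s, pbwLT ρ v s ≤ (pbwLT ρ v (s + d)).comap T) :
    Module.End ℂ (PBWGraded ρ v) :=
  grLift ρ v fun s => grOf ρ v (s + d) ∘ₗ grPiece ρ v T d h s

lemma grOp_of (T : Module.End ℂ M) (d : ℕ)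
    (h : ∀ s, pbwLT ρ v s ≤ (pbwLT ρ v (s + d)).comap T) (s : ℕ) (y : PBWPiece ρ v s) :
    grOp ρ v T d h (grOf ρ v s y) = grOf ρ v (s + d) (grPiece ρ v T d h s y) := by
  rw [grOp, grLift_of]; rfl

/-- The action of `x ∈ N` on the associated graded space: it maps the class of `m ∈ F_s` in
degree `s` to the class of `x m ∈ F_{s+1}` in degree `s + 1`. -/
def grAct (x : N) : Module.End ℂ (PBWGraded ρ v) :=
  grOp ρ v (ρ x) 1 (pbwLT_act ρ v x)

lemma grAct_pow_of (x : N) (m s : ℕ) (y : PBWPiece ρ v s) :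
    ∃ z, (grAct ρ v x ^ m) (grOf ρ v s y) = grOf ρ v (s + m) z := by
  induction m with
  | zero => exact ⟨y, rfl⟩
  | succ m ih =>
    obtain ⟨z, hz⟩ := ih
    exact ⟨_, by rw [pow_succ', Module.End.mul_apply, hz, grAct, grOp_of]; rfl⟩

lemma grAct_isNilpotent [Module.Finite ℂ M] (x : N) : IsNilpotent (grAct ρ v x) := by
  obtain ⟨k, hk⟩ := monotone_stabilizes_iff_noetherian.2
    (inferInstance : IsNoetherian ℂ M) ⟨pbwLT ρ v, pbwLT_mono ρ v⟩
  refine ⟨k, gr_ext ρ v fun s y => ?_⟩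
  obtain ⟨z, hz⟩ := grAct_pow_of ρ v x k s y
  have hs : Subsingleton (PBWPiece ρ v (s + k)) := by
    refine Submodule.Quotient.subsingleton_iff.2 (Submodule.submoduleOf_eq_top.2 ?_)
    have h1 := hk (s + k) (by omega)
    have h2 := hk (s + k + 1) (by omega)
    exact (h2.symm.trans h1).le
  rw [hz, Subsingleton.elim z 0, map_zero, LinearMap.zero_apply]

instance : Module ℚ (Module.End ℂ (PBWGraded ρ v)) :=
  Module.compHom _ (algebraMap ℚ ℂ)

/-- The exponential of the action of `x ∈ N` on the associated graded space; this action is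
nilpotent. -/
def grExp [Module.Finite ℂ M] (x : N) : LinearMap.GeneralLinearGroup ℂ (PBWGraded ρ v) :=
  IsUnit.unit (a := IsNilpotent.exp (grAct ρ v x))
    (IsNilpotent.isUnit_exp (grAct_isNilpotent ρ v x))

lemma grOp_zero_mul (S T : Module.End ℂ M) (hS hT hST) :
    grOp ρ v S 0 hS * grOp ρ v T 0 hT = grOp ρ v (S * T) 0 hST := by
  refine gr_ext ρ v fun s y => ?_
  obtain ⟨y, rfl⟩ := Submodule.mkQ_surjective _ y
  simp only [Module.End.mul_apply, grOp_of]
  rfl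

lemma grOp_zero_one (h) : grOp ρ v 1 0 h = 1 := by
  refine gr_ext ρ v fun s y => ?_
  obtain ⟨y, rfl⟩ := Submodule.mkQ_surjective _ y
  simp only [Module.End.one_apply, grOp_of]
  rfl

/-- The invertible operator of degree `0` on the associated graded space induced by an invertible
operator `T` that, like its inverse, preserves the filtration. -/
def grUnit (T : LinearMap.GeneralLinearGroup ℂ M)
    (h : ∀ s, pbwLT ρ v s ≤ (pbwLT ρ v s).comap (T : Module.End ℂ M))
    (h' : ∀ s, pbwLT ρ v s ≤ (pbwLT ρ v s).comap ((T⁻¹ :) : Module.End ℂ M)) :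
    LinearMap.GeneralLinearGroup ℂ (PBWGraded ρ v) where
  val := grOp ρ v T 0 h
  inv := grOp ρ v ((T⁻¹ :) : Module.End ℂ M) 0 h'
  val_inv := by
    rw [grOp_zero_mul ρ v _ _ _ _ (by rw [Units.mul_inv]; exact fun _ _ hx => hx)]
    simp only [Units.mul_inv, grOp_zero_one]
  inv_val := by
    rw [grOp_zero_mul ρ v _ _ _ _ (by rw [Units.inv_mul]; exact fun _ _ hx => hx)]
    simp only [Units.inv_mul, grOp_zero_one]

lemma pbwLT_zero : pbwLT ρ v 0 = ⊥ := by simp [pbwLT]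

/-- The class in degree `0` of the cyclic vector `v`. -/
def grVec : PBWGraded ρ v := pbwClass ρ v 0 ⟨v, word_mem_pbwLT ρ v [] Nat.zero_lt_one⟩

lemma grVec_ne_zero (hv : v ≠ 0) : grVec ρ v ≠ 0 := by
  intro h
  have h1 : (DirectSum.lof ℂ ℕ (PBWPiece ρ v) 0) (Submodule.Quotient.mk
      ⟨v, word_mem_pbwLT ρ v [] Nat.zero_lt_one⟩) = 0 := h
  have h2 := DirectSum.of_injective (β := PBWPiece ρ v) 0 (h1.trans (map_zero _).symm)
  rw [Submodule.Quotient.mk_eq_zero] at h2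
  have h3 : v ∈ pbwLT ρ v 0 := h2
  rw [pbwLT_zero] at h3
  exact hv h3

end PBW

/-! ### Exterior powers -/

section Exterior

variable {V V' : Type*} [AddCommGroup V] [Module ℂ V] [AddCommGroup V'] [Module ℂ V']

lemma derAux (k : ℕ) (X : Module.End ℂ V) (w : Fin k → V) :
    (∑ i, (exteriorPower.ιMulti ℂ k).toMultilinearMap.compLinearMap
      fun j => if j = i then X else LinearMap.id) w =
      ∑ i, exteriorPower.ιMulti ℂ k (Function.update w i (X (w i))) := by
  rw [sum_apply]
  refine Finset.sum_congr rfl fun i _ => congrArg (exteriorPower.ιMulti ℂ k) ?_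
  funext j
  by_cases hj : j = i
  · subst hj; simp
  · simp [hj]

/-- The alternating map `(v₁, …, v_k) ↦ ∑ᵢ v₁ ∧ ⋯ ∧ X vᵢ ∧ ⋯ ∧ v_k`. -/
def derAlt (k : ℕ) (X : Module.End ℂ V) : V [⋀^Fin k]→ₗ[ℂ] ⋀[ℂ]^k V where
  toMultilinearMap := ∑ i, (exteriorPower.ιMulti ℂ k).toMultilinearMap.compLinearMap
    fun j => if j = i then X else LinearMap.id
  map_eq_zero_of_eq' := by
    intro w a b hab hne
    refine (derAux k X w).trans ?_
    rw [Finset.sum_eq_add a b hne]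
    · have : Function.update w b (X (w b)) =
          Function.update w a (X (w a)) ∘ Equiv.swap a b := by
        funext j
        rcases eq_or_ne j a with rfl | hja
        · simp [hne, hne.symm, hab]
        · rcases eq_or_ne j b with rfl | hjb
          · simp [hab]
          · simp [Equiv.swap_apply_of_ne_of_ne, hja, hjb]
      rw [this, AlternatingMap.map_swap _ _ hne, add_neg_cancel]
    · rintro c - ⟨hca, hcb⟩
      refine AlternatingMap.map_eq_zero_of_eq _ _ ?_ hne
      simp [hca.symm, hcb.symm, hab]
    · simp
    · simp

lemma derAlt_apply (k : ℕ) (X : Module.End ℂ V) (w : Fin k → V) :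
    derAlt k X w = ∑ i, exteriorPower.ιMulti ℂ k (Function.update w i (X (w i))) :=
  derAux k X w

/-- The action of `X ∈ End V` on `Λᵏ V` as a derivation:
`X (v₁ ∧ ⋯ ∧ v_k) = ∑ᵢ v₁ ∧ ⋯ ∧ X vᵢ ∧ ⋯ ∧ v_k`. -/
def der (k : ℕ) : Module.End ℂ V →ₗ[ℂ] Module.End ℂ (⋀[ℂ]^k V) where
  toFun X := exteriorPower.alternatingMapLinearEquiv (derAlt k X)
  map_add' X Y := by
    refine exteriorPower.linearMap_ext (AlternatingMap.ext fun w => ?_)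
    simp [derAlt_apply, Finset.sum_add_distrib]
  map_smul' c X := by
    refine exteriorPower.linearMap_ext (AlternatingMap.ext fun w => ?_)
    simp [derAlt_apply, Finset.smul_sum]

lemma der_ιMulti (k : ℕ) (X : Module.End ℂ V) (w : Fin k → V) :
    der k X (exteriorPower.ιMulti ℂ k w) =
      ∑ i, exteriorPower.ιMulti ℂ k (Function.update w i (X (w i))) := by
  simp [der, derAlt_apply]

lemma der_natural (k : ℕ) (f : V →ₗ[ℂ] V') (X : Module.End ℂ V) (Y : Module.End ℂ V')
    (h : f ∘ₗ X = Y ∘ₗ f) (x : ⋀[ℂ]^k V) :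
    exteriorPower.map k f (der k X x) = der k Y (exteriorPower.map k f x) := by
  suffices H : exteriorPower.map k f ∘ₗ der k X = der k Y ∘ₗ exteriorPower.map k f from
    LinearMap.congr_fun H x
  refine exteriorPower.linearMap_ext (AlternatingMap.ext fun w => ?_)
  have h' : ∀ y, f (X y) = Y (f y) := LinearMap.congr_fun h
  simp only [LinearMap.compAlternatingMap_apply, LinearMap.comp_apply, der_ιMulti, map_sum,
    exteriorPower.map_apply_ιMulti]
  refine Finset.sum_congr rfl fun i _ => ?_
  rw [Function.comp_update, h']
  rfl

lemma der_lie (k : ℕ) (X Y : Module.End ℂ V) :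
    der k (X * Y - Y * X) = der k X * der k Y - der k Y * der k X := by
  refine exteriorPower.linearMap_ext (AlternatingMap.ext fun w => ?_)
  simp only [LinearMap.compAlternatingMap_apply, LinearMap.sub_apply,
    Module.End.mul_apply, der_ιMulti, map_sum]
  conv_rhs => arg 2; rw [Finset.sum_comm]
  simp only [← Finset.sum_sub_distrib]
  refine Finset.sum_congr rfl fun i _ => ?_
  rw [Finset.sum_eq_single i]
  · simp
  · intro j _ hj
    rw [Function.update_of_ne hj, Function.update_of_ne hj.symm, Function.update_comm hj, sub_self]
  · simp

/-- For a `k`-dimensional subspace `U ⊆ V` the image of `Λᵏ U` in `Λᵏ V` is a line. -/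
lemma finrank_range_map (k : ℕ) (U : Submodule ℂ V) [Module.Finite ℂ U]
    (h : Module.finrank ℂ U = k) :
    Module.finrank ℂ (LinearMap.range (exteriorPower.map k U.subtype)) = 1 := by
  rw [LinearMap.finrank_range_of_inj
    (exteriorPower.map_injective_field U.injective_subtype),
    exteriorPower.finrank_eq, h, Nat.choose_self]

end Exterior

/-! ### The symplectic space, group and Lie algebra -/

/-- The space `W` with basis `w₁, …, w_{2n}`; here the basis vectors are `w_{i+1} = Pi.single i 1`,
`i = 0, …, 2n - 1`. -/
abbrev W (n : ℕ) : Type := Fin (2 * n) → ℂ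

/-- The symplectic form: `⟨w_i, w_{2n+1-i}⟩ = 1` for `1 ≤ i ≤ n`, and `⟨w_i, w_j⟩ = 0` for
`i + j ≠ 2n + 1`. -/
def form (n : ℕ) : LinearMap.BilinForm ℂ (W n) :=
  Matrix.toBilin' (Matrix.of fun i j : Fin (2 * n) =>
    if j = i.rev then (if i.val < n then (1 : ℂ) else -1) else 0)

lemma form_single (n : ℕ) (x : W n) (i : Fin (2 * n)) :
    form n (Pi.single i 1) x = (if i.val < n then (1 : ℂ) else -1) * x i.rev := by
  rw [form, Matrix.toBilin'_apply]
  rw [Finset.sum_eq_single i]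
  · rw [Finset.sum_eq_single i.rev]
    · simp
    · intro j _ hj
      simp [hj]
    · simp
  · intro j _ hj
    simp [hj]
  · simp

lemma form_swap (n : ℕ) (x y : W n) : form n x y = - form n y x := by
  simp only [form, Matrix.toBilin'_apply, ← Finset.sum_neg_distrib]
  rw [Finset.sum_comm]
  refine Finset.sum_congr rfl fun j _ => Finset.sum_congr rfl fun i _ => ?_
  simp only [Matrix.of_apply]
  by_cases h : j = i.rev
  · subst h
    have h1 : (i.rev.val < n) ↔ ¬ i.val < n := by
      rw [Fin.val_rev]; omega
    rw [if_pos rfl, if_pos (Fin.rev_rev i).symm]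
    simp only [h1]
    by_cases h2 : i.val < n
    · simp only [h2, not_true, if_true, if_false]; ring
    · simp only [h2, not_false_eq_true, if_true, if_false]; ring
  · have h3 : i ≠ j.rev := fun h' => h (by rw [h', Fin.rev_rev])
    simp [h, h3]

/-- A subspace is isotropic if the symplectic form vanishes on it. -/
def IsIsotropic {n : ℕ} (U : Submodule ℂ (W n)) : Prop :=
  ∀ x ∈ U, ∀ y ∈ U, form n x y = 0

/-- The span of the basis vectors with index (counted from `0`) in `S`. -/
def coordSpan (n : ℕ) (S : Set ℕ) : Submodule ℂ (W n) :=
  Submodule.span ℂ {w | ∃ i : Fin (2 * n), i.val ∈ S ∧ w = Pi.single i 1}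

open Classical in
/-- The projection onto `coordSpan n S` that sends the other basis vectors to `0`. -/
def coordProj (n : ℕ) (S : Set ℕ) : W n →ₗ[ℂ] W n :=
  LinearMap.pi fun i => if i.val ∈ S then LinearMap.proj i else 0

/-- The first `k` indices. -/
def idx1 (k : ℕ) : Set ℕ := {i | i < k}

/-- The indices `k, …, 2n - k - 1` in the middle. -/
def idx2 (n k : ℕ) : Set ℕ := {i | k ≤ i ∧ i + k < 2 * n}

/-- The last `k` indices. -/
def idx3 (n k : ℕ) : Set ℕ := {i | 2 * n ≤ i + k ∧ i < 2 * n}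

/-- `W_{k,1} = span(w₁, …, w_k)`. -/
def W1 (n k : ℕ) : Submodule ℂ (W n) := coordSpan n (idx1 k)

/-- `W_{k,2} = span(w_{k+1}, …, w_{2n-k})`. -/
def W2 (n k : ℕ) : Submodule ℂ (W n) := coordSpan n (idx2 n k)

/-- `W_{k,3} = span(w_{2n-k+1}, …, w_{2n})`. -/
def W3 (n k : ℕ) : Submodule ℂ (W n) := coordSpan n (idx3 n k)

/-- The projection `pr_{1,3}` of `W` onto `W_{k,1} ⊕ W_{k,3}` along `W_{k,2}`. -/
def pr13 (n k : ℕ) : W n →ₗ[ℂ] W n := coordProj n (idx1 k ∪ idx3 n k)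

/-- The symplectic group `Sp_{2n}` of all automorphisms of `W` preserving the form. -/
def Sp (n : ℕ) : Subgroup (W n ≃ₗ[ℂ] W n) where
  carrier := {g | ∀ x y, form n (g x) (g y) = form n x y}
  mul_mem' {g h} hg hh x y := (hg _ _).trans (hh x y)
  one_mem' _ _ := rfl
  inv_mem' {g} hg x y := by
    rw [← hg]
    exact congrArg₂ (fun a b => form n a b) (g.apply_symm_apply x) (g.apply_symm_apply y)

/-- The Borel subgroup of upper triangular matrices in `Sp_{2n}`, i.e. of those elements that
stabilize all the subspaces `span(w₁, …, w_m)`. -/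
def Borel (n : ℕ) : Subgroup (W n ≃ₗ[ℂ] W n) where
  carrier := {g | g ∈ Sp n ∧ ∀ m, (W1 n m).map (g : W n →ₗ[ℂ] W n) = W1 n m}
  mul_mem' {g h} hg hh := ⟨mul_mem hg.1 hh.1, fun m => by
    have : ((g * h : W n ≃ₗ[ℂ] W n) : W n →ₗ[ℂ] W n) = (g : W n →ₗ[ℂ] W n) ∘ₗ h := rfl
    rw [this, Submodule.map_comp, hh.2, hg.2]⟩
  one_mem' := ⟨one_mem _, fun m => Submodule.map_id _⟩
  inv_mem' {g} hg := ⟨inv_mem hg.1, fun m => by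
    conv_lhs => rw [← hg.2 m]
    rw [← Submodule.map_comp]
    have : ((g⁻¹ : W n ≃ₗ[ℂ] W n) : W n →ₗ[ℂ] W n) ∘ₗ (g : W n →ₗ[ℂ] W n) = LinearMap.id :=
      LinearMap.ext fun x => g.symm_apply_apply x
    rw [this, Submodule.map_id]⟩

/-- The subgroup `Sp_{2k} ⊆ Sp_{2n}` acting only on the first and the last `k` coordinates. -/
def SpSub (n k : ℕ) : Subgroup (W n ≃ₗ[ℂ] W n) where
  carrier := {g | g ∈ Sp n ∧ (∀ x ∈ W2 n k, g x = x) ∧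
    (W1 n k ⊔ W3 n k).map (g : W n →ₗ[ℂ] W n) = W1 n k ⊔ W3 n k}
  mul_mem' {g h} hg hh := ⟨mul_mem hg.1 hh.1,
    fun x hx => (congrArg g (hh.2.1 x hx)).trans (hg.2.1 x hx), by
    have : ((g * h : W n ≃ₗ[ℂ] W n) : W n →ₗ[ℂ] W n) = (g : W n →ₗ[ℂ] W n) ∘ₗ h := rfl
    rw [this, Submodule.map_comp, hh.2.2, hg.2.2]⟩
  one_mem' := ⟨one_mem _, fun _ _ => rfl, Submodule.map_id _⟩
  inv_mem' {g} hg := ⟨inv_mem hg.1,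
    fun x hx => (congrArg g.symm (hg.2.1 x hx)).symm.trans (g.symm_apply_apply x), by
    conv_lhs => rw [← hg.2.2]
    rw [← Submodule.map_comp]
    have : ((g⁻¹ : W n ≃ₗ[ℂ] W n) : W n →ₗ[ℂ] W n) ∘ₗ (g : W n →ₗ[ℂ] W n) = LinearMap.id :=
      LinearMap.ext fun x => g.symm_apply_apply x
    rw [this, Submodule.map_id]⟩

/-- The Lie algebra `𝔰𝔭_{2n}` (as a vector space), which consists of the endomorphisms `X` of `W`
with `⟨X x, y⟩ + ⟨x, X y⟩ = 0`. -/
def spLie (n : ℕ) : Submodule ℂ (Module.End ℂ (W n)) := (form n).skewAdjointSubmodule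

lemma mem_spLie {n : ℕ} {X : Module.End ℂ (W n)} :
    X ∈ spLie n ↔ ∀ x y, form n (X x) y = - form n x (X y) := by
  refine (LinearMap.mem_skewAdjointSubmodule _).trans
    (forall_congr' fun x => forall_congr' fun y => ?_)
  simp

lemma lie_mem_spLie {n : ℕ} {X Y : Module.End ℂ (W n)} (hX : X ∈ spLie n) (hY : Y ∈ spLie n) :
    X * Y - Y * X ∈ spLie n := by
  rw [mem_spLie] at *
  intro x y
  simp [hX, hY]

lemma conj_mem_spLie {n : ℕ} {X : Module.End ℂ (W n)} (hX : X ∈ spLie n) {g : W n ≃ₗ[ℂ] W n}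
    (hg : g ∈ Sp n) : g.conj X ∈ spLie n := by
  rw [mem_spLie] at *
  intro x y
  have hg : ∀ x y, form n (g x) (g y) = form n x y := hg
  obtain ⟨x, rfl⟩ := g.surjective x
  obtain ⟨y, rfl⟩ := g.surjective y
  simp [LinearEquiv.conj_apply, hg, hX]

/-- The subalgebra `𝔫⁻` of strictly lower triangular matrices in `𝔰𝔭_{2n}` (as a vector space). -/
def nMinus (n : ℕ) : Submodule ℂ (Module.End ℂ (W n)) where
  carrier := {X | X ∈ spLie n ∧ ∀ i j, i ≤ j → X (Pi.single j 1) i = 0}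
  add_mem' hX hY := ⟨add_mem hX.1 hY.1, fun i j h => by simp [hX.2 i j h, hY.2 i j h]⟩
  zero_mem' := ⟨zero_mem _, fun _ _ _ => rfl⟩
  smul_mem' c X hX := ⟨Submodule.smul_mem _ c hX.1, fun i j h => by simp [hX.2 i j h]⟩

/-- The action of `𝔫⁻` on `Λᵏ W`. -/
def rho (n k : ℕ) : nMinus n →ₗ[ℂ] Module.End ℂ (⋀[ℂ]^k (W n)) :=
  der k ∘ₗ (nMinus n).subtype

/-- The highest weight vector `w₁ ∧ ⋯ ∧ w_k` of `V_{ω_k} ⊆ Λᵏ W`. -/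
def hwVec (n k : ℕ) (hkn : k ≤ n) : ⋀[ℂ]^k (W n) :=
  exteriorPower.ιMulti ℂ k fun i : Fin k =>
    (Pi.single (Fin.castLE (by omega : k ≤ 2 * n) i) 1 : W n)


lemma hwVec_mem (n k : ℕ) (hkn : k ≤ n) :
    hwVec n k hkn ∈ LinearMap.range (exteriorPower.map k (W1 n k).subtype) := by
  refine ⟨exteriorPower.ιMulti ℂ k fun i : Fin k =>
    ⟨Pi.single (Fin.castLE (by omega : k ≤ 2 * n) i) 1, Submodule.subset_span ⟨Fin.castLE (by omega) i, i.2, rfl⟩⟩, ?_⟩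
  rw [exteriorPower.map_apply_ιMulti]
  rfl

lemma hwVec_ne_zero (n k : ℕ) (hkn : k ≤ n) : hwVec n k hkn ≠ 0 := by
  intro h
  have h1 := congrArg (exteriorPower.alternatingMapLinearEquiv
    ((Matrix.detRowAlternating (n := Fin k) (R := ℂ)).compLinearMap
      (LinearMap.funLeft ℂ ℂ (Fin.castLE (by omega : k ≤ 2 * n))))) h
  rw [hwVec, exteriorPower.alternatingMapLinearEquiv_apply_ιMulti, map_zero] at h1
  have h2 : (fun i : Fin k => LinearMap.funLeft ℂ ℂ (Fin.castLE (by omega : k ≤ 2 * n))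
      (Pi.single (Fin.castLE (by omega : k ≤ 2 * n) i) 1 : W n)) = (1 : Matrix (Fin k) (Fin k) ℂ) := by
    funext i j
    simp [LinearMap.funLeft_apply, Pi.single_apply, Matrix.one_apply, eq_comm]
  have h3 : Matrix.det (1 : Matrix (Fin k) (Fin k) ℂ) = 0 := by rw [← h2]; exact h1
  simp at h3

lemma finrank_W1 (n k : ℕ) (hkn : k ≤ n) : Module.finrank ℂ (W1 n k) = k := by
  have h : W1 n k = Submodule.span ℂ (Set.range fun i : Fin k =>
      (Pi.single (Fin.castLE (by omega : k ≤ 2 * n) i) 1 : W n)) := by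
    refine congrArg (Submodule.span ℂ) (Set.ext fun w => ⟨?_, ?_⟩)
    · rintro ⟨i, hi, rfl⟩
      exact ⟨⟨i.val, hi⟩, rfl⟩
    · rintro ⟨i, rfl⟩
      exact ⟨Fin.castLE (by omega) i, i.2, rfl⟩
  have hli := (Pi.basisFun ℂ (Fin (2 * n))).linearIndependent.comp _
    (Fin.castLE_injective (by omega : k ≤ 2 * n))
  rw [h, finrank_span_eq_card, Fintype.card_fin]
  convert hli using 2 with i
  simp

lemma range_eq_span (n k : ℕ) (hkn : k ≤ n) :
    LinearMap.range (exteriorPower.map k (W1 n k).subtype) = ℂ ∙ hwVec n k hkn := by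
  refine (Submodule.eq_of_le_of_finrank_eq ?_ ?_).symm
  · rw [Submodule.span_singleton_le_iff_mem]
    exact hwVec_mem n k hkn
  · rw [finrank_range_map k _ (finrank_W1 n k hkn), finrank_span_singleton (hwVec_ne_zero n k hkn)]

lemma der_hwVec (n k : ℕ) (hkn : k ≤ n) (X : Module.End ℂ (W n))
    (hX : ∀ x ∈ W1 n k, X x ∈ W1 n k) : der k X (hwVec n k hkn) ∈ ℂ ∙ hwVec n k hkn := by
  rw [← range_eq_span]
  obtain ⟨y, hy⟩ := hwVec_mem n k hkn
  exact ⟨der k (X.restrict hX) y, by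
    rw [← hy]; exact der_natural k _ (X.restrict hX) X (LinearMap.ext fun _ => rfl) y⟩

lemma map_hwVec (n k : ℕ) (hkn : k ≤ n) (g : W n →ₗ[ℂ] W n)
    (hg : ∀ x ∈ W1 n k, g x ∈ W1 n k) :
    exteriorPower.map k g (hwVec n k hkn) ∈ ℂ ∙ hwVec n k hkn := by
  rw [← range_eq_span]
  obtain ⟨y, hy⟩ := hwVec_mem n k hkn
  refine ⟨exteriorPower.map k (g.restrict hg) y, ?_⟩
  rw [← hy, ← LinearMap.comp_apply, ← LinearMap.comp_apply, ← exteriorPower.map_comp,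
    ← exteriorPower.map_comp]
  rfl

/-- The span of the words of length `< s` in elements of `𝔰𝔭_{2n}` applied to the highest weight
vector. -/
def spLT (n k : ℕ) (hkn : k ≤ n) (s : ℕ) : Submodule ℂ (⋀[ℂ]^k (W n)) :=
  pbwLT (der k ∘ₗ (spLie n).subtype) (hwVec n k hkn) s

lemma mem_spLie_iff_entries {n : ℕ} {X : Module.End ℂ (W n)} :
    X ∈ spLie n ↔ ∀ i j : Fin (2 * n),
      (if j.val < n then (1 : ℂ) else -1) * X (Pi.single i 1) j.rev =
        (if i.val < n then (1 : ℂ) else -1) * X (Pi.single j 1) i.rev := by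
  rw [mem_spLie]
  constructor
  · intro h i j
    have := h (Pi.single i 1) (Pi.single j 1)
    rw [form_swap, form_single, form_single] at this
    exact neg_injective this
  · intro h
    suffices H : (form n).comp X LinearMap.id = - (form n).comp LinearMap.id X from
      fun x y => LinearMap.congr_fun₂ H x y
    refine LinearMap.ext_basis (Pi.basisFun ℂ _) (Pi.basisFun ℂ _) fun i j => ?_
    have h1 : form n (X (Pi.single i 1)) (Pi.single j 1) =
        - form n (Pi.single i 1) (X (Pi.single j 1)) := by
      rw [form_swap, form_single, form_single, h]
    simpa using h1

/-- Every element of `𝔰𝔭_{2n}` is the sum of a strictly lower triangular and an upper triangular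
one. -/
lemma spLie_decomp {n : ℕ} {X : Module.End ℂ (W n)} (hX : X ∈ spLie n) :
    ∃ Y ∈ nMinus n, ∃ Z ∈ spLie n, (∀ m, ∀ x ∈ W1 n m, Z x ∈ W1 n m) ∧ X = Y + Z := by
  let Y : Module.End ℂ (W n) := Matrix.toLin' (Matrix.of fun i j : Fin (2 * n) =>
    if j < i then X (Pi.single j 1) i else 0)
  have hY : ∀ i j, Y (Pi.single j 1) i = if j < i then X (Pi.single j 1) i else 0 := by
    intro i j
    simp [Y]
  have hYs : Y ∈ spLie n := by
    rw [mem_spLie_iff_entries] at hX ⊢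
    intro i j
    have h1 : i < j.rev ↔ j < i.rev := by
      rw [Fin.lt_def, Fin.lt_def, Fin.val_rev, Fin.val_rev]; omega
    simp only [hY, h1]
    by_cases h2 : j < i.rev
    · simpa only [h2, if_true] using hX i j
    · simp [h2]
  refine ⟨Y, ⟨hYs, fun i j hij => by rw [hY, if_neg (not_lt.2 hij)]⟩, X - Y, sub_mem hX hYs, ?_,
    by abel⟩
  intro m
  suffices H : W1 n m ≤ (W1 n m).comap (X - Y) from H
  refine Submodule.span_le.2 ?_
  rintro _ ⟨j, hj, rfl⟩
  have h1 : (X - Y) (Pi.single j 1) =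
      ∑ i, ((X - Y) (Pi.single j 1) i) • (Pi.single i 1 : W n) := by
    conv_lhs => rw [pi_eq_sum_univ' ((X - Y) (Pi.single j 1))]
  change (X - Y) (Pi.single j 1) ∈ W1 n m
  rw [h1]
  refine sum_mem fun i _ => ?_
  by_cases hij : j < i
  · have : (X - Y) (Pi.single j 1) i = 0 := by
      rw [LinearMap.sub_apply, Pi.sub_apply, hY, if_pos hij, sub_self]
    rw [this, zero_smul]
    exact zero_mem _
  · exact Submodule.smul_mem _ _ (Submodule.subset_span
      ⟨i, lt_of_le_of_lt (Fin.le_def.1 (not_lt.1 hij)) hj, rfl⟩)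

lemma spLT_upper {n k : ℕ} (hkn : k ≤ n) {Z : Module.End ℂ (W n)} (hZ : Z ∈ spLie n)
    (hZ1 : ∀ x ∈ W1 n k, Z x ∈ W1 n k) (l : List (spLie n)) :
    der k Z ((l.map (der k ∘ₗ (spLie n).subtype)).prod (hwVec n k hkn)) ∈
      spLT n k hkn (l.length + 1) := by
  induction l with
  | nil =>
    have h := der_hwVec n k hkn Z hZ1
    refine (Submodule.span_singleton_le_iff_mem _ _).2 ?_ h
    exact word_mem_pbwLT _ _ [] (by simp)
  | cons x l ih =>
    have h1 : der k Z * der k x.1 =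
        der k x.1 * der k Z + der k (Z * x.1 - x.1 * Z) := by
      rw [der_lie]; abel
    have h2 := LinearMap.congr_fun h1
      ((l.map (der k ∘ₗ (spLie n).subtype)).prod (hwVec n k hkn))
    rw [List.map_cons, List.prod_cons]
    refine h2 ▸ add_mem ?_ ?_
    · exact pbwLT_act (der k ∘ₗ (spLie n).subtype) (hwVec n k hkn) x _ ih
    · exact word_mem_pbwLT (der k ∘ₗ (spLie n).subtype) (hwVec n k hkn)
        (⟨_, lie_mem_spLie hZ x.2⟩ :: l) (by simp)

lemma spLT_le {n k : ℕ} (hkn : k ≤ n) (s : ℕ) :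
    spLT n k hkn s ≤ pbwLT (rho n k) (hwVec n k hkn) s := by
  induction s with
  | zero => simp [spLT, pbwLT_zero]
  | succ s ih =>
    refine Submodule.span_le.2 ?_
    rintro _ ⟨l, hl, rfl⟩
    cases l with
    | nil => exact word_mem_pbwLT _ _ [] (by simp)
    | cons x l =>
      simp only [List.length_cons, Nat.add_lt_add_iff_right] at hl
      obtain ⟨Y, hY, Z, hZ, hZ1, hx⟩ := spLie_decomp x.2
      rw [List.map_cons, List.prod_cons]
      have h1 : (der k ∘ₗ (spLie n).subtype) x = rho n k ⟨Y, hY⟩ + der k Z := by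
        simp [rho, hx]
      rw [h1]
      refine add_mem ?_ ?_
      · exact pbwLT_act _ _ _ _ (ih (word_mem_pbwLT _ _ l hl))
      · exact pbwLT_mono _ _ (Nat.le_succ s)
          (ih (pbwLT_mono _ _ hl (spLT_upper hkn hZ (hZ1 k) l)))

/-- The action of `B` on `Λᵏ W` preserves the PBW filtration. -/
lemma borel_pbwLT {n k : ℕ} (hkn : k ≤ n) {g : W n ≃ₗ[ℂ] W n} (hg : g ∈ Borel n) (s : ℕ) :
    pbwLT (rho n k) (hwVec n k hkn) s ≤
      (pbwLT (rho n k) (hwVec n k hkn) s).comap (exteriorPower.map k (g : W n →ₗ[ℂ] W n)) := by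
  refine Submodule.span_le.2 ?_
  rintro _ ⟨l, hl, rfl⟩
  refine spLT_le hkn s (pbwLT_mono _ _ hl ?_)
  clear hl
  induction l with
  | nil =>
    refine (Submodule.span_singleton_le_iff_mem _ _).2 ?_ (map_hwVec n k hkn g ?_)
    · exact word_mem_pbwLT _ _ [] (by simp)
    · intro x hx
      rw [← hg.2 k]
      exact Submodule.mem_map_of_mem hx
  | cons x l ih =>
    rw [List.map_cons, List.prod_cons, Module.End.mul_apply]
    have h := der_natural k (g : W n →ₗ[ℂ] W n) (x : Module.End ℂ (W n))
      (g.conj (x : Module.End ℂ (W n))) (by ext; simp [LinearEquiv.conj_apply])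
      ((l.map (rho n k)).prod (hwVec n k hkn))
    refine h ▸ ?_
    exact pbwLT_act (der k ∘ₗ (spLie n).subtype) (hwVec n k hkn)
      ⟨_, conj_mem_spLie x.2.1 hg.1⟩ _ ih

/-- `g ∈ GL(W)` as an element of `GL(Λᵏ W)`. -/
def extUnit (n k : ℕ) (g : W n ≃ₗ[ℂ] W n) : LinearMap.GeneralLinearGroup ℂ (⋀[ℂ]^k (W n)) where
  val := exteriorPower.map k (g : W n →ₗ[ℂ] W n)
  inv := exteriorPower.map k ((g⁻¹ : W n ≃ₗ[ℂ] W n) : W n →ₗ[ℂ] W n)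
  val_inv := by
    rw [Module.End.mul_eq_comp, ← exteriorPower.map_comp, Module.End.one_eq_id,
      ← exteriorPower.map_id]
    congr 1
    exact LinearMap.ext fun x => g.apply_symm_apply x
  inv_val := by
    rw [Module.End.mul_eq_comp, ← exteriorPower.map_comp, Module.End.one_eq_id,
      ← exteriorPower.map_id]
    congr 1
    exact LinearMap.ext fun x => g.symm_apply_apply x

/-! ### The degenerate symplectic Grassmannian -/

/-- The degenerate fundamental representation `V_{ω_k}ᵃ`: the associated graded space for the PBW
filtration on `V_{ω_k} = U(𝔫⁻)(w₁ ∧ ⋯ ∧ w_k) ⊆ Λᵏ W`. -/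
abbrev Va (n k : ℕ) (hkn : k ≤ n) : Type := PBWGraded (rho n k) (hwVec n k hkn)

/-- The action of an element of the abelian Lie algebra `(𝔫⁻)ᵃ` on `V_{ω_k}ᵃ`. -/
def actA (n k : ℕ) (hkn : k ≤ n) (f : nMinus n) : Module.End ℂ (Va n k hkn) :=
  grAct (rho n k) (hwVec n k hkn) f

/-- The action of the element `exp f` of the abelian group `(N⁻)ᵃ` on `V_{ω_k}ᵃ`. -/
def expA (n k : ℕ) (hkn : k ≤ n) (f : nMinus n) :
    LinearMap.GeneralLinearGroup ℂ (Va n k hkn) :=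
  grExp (rho n k) (hwVec n k hkn) f

/-- The action of `b ∈ B` on `V_{ω_k}ᵃ`. -/
def borelA (n k : ℕ) (hkn : k ≤ n) (b : Borel n) :
    LinearMap.GeneralLinearGroup ℂ (Va n k hkn) :=
  grUnit (rho n k) (hwVec n k hkn) (extUnit n k b) (borel_pbwLT hkn b.2)
    (borel_pbwLT hkn (inv_mem b.2))

/-- The group of operators on `V_{ω_k}ᵃ` by which `Gᵃ = B ⋉ (N⁻)ᵃ` acts. -/
def Ga (n k : ℕ) (hkn : k ≤ n) : Subgroup (LinearMap.GeneralLinearGroup ℂ (Va n k hkn)) :=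
  Subgroup.closure (Set.range (borelA n k hkn) ∪ Set.range (expA n k hkn))

/-- The highest weight vector of `V_{ω_k}ᵃ`. -/
def hwA (n k : ℕ) (hkn : k ≤ n) : Va n k hkn := grVec (rho n k) (hwVec n k hkn)

lemma hwA_ne_zero (n k : ℕ) (hkn : k ≤ n) : hwA n k hkn ≠ 0 :=
  grVec_ne_zero _ _ (hwVec_ne_zero n k hkn)

/-- The degenerate symplectic Grassmannian `SpGrᵃ_k(W) = Spℱᵃ_{ω_k}`: the closure in
`ℙ(V_{ω_k}ᵃ)` of the `Gᵃ`-orbit of the highest weight line. -/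
def SpGrA (n k : ℕ) (hkn : k ≤ n) : Set (ℙ ℂ (Va n k hkn)) :=
  @closure _ (zariski (Va n k hkn))
    (MulAction.orbit (Ga n k hkn) (Projectivization.mk ℂ (hwA n k hkn) (hwA_ne_zero n k hkn)))

/-- The Grassmannian of `k`-dimensional subspaces of `W`. -/
abbrev Gr (n k : ℕ) : Type := {U : Submodule ℂ (W n) // Module.finrank ℂ U = k}

/-- The Plücker embedding of `Gr_k(W)` into `ℙ(Λᵏ W)`, which maps `U` to the line `Λᵏ U`. -/
def plucker (n k : ℕ) (U : Gr n k) : ℙ ℂ (⋀[ℂ]^k (W n)) :=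
  Projectivization.mk'' (LinearMap.range (exteriorPower.map k U.1.subtype))
    (finrank_range_map k U.1 U.2)

/-- The set of `U ∈ Gr_k(W)` such that `pr_{1,3}(U)` is isotropic. -/
def Zk (n k : ℕ) : Set (Gr n k) := {U | IsIsotropic (U.1.map (pr13 n k))}

/-- `Sp_{2k} · Gr_k(W_{k,1} ⊕ W_{k,2})`. -/
def SpDotGr (n k : ℕ) : Set (Gr n k) :=
  {U | ∃ g ∈ SpSub n k, ∃ Y : Gr n k, Y.1 ≤ W1 n k ⊔ W2 n k ∧
    U.1 = Y.1.map (g : W n →ₗ[ℂ] W n)}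

/-- For `f ∈ 𝔫⁻`, the component `W_{k,1} → W_{k,2} ⊕ W_{k,3}` of `f`, extended by `0`. -/
def lowerBlock (n k : ℕ) (f : Module.End ℂ (W n)) : Module.End ℂ (W n) :=
  coordProj n (idx2 n k ∪ idx3 n k) ∘ₗ f ∘ₗ coordProj n (idx1 k)

end DegSymp

end

/-!
The wedge power `Λᵏ W` is graded by the number of factors outside of `W_{k,1}`. The corresponding
number operator is `N = der k (pr23 n k)`. An element `f` of `𝔫⁻` is the sum of its lower block `f_k`,
which raises the degree by one, and of an operator of degree zero. Hence a word of length `s` in `𝔫⁻`,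
applied to `v`, has degree at most `s`, and its component of degree `s` is the word in the lower
blocks. The map `ι` sends the class of `y ∈ F_s` to the component of degree `s` of `y`, which is
`N (N - 1) ⋯ (N - s + 1) y / s!` (`iotaPiece`, `fal_word`).

Why `ι` is injective, and what its image is. All vectors of `V_{ω_k}` are annihilated by the
contraction `C` with the symplectic form (`conB (J1 n n)`), as `C` commutes with `𝔰𝔭_{2n}`. Write
`C = C₁₃ + C₂₂`, where `C₁₃ = conB (J1 n k)` belongs to the pairing of `W_{k,1}` with `W_{k,3}`. It
lowers the degree by one and `C₂₂` lowers it by two, so the component of highest degree of a vector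
in the kernel of `C` lies in the kernel of `C₁₃` (`conB_fal`). Conversely, a vector of degree `s` in the
kernel of `C₁₃` is a combination of words of length `s` in the lower blocks, applied to `v`
(`mem_lowWords`). This is shown by two Casimir identities, for the blocks `W_{k,1} → W_{k,3}` and
`W_{k,1} → W_{k,2}`, in each of which a sum of products (lowering operator) ∘ (raising operator) acts by
a nonzero multiple of a number operator. Hence `ι` is injective, and its image is the kernel of `C₁₃`
(`mem_pbwLT_of_fal`, `iota_injective`, `mem_range_iota`).

The orbit. As `B` fixes the highest weight line and normalizes `(N⁻)ᵃ`, the orbit of this line under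
`Gᵃ` is its orbit under `(N⁻)ᵃ` (`orbit_eq_range`), and `ι` maps `exp(f) v` to
`(1 + f_k) w₁ ∧ ⋯ ∧ (1 + f_k) w_k` (`iota_expA`). Any two points of the orbit are joined by a line in
`𝔫⁻`, on which all polynomial functions are polynomials in one variable; so the orbit and its
closure are irreducible.

The closure is contained in `Z_k`: its points satisfy the quadratic Plücker relations, hence are
decomposable (`exists_eq_smul_ιMulti`), and lie in the kernel of `C₁₃`. For a nonzero decomposable
vector with corresponding subspace `U` the latter means that `pr_{1,3}(U)` is isotropic
(`conB_ιMulti_eq_zero`, `om_eq_zero_of_conB`).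

`Z_k` is contained in the closure: the lower blocks of `𝔫⁻` are all maps `W_{k,1} → W_{k,2} ⊕ W_{k,3}`
with symmetric second component (`exists_lowerBlock`), so the `U ∈ Z_k` that project isomorphically to
`W_{k,1}` are points of the orbit (`ιMulti_mem_of_pr1_injective`). If `K = pr_{1,3}(U)` meets
`W_{k,3}`, then a transvection `1 + t E` in `Sp_{2k}` decreases the dimension of the intersection for
all `t ≠ 0` (`exists_transvection`), and `t → 0` gives `U`. If `K` does not meet `W_{k,3}`, then it lies
in the graph of a symmetric map `S : W_{k,1} → W_{k,3}` (`exists_shear`), and `U` is joined by a line to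
a subspace that projects isomorphically to `W_{k,1}`. The same two steps prove
`Z_k = Sp_{2k} · Gr_k(W_{k,1} ⊕ W_{k,2})`, as `1 - S` is an element of `Sp_{2k}` that maps `U` into
`W_{k,1} ⊕ W_{k,2}`.
-/

noncomputable section

namespace DegSymp

/-! ### Contractions on the exterior algebra -/

section Contraction

variable {V : Type*} [AddCommGroup V] [Module ℂ V]

/-- The contraction of the exterior algebra with a linear form. -/
def ctr (φ : Module.Dual ℂ V) : Module.End ℂ (ExteriorAlgebra ℂ V) :=
  CliffordAlgebra.contractLeft (Q := (0 : QuadraticForm ℂ V)) φ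

lemma ctr_ι_mul (φ : Module.Dual ℂ V) (w : V) (x : ExteriorAlgebra ℂ V) :
    ctr φ (ExteriorAlgebra.ι ℂ w * x) = φ w • x - ExteriorAlgebra.ι ℂ w * ctr φ x :=
  CliffordAlgebra.contractLeft_ι_mul (Q := (0 : QuadraticForm ℂ V)) φ w x

lemma ctr_one (φ : Module.Dual ℂ V) : ctr φ (1 : ExteriorAlgebra ℂ V) = 0 :=
  CliffordAlgebra.contractLeft_one (Q := (0 : QuadraticForm ℂ V)) _

lemma ctr_ctr (φ ψ : Module.Dual ℂ V) (x : ExteriorAlgebra ℂ V) :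
    ctr φ (ctr ψ x) = - ctr ψ (ctr φ x) :=
  CliffordAlgebra.contractLeft_comm (Q := (0 : QuadraticForm ℂ V)) φ ψ x

lemma ctr_ctr_self (φ : Module.Dual ℂ V) (x : ExteriorAlgebra ℂ V) : ctr φ (ctr φ x) = 0 :=
  CliffordAlgebra.contractLeft_contractLeft (Q := (0 : QuadraticForm ℂ V)) φ x

lemma ctr_add (φ ψ : Module.Dual ℂ V) : ctr (φ + ψ) = ctr φ + ctr ψ := by
  simp [ctr]

lemma ctr_smul (c : ℂ) (φ : Module.Dual ℂ V) : ctr (c • φ) = c • ctr φ := by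
  simp [ctr]

lemma ctr_zero : ctr (0 : Module.Dual ℂ V) = 0 := by
  simp [ctr]

lemma ctr_sum {ι : Type*} (s : Finset ι) (φ : ι → Module.Dual ℂ V) :
    ctr (∑ i ∈ s, φ i) = ∑ i ∈ s, ctr (φ i) := by
  simp [ctr]

lemma ctr_ιMulti_eq_zero (φ : Module.Dual ℂ V) {m : ℕ} (w : Fin m → V) (hw : ∀ j, φ (w j) = 0) :
    ctr φ (ExteriorAlgebra.ιMulti ℂ m w) = 0 := by
  induction m with
  | zero => rw [ExteriorAlgebra.ιMulti_zero_apply]; exact ctr_one _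
  | succ m ih =>
    have h2 := ih (Matrix.vecTail w) (fun j => hw j.succ)
    rw [ExteriorAlgebra.ιMulti_succ_apply, ctr_ι_mul, h2, hw, zero_smul, mul_zero, sub_zero]

lemma ι_mul_ι_mul (u w : V) (x : ExteriorAlgebra ℂ V) :
    ExteriorAlgebra.ι ℂ u * (ExteriorAlgebra.ι ℂ w * x) =
      - (ExteriorAlgebra.ι ℂ w * (ExteriorAlgebra.ι ℂ u * x)) := by
  rw [← mul_assoc, ← mul_assoc, eq_neg_iff_add_eq_zero, ← add_mul,
    ExteriorAlgebra.ι_add_mul_swap, zero_mul]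

lemma ι_mul_ι_mul_self (u : V) (x : ExteriorAlgebra ℂ V) :
    ExteriorAlgebra.ι ℂ u * (ExteriorAlgebra.ι ℂ u * x) = 0 := by
  rw [← mul_assoc, ExteriorAlgebra.ι_sq_zero, zero_mul]

lemma ι_mul_mem {k : ℕ} (u : V) {x : ExteriorAlgebra ℂ V} (hx : x ∈ ⋀[ℂ]^k V) :
    ExteriorAlgebra.ι ℂ u * x ∈ ⋀[ℂ]^(k + 1) V := by
  have h1 : ExteriorAlgebra.ι ℂ u ∈ ⋀[ℂ]^1 V := by
    rw [ExteriorAlgebra.exteriorPower, pow_one]; exact LinearMap.mem_range_self _ _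
  have h2 := SetLike.mul_mem_graded (A := fun i : ℕ => ⋀[ℂ]^i V) h1 hx
  rwa [add_comm] at h2

lemma ctr_mem {k : ℕ} (φ : Module.Dual ℂ V) {x : ExteriorAlgebra ℂ V}
    (hx : x ∈ ⋀[ℂ]^(k + 1) V) : ctr φ x ∈ ⋀[ℂ]^k V := by
  rw [← ExteriorAlgebra.ιMulti_span_fixedDegree] at hx
  induction hx using Submodule.span_induction with
  | zero => rw [map_zero]; exact zero_mem _
  | add x y _ _ hx hy => rw [map_add]; exact add_mem hx hy
  | smul c x _ hx => rw [map_smul]; exact Submodule.smul_mem _ _ hx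
  | mem x hx =>
    obtain ⟨v, rfl⟩ := hx
    induction k with
    | zero =>
      rw [ExteriorAlgebra.ιMulti_succ_apply, ctr_ι_mul, ExteriorAlgebra.ιMulti_zero_apply, ctr_one,
        mul_zero, sub_zero, ExteriorAlgebra.exteriorPower, pow_zero]
      exact Submodule.smul_mem _ _ (Submodule.one_le.1 le_rfl)
    | succ k ih =>
      rw [ExteriorAlgebra.ιMulti_succ_apply, ctr_ι_mul]
      exact sub_mem (Submodule.smul_mem _ _ (ExteriorAlgebra.ιMulti_range ℂ (k + 1) ⟨_, rfl⟩))
        (ι_mul_mem _ (ih _))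

/-- If `x` is annihilated by the exterior multiplication with `u₁, …, u_m` and `φ₁, …, φ_m` are
linear forms dual to these vectors, then `x = u₁ ∧ ⋯ ∧ u_m ∧ y`, where `y` is an iterated
contraction of `x`. -/
lemma eq_ιMulti_mul {m : ℕ} (u : Fin m → V) (φ : Fin m → Module.Dual ℂ V)
    (hφ : ∀ i j, φ i (u j) = if i = j then 1 else 0) {l : ℕ} {x : ExteriorAlgebra ℂ V}
    (hx : x ∈ ⋀[ℂ]^(l + m) V) (hu : ∀ i, ExteriorAlgebra.ι ℂ (u i) * x = 0) :
    ∃ y ∈ ⋀[ℂ]^l V, x = ExteriorAlgebra.ιMulti ℂ m u * y := by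
  induction m generalizing x with
  | zero => exact ⟨x, hx, by simp⟩
  | succ m ih =>
    have h0 : ExteriorAlgebra.ι ℂ (u 0) * ctr (φ 0) x = x := by
      have := ctr_ι_mul (φ 0) (u 0) x
      rw [hu, map_zero, hφ, if_pos rfl, one_smul] at this
      exact (sub_eq_zero.1 this.symm).symm
    obtain ⟨y, hy, hxy⟩ := ih (fun i => u i.succ) (fun i => φ i.succ)
      (fun i j => by simp [hφ]) (ctr_mem (φ 0) hx) (fun i => by
        have := ctr_ι_mul (φ 0) (u i.succ) x
        rw [hu, map_zero, hφ, if_neg (Fin.succ_ne_zero i).symm, zero_smul, zero_sub] at this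
        exact neg_eq_zero.1 this.symm)
    refine ⟨y, hy, ?_⟩
    rw [ExteriorAlgebra.ιMulti_succ_apply, mul_assoc]
    change x = _ * (ExteriorAlgebra.ιMulti ℂ m (fun i => u i.succ) * y)
    rw [← hxy, h0]

/-- An element of `Λᵐ V` annihilated by the exterior multiplication with the linearly independent
vectors `u₁, …, u_m` is a multiple of `u₁ ∧ ⋯ ∧ u_m`. -/
lemma eq_smul_ιMulti {m : ℕ} (u : Fin m → V) (φ : Fin m → Module.Dual ℂ V)
    (hφ : ∀ i j, φ i (u j) = if i = j then 1 else 0) (x : ⋀[ℂ]^m V)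
    (hu : ∀ i, ExteriorAlgebra.ι ℂ (u i) * (x : ExteriorAlgebra ℂ V) = 0) :
    ∃ c : ℂ, x = c • exteriorPower.ιMulti ℂ m u := by
  obtain ⟨y, hy, hxy⟩ := eq_ιMulti_mul (l := 0) u φ hφ (by rw [zero_add]; exact x.2) hu
  rw [ExteriorAlgebra.exteriorPower, pow_zero, Submodule.mem_one] at hy
  obtain ⟨c, rfl⟩ := hy
  refine ⟨c, Subtype.ext ?_⟩
  rw [hxy, ← Algebra.commutes, ← Algebra.smul_def]
  rfl

lemma der_one (k : ℕ) (x : ⋀[ℂ]^k V) : der k (1 : Module.End ℂ V) x = (k : ℂ) • x := by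
  suffices H : der k (1 : Module.End ℂ V) = (k : ℂ) • LinearMap.id from LinearMap.congr_fun H x
  refine exteriorPower.linearMap_ext (AlternatingMap.ext fun w => ?_)
  simp only [LinearMap.compAlternatingMap_apply, der_ιMulti]
  simp [Nat.cast_smul_eq_nsmul]

end Contraction

/-! ### Creation and annihilation operators -/

section Fermions

variable {n : ℕ}

/-- The exterior multiplication with the basis vector of index `i`. -/
def cr (i : Fin (2 * n)) : Module.End ℂ (ExteriorAlgebra ℂ (W n)) :=
  LinearMap.mulLeft ℂ (ExteriorAlgebra.ι ℂ (Pi.single i 1))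

/-- The contraction with the coordinate of index `i`. -/
def an (i : Fin (2 * n)) : Module.End ℂ (ExteriorAlgebra ℂ (W n)) := ctr (LinearMap.proj i)

lemma an_cr (i j : Fin (2 * n)) :
    an i * cr j = (if i = j then 1 else 0) - cr j * an i := by
  refine LinearMap.ext fun x => ?_
  have := ctr_ι_mul (LinearMap.proj i : Module.Dual ℂ (W n)) (Pi.single j 1) x
  simp only [LinearMap.proj_apply, Pi.single_apply] at this
  simp only [an, cr, Module.End.mul_apply, LinearMap.mulLeft_apply, LinearMap.sub_apply, this]
  split_ifs <;> simp

lemma an_cr_self (i : Fin (2 * n)) : an i * cr i = 1 - cr i * an i := by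
  rw [an_cr, if_pos rfl]

lemma an_cr_of_ne {i j : Fin (2 * n)} (h : i ≠ j) : an i * cr j = - (cr j * an i) := by
  rw [an_cr, if_neg h, zero_sub]

lemma an_an (i j : Fin (2 * n)) : an i * an j = - (an j * an i) :=
  LinearMap.ext fun x => ctr_ctr _ _ x

lemma cr_cr (i j : Fin (2 * n)) : cr i * cr j = - (cr j * cr i) :=
  LinearMap.ext fun x => ι_mul_ι_mul _ _ x

lemma cr_cr_self (i : Fin (2 * n)) : cr i * cr i = 0 :=
  LinearMap.ext fun x => ι_mul_ι_mul_self _ x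

/-- The derivation of the exterior algebra that extends `X`, in terms of creation and annihilation
operators. -/
def derE (X : Module.End ℂ (W n)) : Module.End ℂ (ExteriorAlgebra ℂ (W n)) :=
  ∑ j, ∑ i, X (Pi.single j 1) i • (cr i * an j)

lemma derE_ι_mul (X : Module.End ℂ (W n)) (w : W n) (x : ExteriorAlgebra ℂ (W n)) :
    derE X (ExteriorAlgebra.ι ℂ w * x) =
      ExteriorAlgebra.ι ℂ (X w) * x + ExteriorAlgebra.ι ℂ w * derE X x := by
  have h1 : ∀ y, derE X y =
      ∑ j, ExteriorAlgebra.ι ℂ (X (Pi.single j 1)) * an j y := by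
    intro y
    simp only [derE, LinearMap.sum_apply, LinearMap.smul_apply, Module.End.mul_apply, cr,
      LinearMap.mulLeft_apply]
    refine Finset.sum_congr rfl fun j _ => ?_
    conv_rhs => rw [pi_eq_sum_univ' (X (Pi.single j 1)), map_sum, Finset.sum_mul]
    refine Finset.sum_congr rfl fun i _ => ?_
    rw [map_smul, smul_mul_assoc]
  have h2 : X w = ∑ j, w j • X (Pi.single j 1) := by
    conv_lhs => rw [pi_eq_sum_univ' w, map_sum]
    simp only [map_smul]
  rw [h1, h1, h2, map_sum, Finset.sum_mul, Finset.mul_sum, ← Finset.sum_add_distrib]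
  refine Finset.sum_congr rfl fun j _ => ?_
  rw [an, ctr_ι_mul, mul_sub, ι_mul_ι_mul, sub_neg_eq_add, mul_smul_comm, map_smul, smul_mul_assoc]
  rfl

lemma derE_one (X : Module.End ℂ (W n)) : derE X 1 = 0 := by
  simp only [derE, LinearMap.sum_apply, LinearMap.smul_apply, Module.End.mul_apply, an, ctr_one,
    map_zero, smul_zero, Finset.sum_const_zero]

lemma derE_ιMulti (X : Module.End ℂ (W n)) {k : ℕ} (w : Fin k → W n) :
    derE X (ExteriorAlgebra.ιMulti ℂ k w) =
      ∑ i, ExteriorAlgebra.ιMulti ℂ k (Function.update w i (X (w i))) := by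
  induction k with
  | zero => simp [derE_one]
  | succ k ih =>
    rw [ExteriorAlgebra.ιMulti_succ_apply, derE_ι_mul, ih, Fin.sum_univ_succ, Finset.mul_sum]
    congr 1
    · rw [ExteriorAlgebra.ιMulti_succ_apply, Function.update_self]
      congr 2
    · refine Finset.sum_congr rfl fun i _ => ?_
      rw [ExteriorAlgebra.ιMulti_succ_apply, Function.update_of_ne (Fin.succ_ne_zero i).symm]
      congr 2
      funext j
      by_cases h : j = i
      · subst h; simp [Matrix.vecTail]
      · simp [Matrix.vecTail, h]

lemma coe_der (k : ℕ) (X : Module.End ℂ (W n)) (x : ⋀[ℂ]^k (W n)) :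
    (der k X x : ExteriorAlgebra ℂ (W n)) = derE X x := by
  suffices H : (⋀[ℂ]^k (W n)).subtype ∘ₗ der k X = derE X ∘ₗ (⋀[ℂ]^k (W n)).subtype from
    LinearMap.congr_fun H x
  refine exteriorPower.linearMap_ext (AlternatingMap.ext fun w => ?_)
  simp only [LinearMap.compAlternatingMap_apply, LinearMap.comp_apply, der_ιMulti,
    Submodule.subtype_apply, exteriorPower.ιMulti_apply_coe, derE_ιMulti, map_sum]

end Fermions

/-! ### Falling factorials of an operator -/

section Falling

variable {M M' : Type*} [AddCommGroup M] [Module ℂ M] [AddCommGroup M'] [Module ℂ M']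

/-- The falling factorial `N (N - 1) ⋯ (N - s + 1)` of an operator `N`. -/
def fal (N : Module.End ℂ M) : ℕ → Module.End ℂ M
  | 0 => 1
  | s + 1 => (N - (s : ℂ) • 1) * fal N s

lemma fal_succ_apply (N : Module.End ℂ M) (s : ℕ) (x : M) :
    fal N (s + 1) x = N (fal N s x) - (s : ℂ) • fal N s x := rfl

lemma fal_semiconj {N : Module.End ℂ M} {N' : Module.End ℂ M'} (A : M →ₗ[ℂ] M')
    (h : ∀ x, N' (A x) = A (N x)) (s : ℕ) (x : M) : fal N' s (A x) = A (fal N s x) := by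
  induction s with
  | zero => rfl
  | succ s ih => rw [fal_succ_apply, fal_succ_apply, ih, h, map_sub, map_smul]

lemma fal_apply_self (N : Module.End ℂ M) (s : ℕ) (x : M) : fal N s (N x) = N (fal N s x) :=
  fal_semiconj N (fun _ => rfl) s x

lemma fal_succ_apply' (N : Module.End ℂ M) (s : ℕ) (x : M) :
    fal N (s + 1) x = fal N s (N x - (s : ℂ) • x) := by
  rw [fal_succ_apply, map_sub, map_smul, fal_apply_self]

lemma fal_add_one (N : Module.End ℂ M) (s : ℕ) (x : M) :
    fal (N + 1) (s + 1) x = N (fal N s x) + fal N s x := by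
  induction s with
  | zero => simp [fal]
  | succ s ih =>
    rw [fal_succ_apply, ih, fal_succ_apply]
    simp only [LinearMap.add_apply, Module.End.one_apply, map_add, map_sub, map_smul]
    push_cast
    module

/-- If `N' A = A (N + 1)`, then the falling factorials of `N'` and `N` satisfy a Pascal rule. -/
lemma fal_shift {N : Module.End ℂ M} {N' : Module.End ℂ M'} (A : M →ₗ[ℂ] M')
    (h : ∀ x, N' (A x) = A (N x) + A x) (s : ℕ) (x : M) :
    fal N' (s + 1) (A x) = A (N (fal N s x) + fal N s x) := by
  rw [← fal_add_one, fal_semiconj (N := N + 1) A (fun x => by rw [h]; simp)]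

lemma fal_eigen {N : Module.End ℂ M} {x : M} {a : ℕ} (h : N x = (a : ℂ) • x) (s : ℕ) :
    fal N s x = ((a.descFactorial s : ℕ) : ℂ) • x := by
  induction s with
  | zero => simp [fal]
  | succ s ih =>
    rw [fal_succ_apply, ih, map_smul, h, Nat.descFactorial_succ, ← smul_assoc, ← smul_assoc,
      ← sub_smul]
    congr 1
    rcases le_or_gt s a with hs | hs
    · push_cast [Nat.cast_sub hs]
      simp only [smul_eq_mul]; ring
    · simp [Nat.descFactorial_of_lt hs]

lemma fal_mono {N : Module.End ℂ M} {x : M} {s t : ℕ} (hst : s ≤ t) (h : fal N s x = 0) :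
    fal N t x = 0 := by
  induction hst with
  | refl => exact h
  | step _ ih => rw [fal_succ_apply, ih, map_zero, smul_zero, sub_zero]

/-- If the sum of commuting idempotents maps `x` to `-m x` with `m ≥ 0`, then each of them
annihilates `x`. -/
lemma idempotent_apply_eq_zero {ι : Type*} (S : Finset ι) (p : ι → Module.End ℂ M)
    (hp : ∀ i, p i * p i = p i) (hc : ∀ i j, p i * p j = p j * p i) (m : ℕ) (x : M)
    (h : ∑ i ∈ S, p i x = - ((m : ℂ) • x)) : ∀ i ∈ S, p i x = 0 := by
  classical
  induction S using Finset.induction_on generalizing m x with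
  | empty => simp
  | insert a S ha ih =>
    rw [Finset.sum_insert ha] at h
    have hy : ∑ i ∈ S, p i (p a x) = - (((m + 1 : ℕ) : ℂ) • p a x) := by
      have h1 : ∀ i, p i (p a x) = p a (p i x) := fun i => LinearMap.congr_fun (hc i a) x
      have h2 : p a (p a x) = p a x := LinearMap.congr_fun (hp a) x
      have h3 := congrArg (p a) h
      simp only [h1, ← map_sum]
      rw [map_add, h2, map_neg, map_smul] at h3
      rw [eq_sub_of_add_eq' h3]
      push_cast
      module
    have h0 : p a x = 0 := by
      have h4 := ih (m + 1) (p a x) hy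
      rw [Finset.sum_eq_zero h4, eq_comm, neg_eq_zero, smul_eq_zero] at hy
      exact hy.resolve_left (by exact_mod_cast Nat.succ_ne_zero m)
    rw [h0, zero_add] at h
    intro i hi
    rcases Finset.mem_insert.1 hi with rfl | hi
    · exact h0
    · exact ih m x h i hi

end Falling

/-! ### Matrix units, coordinate projections and derivations -/

section Units

variable {n : ℕ}

lemma coordProj_apply (S : Set ℕ) [DecidablePred (· ∈ S)] (x : W n) (i : Fin (2 * n)) :
    coordProj n S x i = if i.val ∈ S then x i else 0 := by
  simp only [coordProj, LinearMap.pi_apply]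
  split_ifs <;> rfl

lemma coordProj_mul (S T : Set ℕ) : coordProj n S * coordProj n T = coordProj n (S ∩ T) := by
  classical
  refine LinearMap.ext fun x => funext fun i => ?_
  simp only [Module.End.mul_apply, coordProj_apply, Set.mem_inter_iff, ite_and]

lemma coordProj_empty : coordProj n ∅ = 0 := by
  classical
  refine LinearMap.ext fun x => funext fun i => ?_
  simp [coordProj_apply]

lemma coordProj_congr {S T : Set ℕ} (h : ∀ i < 2 * n, i ∈ S ↔ i ∈ T) :
    coordProj n S = coordProj n T := by
  classical
  refine LinearMap.ext fun x => funext fun i => ?_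
  simp only [coordProj_apply, h i i.2]

/-- The matrix unit that maps the basis vector of index `b` to that of index `a`. -/
def eu (a b : Fin (2 * n)) : Module.End ℂ (W n) :=
  (LinearMap.proj b : W n →ₗ[ℂ] ℂ).smulRight (Pi.single a 1)

lemma eu_apply (a b : Fin (2 * n)) (x : W n) : eu a b x = x b • Pi.single a 1 := rfl

lemma eu_mul (a b c d : Fin (2 * n)) : eu a b * eu c d = if b = c then eu a d else 0 := by
  refine LinearMap.ext fun x => ?_
  simp only [Module.End.mul_apply, eu_apply, Pi.smul_apply, Pi.single_apply, smul_eq_mul]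
  split_ifs <;> simp [eu_apply]

lemma coordProj_mul_eu (S : Set ℕ) [DecidablePred (· ∈ S)] (a b : Fin (2 * n)) :
    coordProj n S * eu a b = if a.val ∈ S then eu a b else 0 := by
  refine LinearMap.ext fun x => funext fun i => ?_
  by_cases h : i = a
  · subst h
    simp only [Module.End.mul_apply, eu_apply, coordProj_apply]
    split_ifs <;> simp [eu_apply]
  · simp only [Module.End.mul_apply, eu_apply, coordProj_apply]
    split_ifs <;> simp [eu_apply, h]

lemma eu_mul_coordProj (S : Set ℕ) [DecidablePred (· ∈ S)] (a b : Fin (2 * n)) :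
    eu a b * coordProj n S = if b.val ∈ S then eu a b else 0 := by
  refine LinearMap.ext fun x => ?_
  simp only [Module.End.mul_apply, eu_apply, coordProj_apply]
  split_ifs <;> simp [eu_apply]

lemma derE_add (X Y : Module.End ℂ (W n)) : derE (X + Y) = derE X + derE Y := by
  simp only [derE, LinearMap.add_apply, Pi.add_apply, add_smul, Finset.sum_add_distrib]

lemma derE_sum {ι : Type*} (s : Finset ι) (X : ι → Module.End ℂ (W n)) :
    derE (∑ i ∈ s, X i) = ∑ i ∈ s, derE (X i) :=
  map_sum (AddMonoidHom.mk' (derE (n := n)) derE_add) X s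

lemma derE_eu (a b : Fin (2 * n)) : derE (eu a b) = cr a * an b := by
  rw [derE, Finset.sum_eq_single b, Finset.sum_eq_single a]
  · simp [eu_apply]
  · intro i _ hi
    simp [eu_apply, hi]
  · simp
  · intro j _ hj
    simp [eu_apply, hj.symm]
  · simp

lemma ctr_derE (φ : Module.Dual ℂ (W n)) (X : Module.End ℂ (W n))
    (x : ExteriorAlgebra ℂ (W n)) :
    ctr φ (derE X x) = derE X (ctr φ x) + ctr (φ ∘ₗ X) x := by
  have h2 : φ ∘ₗ X = ∑ j, φ (X (Pi.single j 1)) • (LinearMap.proj j : Module.Dual ℂ (W n)) := by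
    refine LinearMap.ext fun w => ?_
    conv_lhs => rw [pi_eq_sum_univ' w, map_sum]
    simp [mul_comm]
  have h3 : ∀ i (y : ExteriorAlgebra ℂ (W n)), ctr φ (cr i y) =
      φ (Pi.single i 1) • y - cr i (ctr φ y) := fun i y => ctr_ι_mul _ _ _
  have h4 : ∀ i (y : ExteriorAlgebra ℂ (W n)), ctr φ (an i y) = - an i (ctr φ y) :=
    fun i y => ctr_ctr _ _ _
  have h5 : ∀ j, φ (X (Pi.single j 1)) = ∑ i, X (Pi.single j 1) i * φ (Pi.single i 1) := by
    intro j
    conv_lhs => rw [pi_eq_sum_univ' (X (Pi.single j 1)), map_sum]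
    simp
  have h6 : ctr (φ ∘ₗ X) x =
      ∑ j, ∑ i, (X (Pi.single j 1) i * φ (Pi.single i 1)) • an j x := by
    rw [h2, ctr_sum, LinearMap.sum_apply]
    refine Finset.sum_congr rfl fun j _ => ?_
    rw [ctr_smul, h5, LinearMap.smul_apply, Finset.sum_smul]
    rfl
  rw [h6]
  simp only [derE, LinearMap.sum_apply, LinearMap.smul_apply, Module.End.mul_apply, map_sum,
    map_smul, h3, h4, map_neg, ← Finset.sum_add_distrib]
  refine Finset.sum_congr rfl fun j _ => Finset.sum_congr rfl fun i _ => ?_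
  module

/-- The number operator of a set of coordinates on the exterior algebra: after exterior
multiplication with one more vector one more factor of the falling factorial is needed to
annihilate. -/
lemma fal_coordProj_ι_mul (S : Set ℕ) (w : W n) {m : ℕ} {x : ExteriorAlgebra ℂ (W n)}
    (hx : fal (derE (coordProj n S)) m x = 0) :
    fal (derE (coordProj n S)) (m + 1) (ExteriorAlgebra.ι ℂ w * x) = 0 := by
  set P := coordProj n S with hP
  have hPP : ∀ w, P (P w) = P w := fun w => by
    have := coordProj_mul (n := n) S S
    rw [Set.inter_self] at this
    exact LinearMap.congr_fun this w
  have h1 : fal (derE P) (m + 1) (LinearMap.mulLeft ℂ (ExteriorAlgebra.ι ℂ (P w)) x) = 0 := by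
    rw [fal_shift (N := derE P), hx, map_zero, add_zero, map_zero]
    intro y
    simp only [LinearMap.mulLeft_apply, derE_ι_mul, hPP]
    rw [add_comm]
  have h2 : fal (derE P) (m + 1) (LinearMap.mulLeft ℂ (ExteriorAlgebra.ι ℂ (w - P w)) x) = 0 := by
    rw [fal_semiconj (N := derE P), fal_mono (Nat.le_succ m) hx, map_zero]
    intro y
    simp only [LinearMap.mulLeft_apply, derE_ι_mul]
    rw [map_sub P, hPP, sub_self, map_zero, zero_mul, zero_add]
  have h3 : ExteriorAlgebra.ι ℂ w * x = LinearMap.mulLeft ℂ (ExteriorAlgebra.ι ℂ (P w)) x +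
      LinearMap.mulLeft ℂ (ExteriorAlgebra.ι ℂ (w - P w)) x := by
    simp only [LinearMap.mulLeft_apply, ← add_mul, ← map_add, add_sub_cancel]
  rw [h3, map_add, h1, h2, add_zero]

lemma fal_coordProj_eq_zero (S : Set ℕ) {k : ℕ} (x : ⋀[ℂ]^k (W n)) :
    fal (der k (coordProj n S)) (k + 1) x = 0 := by
  refine Subtype.ext ?_
  have h1 := fal_semiconj (N := der k (coordProj n S)) (N' := derE (coordProj n S))
    (⋀[ℂ]^k (W n)).subtype (fun y => (coe_der k _ y).symm) (k + 1) x
  refine h1.symm.trans ?_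
  change fal (derE (coordProj n S)) (k + 1) x.1 = 0
  obtain ⟨x, h2⟩ := x
  clear h1
  change fal (derE (coordProj n S)) (k + 1) x = 0
  rw [← ExteriorAlgebra.ιMulti_span_fixedDegree] at h2
  induction h2 using Submodule.span_induction with
  | zero => rw [map_zero]
  | add x y _ _ hx hy => rw [map_add, hx, hy, add_zero]
  | smul c x _ hx => rw [map_smul, hx, smul_zero]
  | mem x hx =>
    obtain ⟨w, rfl⟩ := hx
    induction k with
    | zero => simp [fal, derE_one]
    | succ k ih =>
      rw [ExteriorAlgebra.ιMulti_succ_apply]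
      exact fal_coordProj_ι_mul S _ (ih _)

end Units

/-! ### The blocks of the nilradical -/

section Blocks

variable {n k : ℕ}

lemma mem_idx1 {i : ℕ} : i ∈ idx1 k ↔ i < k := Iff.rfl

lemma mem_idx2 {i : ℕ} : i ∈ idx2 n k ↔ k ≤ i ∧ i + k < 2 * n := Iff.rfl

lemma mem_idx3 {i : ℕ} : i ∈ idx3 n k ↔ 2 * n ≤ i + k ∧ i < 2 * n := Iff.rfl

/-- The projection of `W` onto `W_{k,1}` along the other basis vectors. -/
abbrev pr1 (n k : ℕ) : Module.End ℂ (W n) := coordProj n (idx1 k)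

/-- The projection of `W` onto `W_{k,2}` along the other basis vectors. -/
abbrev pr2 (n k : ℕ) : Module.End ℂ (W n) := coordProj n (idx2 n k)

/-- The projection of `W` onto `W_{k,3}` along the other basis vectors. -/
abbrev pr3 (n k : ℕ) : Module.End ℂ (W n) := coordProj n (idx3 n k)

/-- The projection of `W` onto `W_{k,2} ⊕ W_{k,3}` along the other basis vectors. -/
abbrev pr23 (n k : ℕ) : Module.End ℂ (W n) := coordProj n (idx2 n k ∪ idx3 n k)

/-- The indices of the basis vectors in `W_{k,1}`; the function `Fin.rev` maps them to those of the
basis vectors in `W_{k,3}`. -/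
def J1 (n k : ℕ) : Finset (Fin (2 * n)) := Finset.univ.filter fun i => i.val < k

/-- The indices of the basis vectors in `W_{k,2}`. -/
def J2 (n k : ℕ) : Finset (Fin (2 * n)) := Finset.univ.filter fun i => k ≤ i.val ∧ i.val + k < 2 * n

lemma mem_J1 {i : Fin (2 * n)} : i ∈ J1 n k ↔ i.val < k := by simp [J1]

lemma mem_J2 {i : Fin (2 * n)} : i ∈ J2 n k ↔ k ≤ i.val ∧ i.val + k < 2 * n := by simp [J2]

lemma card_J1 (hkn : k ≤ n) : (J1 n k).card = k := by
  have h : J1 n k = Finset.univ.map (Fin.castLEEmb (by omega : k ≤ 2 * n)) := by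
    ext i
    simp only [mem_J1, Finset.mem_map, Finset.mem_univ, true_and]
    exact ⟨fun h => ⟨⟨i.val, h⟩, rfl⟩, by rintro ⟨j, rfl⟩; exact j.2⟩
  rw [h, Finset.card_map, Finset.card_univ, Fintype.card_fin]

lemma pr1_add_pr23 (hkn : k ≤ n) : pr1 n k + pr23 n k = 1 := by
  classical
  refine LinearMap.ext fun x => funext fun i => ?_
  have hi := i.2
  simp only [LinearMap.add_apply, Pi.add_apply, coordProj_apply, Set.mem_union, mem_idx1, mem_idx2,
    mem_idx3, Module.End.one_apply]
  split_ifs <;> first | omega | simp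

lemma pr2_add_pr3 : pr2 n k + pr3 n k = pr23 n k := by
  classical
  refine LinearMap.ext fun x => funext fun i => ?_
  have hi := i.2
  simp only [LinearMap.add_apply, Pi.add_apply, coordProj_apply, Set.mem_union, mem_idx2,
    mem_idx3]
  split_ifs <;> first | omega | simp

lemma eu_sum_apply (J : Finset (Fin (2 * n))) (σ : Equiv.Perm (Fin (2 * n))) (x : W n)
    (i : Fin (2 * n)) :
    (∑ j ∈ J, eu (σ j) (σ j)) x i = if σ.symm i ∈ J then x i else 0 := by
  rw [LinearMap.sum_apply, Finset.sum_apply]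
  have h : ∀ j, eu (σ j) (σ j) x i = if σ.symm i = j then x i else 0 := by
    intro j
    rw [eu_apply]
    by_cases hj : σ.symm i = j
    · subst hj; simp
    · rw [if_neg hj, Pi.smul_apply, Pi.single_apply, if_neg, smul_zero]
      rintro rfl
      simp at hj
  simp only [h, Finset.sum_ite_eq]

lemma pr1_eq_sum : pr1 n k = ∑ i ∈ J1 n k, eu i i := by
  classical
  refine LinearMap.ext fun x => funext fun i => ?_
  refine Eq.trans ?_ (eu_sum_apply (J1 n k) 1 x i).symm
  simp only [coordProj_apply, mem_idx1, mem_J1]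
  rfl

lemma pr2_eq_sum : pr2 n k = ∑ i ∈ J2 n k, eu i i := by
  classical
  refine LinearMap.ext fun x => funext fun i => ?_
  refine Eq.trans ?_ (eu_sum_apply (J2 n k) 1 x i).symm
  simp only [coordProj_apply, mem_idx2, mem_J2]
  rfl

lemma pr3_eq_sum : pr3 n k = ∑ i ∈ J1 n k, eu i.rev i.rev := by
  classical
  refine LinearMap.ext fun x => funext fun i => ?_
  refine Eq.trans ?_ (eu_sum_apply (J1 n k) Fin.revPerm x i).symm
  have hi := i.2
  simp only [coordProj_apply, mem_idx3, mem_J1, Fin.revPerm_symm, Fin.revPerm_apply, Fin.val_rev]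
  split_ifs <;> first | omega | rfl

/-- The lower triangular blocks of an element of `𝔫⁻` may be prescribed arbitrarily, subject to the
symmetry of the component `W_{k,1} → W_{k,3}`. -/
lemma exists_lowerBlock (hkn : k ≤ n) (T : Module.End ℂ (W n))
    (hT : ∀ i ∈ J1 n k, ∀ j ∈ J1 n k, T (Pi.single i 1) j.rev = T (Pi.single j 1) i.rev) :
    ∃ f : nMinus n, lowerBlock n k f = pr23 n k * T * pr1 n k := by
  classical
  let X : Module.End ℂ (W n) := Matrix.toLin' (Matrix.of fun a b : Fin (2 * n) =>
    if b.val < k then (if k ≤ a.val then T (Pi.single b 1) a else 0)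
    else if b.val + k < 2 * n ∧ 2 * n ≤ a.val + k then
      (if b.val < n then (1 : ℂ) else -1) * T (Pi.single a.rev 1) b.rev else 0)
  have hX : ∀ a b, X (Pi.single b 1) a =
    if b.val < k then (if k ≤ a.val then T (Pi.single b 1) a else 0)
    else if b.val + k < 2 * n ∧ 2 * n ≤ a.val + k then
      (if b.val < n then (1 : ℂ) else -1) * T (Pi.single a.rev 1) b.rev else 0 := by
    intro a b
    simp [X]
  refine ⟨⟨X, ?_, ?_⟩, ?_⟩
  · rw [mem_spLie_iff_entries]
    intro i j
    simp only [hX, Fin.val_rev, Fin.rev_rev]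
    have hi := i.2
    have hj := j.2
    split_ifs <;> first
      | (exfalso; omega)
      | rw [hT i (mem_J1.2 ‹_›) j (mem_J1.2 ‹_›)]
      | ring
  · intro i j hij
    have hij : i.val ≤ j.val := hij
    rw [hX]
    split_ifs <;> first | omega | rfl
  · refine LinearMap.pi_ext' fun j => LinearMap.ext_ring (funext fun i => ?_)
    have hi := i.2
    simp only [lowerBlock, LinearMap.comp_apply, Module.End.mul_apply]
    by_cases hj : j.val < k
    · have h1 : pr1 n k (LinearMap.single ℂ (fun _ => ℂ) j 1) = Pi.single j 1 := by
        funext a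
        rw [coordProj_apply]
        by_cases ha : a = j
        · subst ha; simp [mem_idx1, hj]
        · simp [ha]
      rw [h1, coordProj_apply, coordProj_apply]
      by_cases hi : i.val ∈ idx2 n k ∪ idx3 n k
      · rw [if_pos hi, if_pos hi, hX, if_pos hj, if_pos]
        rcases hi with hi | hi
        · exact hi.1
        · rw [mem_idx3] at hi
          omega
      · rw [if_neg hi, if_neg hi]
    · have h1 : pr1 n k (LinearMap.single ℂ (fun _ => ℂ) j 1) = 0 := by
        funext a
        rw [coordProj_apply]
        by_cases ha : a = j
        · subst ha; simp [mem_idx1, hj]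
        · simp [ha]
      rw [h1, map_zero, map_zero, map_zero, map_zero]

end Blocks

/-! ### Contraction with the symplectic form -/

section Contraction

variable {n k : ℕ}

/-- The contraction with the part `∑_{i ∈ s} w_i^* ∧ w_{2n+1-i}^*` of the symplectic form. -/
def conB (s : Finset (Fin (2 * n))) : Module.End ℂ (ExteriorAlgebra ℂ (W n)) :=
  ∑ i ∈ s, an i * an i.rev

lemma conB_derE (s : Finset (Fin (2 * n))) (X : Module.End ℂ (W n))
    (x : ExteriorAlgebra ℂ (W n)) :
    conB s (derE X x) = derE X (conB s x) + ∑ i ∈ s,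
      (ctr ((LinearMap.proj i : Module.Dual ℂ (W n)) ∘ₗ X) (an i.rev x) +
        an i (ctr ((LinearMap.proj i.rev : Module.Dual ℂ (W n)) ∘ₗ X) x)) := by
  simp only [conB, LinearMap.sum_apply, Module.End.mul_apply, map_sum, ← Finset.sum_add_distrib]
  refine Finset.sum_congr rfl fun i _ => ?_
  have h1 := ctr_derE (LinearMap.proj i.rev : Module.Dual ℂ (W n)) X x
  have h2 := ctr_derE (LinearMap.proj i : Module.Dual ℂ (W n)) X (an i.rev x)
  simp only [an] at h1 h2 ⊢
  rw [h1, map_add, h2, add_assoc]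

lemma proj_comp_eu (i a b : Fin (2 * n)) :
    (LinearMap.proj i : Module.Dual ℂ (W n)) ∘ₗ eu a b =
      (if i = a then (1 : ℂ) else 0) • (LinearMap.proj b : Module.Dual ℂ (W n)) := by
  refine LinearMap.ext fun x => ?_
  simp only [LinearMap.comp_apply, eu_apply, LinearMap.proj_apply, Pi.smul_apply, Pi.single_apply,
    LinearMap.smul_apply, smul_eq_mul]
  ring

lemma ctr_proj (i : Fin (2 * n)) : ctr (LinearMap.proj i : Module.Dual ℂ (W n)) = an i := rfl

lemma ne_rev_of_mem (hkn : k ≤ n) {i j : Fin (2 * n)} (hi : i ∈ J1 n k) (hj : j ∈ J1 n k) :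
    i ≠ j.rev := by
  rw [mem_J1] at hi hj
  intro h
  have := congrArg Fin.val h
  rw [Fin.val_rev] at this
  omega

lemma conB_pr3 (hkn : k ≤ n) (x : ExteriorAlgebra ℂ (W n)) :
    conB (J1 n k) (derE (pr3 n k) x) =
      derE (pr3 n k) (conB (J1 n k) x) + conB (J1 n k) x := by
  classical
  rw [conB_derE]
  congr 1
  rw [conB, LinearMap.sum_apply]
  refine Finset.sum_congr rfl fun i hi => ?_
  have h1 : (LinearMap.proj i : Module.Dual ℂ (W n)) ∘ₗ pr3 n k = 0 := by
    refine LinearMap.ext fun x => ?_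
    rw [mem_J1] at hi
    rw [LinearMap.comp_apply, LinearMap.proj_apply, coordProj_apply, if_neg]
    · rfl
    · rw [mem_idx3]; omega
  have h2 : (LinearMap.proj i.rev : Module.Dual ℂ (W n)) ∘ₗ pr3 n k = LinearMap.proj i.rev := by
    refine LinearMap.ext fun x => ?_
    rw [mem_J1] at hi
    rw [LinearMap.comp_apply, LinearMap.proj_apply, coordProj_apply, if_pos]
    · rfl
    · rw [mem_idx3, Fin.val_rev]; omega
  rw [h1, h2, ctr_zero, ctr_proj, LinearMap.zero_apply, zero_add]
  rfl

/-- The symmetric operators `W_{k,1} → W_{k,3}`, which are blocks of elements of `𝔫⁻`. -/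
def lowE (i j : Fin (2 * n)) : Module.End ℂ (W n) := eu i.rev j + eu j.rev i

/-- The symmetric operators `W_{k,3} → W_{k,1}`. -/
def upE (i j : Fin (2 * n)) : Module.End ℂ (W n) := eu j i.rev + eu i j.rev

lemma conB_upE (hkn : k ≤ n) {i j : Fin (2 * n)} (hi : i ∈ J1 n k) (hj : j ∈ J1 n k)
    (x : ExteriorAlgebra ℂ (W n)) :
    conB (J1 n k) (derE (upE i j) x) = derE (upE i j) (conB (J1 n k) x) := by
  rw [conB_derE, add_eq_left]
  have h1 : ∀ a ∈ J1 n k, (LinearMap.proj a.rev : Module.Dual ℂ (W n)) ∘ₗ upE i j = 0 := by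
    intro a ha
    rw [upE, LinearMap.comp_add, proj_comp_eu, proj_comp_eu,
      if_neg (ne_rev_of_mem hkn hi ha).symm, if_neg (ne_rev_of_mem hkn hj ha).symm]
    simp
  have h2 : ∀ a ∈ J1 n k, ctr ((LinearMap.proj a : Module.Dual ℂ (W n)) ∘ₗ upE i j) (an a.rev x) +
      an a (ctr ((LinearMap.proj a.rev : Module.Dual ℂ (W n)) ∘ₗ upE i j) x) =
      (if a = j then (an i.rev * an j.rev) x else 0) +
        (if a = i then (an j.rev * an i.rev) x else 0) := by
    intro a ha
    rw [h1 a ha, upE, LinearMap.comp_add, proj_comp_eu, proj_comp_eu, ctr_add, ctr_smul, ctr_smul,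
      ctr_proj, ctr_proj, ctr_zero, LinearMap.zero_apply, map_zero, add_zero]
    by_cases haj : a = j
    · subst haj
      by_cases hai : a = i
      · subst hai; simp
      · simp [hai]
    · by_cases hai : a = i
      · subst hai; simp [haj]
      · simp [haj, hai]
  rw [Finset.sum_congr rfl h2, Finset.sum_add_distrib, Finset.sum_ite_eq', Finset.sum_ite_eq',
    if_pos hi, if_pos hj, an_an i.rev j.rev, LinearMap.neg_apply, neg_add_cancel]

lemma derE_pr1 : derE (pr1 n k) = ∑ j ∈ J1 n k, cr j * an j := by
  rw [pr1_eq_sum, derE_sum]; simp only [derE_eu]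

lemma derE_pr2 : derE (pr2 n k) = ∑ j ∈ J2 n k, cr j * an j := by
  rw [pr2_eq_sum, derE_sum]; simp only [derE_eu]

lemma derE_pr3 : derE (pr3 n k) = ∑ i ∈ J1 n k, cr i.rev * an i.rev := by
  rw [pr3_eq_sum, derE_sum]; simp only [derE_eu]

lemma cr_an_mul_cr_an_of_ne {i l : Fin (2 * n)} (h : i ≠ l) :
    (cr l * an i) * (cr i * an l) = cr l * an l - (cr i * an i) * (cr l * an l) := by
  have e1 : (cr l * an i) * (cr i * an l) = cr l * (an i * cr i) * an l := by
    simp only [mul_assoc]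
  have e2 : (cr i * an i) * (cr l * an l) = cr i * (an i * cr l) * an l := by
    simp only [mul_assoc]
  have e3 : cr l * (cr i * an i) * an l = (cr l * cr i) * (an i * an l) := by
    simp only [mul_assoc]
  rw [e1, e2, an_cr_self, an_cr_of_ne h, mul_sub, sub_mul, mul_one, e3, cr_cr l i]
  refine LinearMap.ext fun x => ?_
  simp only [Module.End.mul_apply, LinearMap.sub_apply, LinearMap.neg_apply, map_neg]

lemma sum_cr_an_mul_cr_an (hkn : k ≤ n) :
    ∑ i ∈ J1 n k, ∑ j ∈ J1 n k, (cr i.rev * an j) * (cr j * an i.rev) =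
      (k : ℂ) • derE (pr3 n k) - derE (pr1 n k) * derE (pr3 n k) := by
  rw [Finset.sum_congr rfl fun i hi => Finset.sum_congr rfl fun j hj =>
    cr_an_mul_cr_an_of_ne (ne_rev_of_mem hkn hj hi)]
  simp only [Finset.sum_sub_distrib, Finset.sum_const, card_J1 hkn, ← Finset.sum_mul,
    ← Finset.mul_sum, ← derE_pr1, ← Finset.smul_sum, ← derE_pr3, Nat.cast_smul_eq_nsmul]

lemma cr_an_mul_cr_an_eq_ite (i j : Fin (2 * n)) : (cr i.rev * an j) * (cr i * an j.rev) =
    (if j = i then cr i.rev * an i.rev else 0) - (cr i.rev * cr i) * (an j * an j.rev) := by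
  have e1 : (cr i.rev * an j) * (cr i * an j.rev) = cr i.rev * ((an j * cr i) * an j.rev) := by
    simp only [mul_assoc]
  by_cases h : j = i
  · subst h
    rw [e1, an_cr_self, if_pos rfl]
    refine LinearMap.ext fun x => ?_
    simp only [Module.End.mul_apply, LinearMap.sub_apply, Module.End.one_apply, map_sub]
  · rw [e1, an_cr_of_ne h, if_neg h]
    refine LinearMap.ext fun x => ?_
    simp only [Module.End.mul_apply, LinearMap.neg_apply, map_neg, zero_sub]

lemma sum_cr_an_mul_cr_an' :
    ∑ i ∈ J1 n k, ∑ j ∈ J1 n k, (cr i.rev * an j) * (cr i * an j.rev) =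
      derE (pr3 n k) - (∑ i ∈ J1 n k, cr i.rev * cr i) * conB (J1 n k) := by
  have h1 : ∀ i ∈ J1 n k, ∑ j ∈ J1 n k, (cr i.rev * an j) * (cr i * an j.rev) =
      cr i.rev * an i.rev - (cr i.rev * cr i) * conB (J1 n k) := by
    intro i hi
    rw [Finset.sum_congr rfl fun j _ => cr_an_mul_cr_an_eq_ite i j, Finset.sum_sub_distrib,
      Finset.sum_ite_eq', if_pos hi, ← Finset.mul_sum]
    rfl
  rw [Finset.sum_congr rfl h1, Finset.sum_sub_distrib, ← derE_pr3, ← Finset.sum_mul]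

lemma derE_lowE_mul_derE_upE (i j : Fin (2 * n)) : derE (lowE i j) * derE (upE i j) =
    (cr i.rev * an j) * (cr j * an i.rev) + (cr j.rev * an i) * (cr i * an j.rev) +
    ((cr i.rev * an j) * (cr i * an j.rev) + (cr j.rev * an i) * (cr j * an i.rev)) := by
  rw [lowE, upE, derE_add, derE_add, derE_eu, derE_eu, derE_eu, derE_eu, add_mul, mul_add, mul_add,
    add_comm (cr i.rev * an j * (cr i * an j.rev)), add_add_add_comm,
    add_comm (cr i.rev * an j * (cr i * an j.rev))]
  exact add_add_add_comm _ _ _ _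

/-- A Casimir identity: on the kernel of the contraction `conB (J1 n k)` the quadratic expression on
the left acts through the number operators of `W_{k,1}` and `W_{k,3}`. -/
lemma casimir_lowE_upE (hkn : k ≤ n) (x : ExteriorAlgebra ℂ (W n))
    (hx : conB (J1 n k) x = 0) :
    ∑ i ∈ J1 n k, ∑ j ∈ J1 n k, derE (lowE i j) (derE (upE i j) x) =
      (2 : ℂ) • (((k : ℂ) + 1) • derE (pr3 n k) x - derE (pr1 n k) (derE (pr3 n k) x)) := by
  have hA := sum_cr_an_mul_cr_an hkn
  have hB := sum_cr_an_mul_cr_an' (n := n) (k := k)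
  have hA2 := hA
  have hB2 := hB
  rw [Finset.sum_comm] at hA2 hB2
  have h : ∑ i ∈ J1 n k, ∑ j ∈ J1 n k, derE (lowE i j) * derE (upE i j) =
      ∑ i ∈ J1 n k, ∑ j ∈ J1 n k, (cr i.rev * an j) * (cr j * an i.rev) +
      ∑ i ∈ J1 n k, ∑ j ∈ J1 n k, (cr j.rev * an i) * (cr i * an j.rev) +
      (∑ i ∈ J1 n k, ∑ j ∈ J1 n k, (cr i.rev * an j) * (cr i * an j.rev) +
      ∑ i ∈ J1 n k, ∑ j ∈ J1 n k, (cr j.rev * an i) * (cr j * an i.rev)) := by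
    simp only [derE_lowE_mul_derE_upE, Finset.sum_add_distrib]
  rw [hA, hA2, hB, hB2] at h
  have h' := LinearMap.congr_fun h x
  simp only [LinearMap.sum_apply, Module.End.mul_apply, LinearMap.add_apply, LinearMap.sub_apply,
    LinearMap.smul_apply, hx, map_zero, sub_zero] at h'
  rw [h']
  module

/-- The Casimir identity for the blocks `W_{k,1} → W_{k,2}`. -/
lemma casimir_eu (hkn : k ≤ n) :
    ∑ i ∈ J1 n k, ∑ l ∈ J2 n k, derE (eu l i) * derE (eu i l) =
      (k : ℂ) • derE (pr2 n k) - derE (pr1 n k) * derE (pr2 n k) := by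
  have hA' : ∀ i ∈ J1 n k, ∀ l ∈ J2 n k, derE (eu l i) * derE (eu i l) =
      cr l * an l - (cr i * an i) * (cr l * an l) := by
    intro i hi l hl
    rw [derE_eu, derE_eu]
    refine cr_an_mul_cr_an_of_ne ?_
    rw [mem_J1] at hi
    rw [mem_J2] at hl
    rintro rfl
    omega
  rw [Finset.sum_congr rfl fun i hi => Finset.sum_congr rfl fun j hj => hA' i hi j hj]
  simp only [Finset.sum_sub_distrib, Finset.sum_const, card_J1 hkn, ← Finset.sum_mul,
    ← Finset.mul_sum, ← derE_pr1, ← derE_pr2, Nat.cast_smul_eq_nsmul]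

end Contraction

/-! ### The kernel of the contraction is generated by the highest weight vector -/

section Kernel

variable {n k : ℕ}

lemma der_comm (X Y : Module.End ℂ (W n)) (x : ⋀[ℂ]^k (W n)) :
    der k X (der k Y x) = der k Y (der k X x) + der k (X * Y - Y * X) x := by
  rw [der_lie]
  simp

lemma der_pr1 (hkn : k ≤ n) (x : ⋀[ℂ]^k (W n)) :
    der k (pr1 n k) x = (k : ℂ) • x - der k (pr23 n k) x := by
  rw [← der_one k x, ← pr1_add_pr23 hkn, map_add, LinearMap.add_apply, add_sub_cancel_right]

lemma cr_an_of_ne {i j : Fin (2 * n)} (h : i ≠ j) (x : ExteriorAlgebra ℂ (W n)) :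
    cr i (an j x) = - an j (cr i x) := by
  have := LinearMap.congr_fun (an_cr_of_ne h.symm) x
  simp only [Module.End.mul_apply, LinearMap.neg_apply] at this
  rw [this, neg_neg]

lemma an_mul_cr_comm (i j : Fin (2 * n)) :
    (an i * cr i) * (an j * cr j) = (an j * cr j) * (an i * cr i) := by
  rcases eq_or_ne i j with rfl | h
  · rfl
  · refine LinearMap.ext fun x => ?_
    have h1 : ∀ y : ExteriorAlgebra ℂ (W n), an i (an j y) = - an j (an i y) :=
      fun y => LinearMap.congr_fun (an_an i j) y
    have h2 : ∀ y : ExteriorAlgebra ℂ (W n), cr i (cr j y) = - cr j (cr i y) :=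
      fun y => LinearMap.congr_fun (cr_cr i j) y
    have h3 : ∀ y : ExteriorAlgebra ℂ (W n), an i (cr j y) = - cr j (an i y) :=
      fun y => LinearMap.congr_fun (an_cr_of_ne h) y
    simp only [Module.End.mul_apply]
    rw [cr_an_of_ne h, map_neg, h1, neg_neg, h2, map_neg, h3, neg_neg]

lemma cr_an_cr (i : Fin (2 * n)) (x : ExteriorAlgebra ℂ (W n)) : cr i (an i (cr i x)) = cr i x := by
  have h1 : an i (cr i x) = x - cr i (an i x) := LinearMap.congr_fun (an_cr_self i) x
  have h2 : cr i (cr i (an i x)) = 0 := LinearMap.congr_fun (cr_cr_self i) (an i x)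
  rw [h1, map_sub, h2, sub_zero]

lemma an_mul_cr_idem (i : Fin (2 * n)) : (an i * cr i) * (an i * cr i) = an i * cr i := by
  refine LinearMap.ext fun x => ?_
  simp only [Module.End.mul_apply]
  rw [cr_an_cr]

/-- A vector of degree zero is a multiple of `w₁ ∧ ⋯ ∧ w_k`: it has `k` factors in `W_{k,1}`, so the
sum over `i < k` of the idempotents `an i * cr i`, which test the absence of the factor `w_i`,
annihilates it. -/
lemma mem_span_hwVec (hkn : k ≤ n) {x : ⋀[ℂ]^k (W n)} (hx : der k (pr23 n k) x = 0) :
    x ∈ ℂ ∙ hwVec n k hkn := by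
  have h1 : derE (pr1 n k) (x : ExteriorAlgebra ℂ (W n)) = (k : ℂ) • x := by
    rw [← coe_der, der_pr1 hkn, hx, sub_zero]
    rfl
  have h2 : ∑ i ∈ J1 n k, (an i * cr i) (x : ExteriorAlgebra ℂ (W n)) =
      - (((0 : ℕ) : ℂ) • (x : ExteriorAlgebra ℂ (W n))) := by
    simp only [an_cr_self, LinearMap.sub_apply, Finset.sum_sub_distrib, ← LinearMap.sum_apply]
    rw [← derE_pr1, h1, Finset.sum_const, card_J1 hkn, ← Nat.cast_smul_eq_nsmul ℂ]
    simp
  have h3 := idempotent_apply_eq_zero (J1 n k) (fun i => an i * cr i) an_mul_cr_idem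
    an_mul_cr_comm 0 (x : ExteriorAlgebra ℂ (W n)) h2
  have h4 : ∀ i ∈ J1 n k, cr i (x : ExteriorAlgebra ℂ (W n)) = 0 := by
    intro i hi
    have := h3 i hi
    rw [Module.End.mul_apply] at this
    rw [← cr_an_cr, this, map_zero]
  obtain ⟨c, hc⟩ := eq_smul_ιMulti
    (fun i : Fin k => (Pi.single (Fin.castLE (by omega : k ≤ 2 * n) i) 1 : W n))
    (fun i : Fin k => LinearMap.proj (Fin.castLE (by omega : k ≤ 2 * n) i))
    (fun i j => by simp [Pi.single_apply]) x
    (fun i => h4 _ (mem_J1.2 i.2))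
  exact Submodule.mem_span_singleton.2 ⟨c, hc.symm⟩

/-- The span of the words of length `s` in the lower triangular blocks of elements of `𝔫⁻`, applied
to the highest weight vector. -/
def lowWords (n k : ℕ) (hkn : k ≤ n) (s : ℕ) : Submodule ℂ (⋀[ℂ]^k (W n)) :=
  Submodule.span ℂ {x | ∃ l : List (nMinus n), l.length = s ∧
    x = (l.map fun f => der k (lowerBlock n k f)).prod (hwVec n k hkn)}

lemma hwVec_mem_lowWords (hkn : k ≤ n) : hwVec n k hkn ∈ lowWords n k hkn 0 :=
  Submodule.subset_span ⟨[], rfl, rfl⟩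

lemma der_mem_lowWords (hkn : k ≤ n) (f : nMinus n) {s : ℕ} {x : ⋀[ℂ]^k (W n)}
    (hx : x ∈ lowWords n k hkn s) :
    der k (lowerBlock n k f) x ∈ lowWords n k hkn (s + 1) := by
  suffices H : lowWords n k hkn s ≤ (lowWords n k hkn (s + 1)).comap (der k (lowerBlock n k f)) from
    H hx
  refine Submodule.span_le.2 ?_
  rintro _ ⟨l, hl, rfl⟩
  exact Submodule.subset_span ⟨f :: l, by simp [hl], by simp⟩

lemma exists_lowerBlock_eq_lowE (hkn : k ≤ n) {i j : Fin (2 * n)} (hi : i ∈ J1 n k)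
    (hj : j ∈ J1 n k) : ∃ f : nMinus n, lowerBlock n k f = lowE i j := by
  classical
  obtain ⟨f, hf⟩ := exists_lowerBlock hkn (lowE i j) (by
    intro a _ b _
    simp only [lowE, LinearMap.add_apply, eu_apply, Pi.add_apply, Pi.smul_apply, Pi.single_apply,
      Fin.rev_inj, smul_eq_mul, mul_ite, mul_one, mul_zero]
    simp only [eq_comm (a := b), eq_comm (a := a)]
    split_ifs <;> simp)
  refine ⟨f, hf.trans ?_⟩
  rw [mem_J1] at hi hj
  rw [lowE, mul_add, add_mul, coordProj_mul_eu, coordProj_mul_eu, if_pos, if_pos, eu_mul_coordProj,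
    eu_mul_coordProj, if_pos (show i.val ∈ idx1 k from hi), if_pos (show j.val ∈ idx1 k from hj)]
  · refine Or.inr ?_
    rw [mem_idx3, Fin.val_rev]
    omega
  · refine Or.inr ?_
    rw [mem_idx3, Fin.val_rev]
    omega

lemma exists_lowerBlock_eq_eu (hkn : k ≤ n) {i l : Fin (2 * n)} (hi : i ∈ J1 n k)
    (hl : l ∈ J2 n k) : ∃ f : nMinus n, lowerBlock n k f = eu l i := by
  classical
  rw [mem_J2] at hl
  obtain ⟨f, hf⟩ := exists_lowerBlock hkn (eu l i) (by
    have h : ∀ a ∈ J1 n k, a.rev ≠ l := by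
      rintro a ha rfl
      rw [mem_J1] at ha
      rw [Fin.val_rev] at hl
      omega
    intro a ha b hb
    simp [eu_apply, Pi.single_apply, h a ha, h b hb])
  refine ⟨f, hf.trans ?_⟩
  rw [mem_J1] at hi
  rw [coordProj_mul_eu, if_pos (show l.val ∈ idx2 n k ∪ idx3 n k from Or.inl hl),
    eu_mul_coordProj, if_pos (show i.val ∈ idx1 k from hi)]

lemma pr23_mul_upE (hkn : k ≤ n) {i j : Fin (2 * n)} (hi : i ∈ J1 n k) (hj : j ∈ J1 n k) :
    pr23 n k * upE i j - upE i j * pr23 n k = - upE i j := by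
  classical
  rw [mem_J1] at hi hj
  have h : ∀ a : Fin (2 * n), a.val < k → a.val ∉ idx2 n k ∪ idx3 n k := by
    rintro a ha (h | h)
    · rw [mem_idx2] at h; omega
    · rw [mem_idx3] at h; omega
  have h' : ∀ a : Fin (2 * n), a.val < k → a.rev.val ∈ idx2 n k ∪ idx3 n k := by
    intro a ha
    refine Or.inr ?_
    rw [mem_idx3, Fin.val_rev]
    omega
  rw [upE, mul_add, add_mul, coordProj_mul_eu, coordProj_mul_eu, if_neg (h _ hi), if_neg (h _ hj),
    eu_mul_coordProj, eu_mul_coordProj, if_pos (h' _ hi), if_pos (h' _ hj)]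
  simp

lemma pr23_mul_eu (hkn : k ≤ n) {i l : Fin (2 * n)} (hi : i ∈ J1 n k) (hl : l ∈ J2 n k) :
    pr23 n k * eu i l - eu i l * pr23 n k = - eu i l := by
  classical
  rw [mem_J1] at hi
  rw [mem_J2] at hl
  have h : i.val ∉ idx2 n k ∪ idx3 n k := by
    rintro (h | h)
    · rw [mem_idx2] at h; omega
    · rw [mem_idx3] at h; omega
  rw [coordProj_mul_eu, if_neg h, eu_mul_coordProj,
    if_pos (show l.val ∈ idx2 n k ∪ idx3 n k from Or.inl hl), zero_sub]

lemma pr3_mul_eu (hkn : k ≤ n) {i l : Fin (2 * n)} (hi : i ∈ J1 n k) (hl : l ∈ J2 n k) :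
    pr3 n k * eu i l - eu i l * pr3 n k = 0 := by
  classical
  rw [mem_J1] at hi
  rw [mem_J2] at hl
  rw [coordProj_mul_eu, if_neg, eu_mul_coordProj, if_neg, sub_zero]
  · rw [mem_idx3]; omega
  · rw [mem_idx3]; omega

lemma pr3_comm_pr23 : pr23 n k * pr3 n k - pr3 n k * pr23 n k = 0 := by
  rw [coordProj_mul, coordProj_mul, Set.inter_comm, sub_self]

lemma der_pr23_pr3 (x : ⋀[ℂ]^k (W n)) :
    der k (pr23 n k) (der k (pr3 n k) x) = der k (pr3 n k) (der k (pr23 n k) x) := by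
  rw [der_comm, pr3_comm_pr23, map_zero, LinearMap.zero_apply, add_zero]

/-- The Casimir identity for the blocks `W_{k,1} → W_{k,3}`, on vectors of degree `s` in the kernel of
the contraction. -/
lemma casimir_low (hkn : k ≤ n) {s : ℕ} {x : ⋀[ℂ]^k (W n)}
    (hC : conB (J1 n k) (x : ExteriorAlgebra ℂ (W n)) = 0)
    (hN : der k (pr23 n k) x = (s : ℂ) • x) :
    ∑ i ∈ J1 n k, ∑ j ∈ J1 n k, der k (lowE i j) (der k (upE i j) x) =
      (2 * ((s : ℂ) + 1)) • der k (pr3 n k) x := by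
  have h1 := casimir_lowE_upE hkn (x : ExteriorAlgebra ℂ (W n)) hC
  simp only [← coe_der] at h1
  have h2 : ∑ i ∈ J1 n k, ∑ j ∈ J1 n k, der k (lowE i j) (der k (upE i j) x) =
      (2 : ℂ) • (((k : ℂ) + 1) • der k (pr3 n k) x - der k (pr1 n k) (der k (pr3 n k) x)) := by
    refine Subtype.ext ?_
    simp only [AddSubmonoidClass.coe_finsetSum, h1]
    rfl
  rw [h2, der_pr1 hkn, der_pr23_pr3, hN, map_smul]
  module

/-- The Casimir identity for the blocks `W_{k,1} → W_{k,2}`, on vectors of degree `s` without factors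
in `W_{k,3}`. -/
lemma casimir_mid (hkn : k ≤ n) {s : ℕ} {x : ⋀[ℂ]^k (W n)}
    (h3 : der k (pr3 n k) x = 0) (hN : der k (pr23 n k) x = (s : ℂ) • x) :
    ∑ i ∈ J1 n k, ∑ l ∈ J2 n k, der k (eu l i) (der k (eu i l) x) =
      ((s : ℂ) * s) • x := by
  have h1 := LinearMap.congr_fun (casimir_eu hkn) (x : ExteriorAlgebra ℂ (W n))
  simp only [LinearMap.sum_apply, Module.End.mul_apply, LinearMap.sub_apply, LinearMap.smul_apply,
    ← coe_der] at h1
  have h2 : ∑ i ∈ J1 n k, ∑ l ∈ J2 n k, der k (eu l i) (der k (eu i l) x) =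
      (k : ℂ) • der k (pr2 n k) x - der k (pr1 n k) (der k (pr2 n k) x) := by
    refine Subtype.ext ?_
    simp only [AddSubmonoidClass.coe_finsetSum, h1]
    rfl
  have h4 : der k (pr2 n k) x = (s : ℂ) • x := by
    rw [← hN, ← pr2_add_pr3, map_add, LinearMap.add_apply, h3, add_zero]
  rw [h2, der_pr1 hkn, h4, map_smul, hN]
  module

lemma mem_lowWords_of_pr3 (hkn : k ≤ n) (s : ℕ) (x : ⋀[ℂ]^k (W n))
    (h3 : der k (pr3 n k) x = 0) (hN : der k (pr23 n k) x = (s : ℂ) • x) :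
    x ∈ lowWords n k hkn s := by
  induction s generalizing x with
  | zero =>
    rw [Nat.cast_zero, zero_smul] at hN
    exact (Submodule.span_singleton_le_iff_mem _ _).2 (hwVec_mem_lowWords hkn)
      (mem_span_hwVec hkn hN)
  | succ s ih =>
    have h := casimir_mid hkn h3 hN
    have h0 : (((s + 1 : ℕ) : ℂ) * ((s + 1 : ℕ) : ℂ)) ≠ 0 := by
      exact_mod_cast Nat.mul_ne_zero (Nat.succ_ne_zero s) (Nat.succ_ne_zero s)
    refine (Submodule.smul_mem_iff _ h0).1 (h ▸ ?_)
    refine sum_mem fun i hi => sum_mem fun l hl => ?_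
    obtain ⟨f, hf⟩ := exists_lowerBlock_eq_eu hkn hi hl
    rw [← hf]
    refine der_mem_lowWords hkn f (ih _ ?_ ?_)
    · rw [der_comm, h3, map_zero, pr3_mul_eu hkn hi hl, map_zero, LinearMap.zero_apply, add_zero]
    · rw [der_comm, hN, pr23_mul_eu hkn hi hl, map_smul, map_neg, LinearMap.neg_apply]
      push_cast
      module

/-- A vector of degree `s` annihilated by the contraction `conB (J1 n k)` is a combination of words
of length `s` in the blocks of elements of `𝔫⁻`. The Casimir identities express it through
vectors of smaller degree; the induction on `m` replaces the decomposition into eigenvectors of the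
number operator of `W_{k,3}`. -/
lemma mem_lowWords (hkn : k ≤ n) (s : ℕ) (x : ⋀[ℂ]^k (W n))
    (hC : conB (J1 n k) (x : ExteriorAlgebra ℂ (W n)) = 0)
    (hN : der k (pr23 n k) x = (s : ℂ) • x) :
    x ∈ lowWords n k hkn s := by
  induction s generalizing x with
  | zero =>
    rw [Nat.cast_zero, zero_smul] at hN
    exact (Submodule.span_singleton_le_iff_mem _ _).2 (hwVec_mem_lowWords hkn)
      (mem_span_hwVec hkn hN)
  | succ s ih =>
    have hR : ∀ x : ⋀[ℂ]^k (W n), conB (J1 n k) (x : ExteriorAlgebra ℂ (W n)) = 0 →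
        der k (pr23 n k) x = ((s + 1 : ℕ) : ℂ) • x →
        der k (pr3 n k) x ∈ lowWords n k hkn (s + 1) := by
      intro x hC hN
      have h := casimir_low hkn hC hN
      have h0 : (2 * (((s + 1 : ℕ) : ℂ) + 1)) ≠ 0 := by
        exact_mod_cast Nat.mul_ne_zero two_ne_zero (Nat.succ_ne_zero (s + 1))
      refine (Submodule.smul_mem_iff _ h0).1 (h ▸ ?_)
      refine sum_mem fun i hi => sum_mem fun j hj => ?_
      obtain ⟨f, hf⟩ := exists_lowerBlock_eq_lowE hkn hi hj
      rw [← hf]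
      refine der_mem_lowWords hkn f (ih _ ?_ ?_)
      · rw [coe_der, conB_upE hkn hi hj, hC, map_zero]
      · rw [der_comm, hN, pr23_mul_upE hkn hi hj, map_smul, map_neg, LinearMap.neg_apply]
        push_cast
        module
    have key : ∀ m, ∀ x : ⋀[ℂ]^k (W n), conB (J1 n k) (x : ExteriorAlgebra ℂ (W n)) = 0 →
        der k (pr23 n k) x = ((s + 1 : ℕ) : ℂ) • x → fal (der k (pr3 n k)) m x = 0 →
        x ∈ lowWords n k hkn (s + 1) := by
      intro m
      induction m with
      | zero =>
        intro x _ _ hx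
        rw [show x = 0 from hx]
        exact zero_mem _
      | succ m ihm =>
        intro x hC hN hx
        rcases Nat.eq_zero_or_pos m with rfl | hm
        · refine mem_lowWords_of_pr3 hkn _ x ?_ hN
          simpa [fal] using hx
        · rw [fal_succ_apply'] at hx
          have h1 := ihm _ ?_ ?_ hx
          · have h2 := sub_mem (hR x hC hN) h1
            rw [sub_sub_cancel] at h2
            exact (Submodule.smul_mem_iff _ (by exact_mod_cast hm.ne')).1 h2
          · rw [Submodule.coe_sub, Submodule.coe_smul, coe_der, map_sub, map_smul, conB_pr3 hkn, hC]
            simp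
          · rw [map_sub, map_smul, der_pr23_pr3, hN, map_smul, smul_sub, smul_comm]
    exact key (k + 1) x hC hN (fal_coordProj_eq_zero _ x)

end Kernel

/-! ### The embedding of the degenerate representation -/

section Embedding

variable {n k : ℕ}

lemma sum_univ_eq_sum_J1 {M : Type*} [AddCommMonoid M] (g : Fin (2 * n) → M) :
    ∑ a, g a = ∑ i ∈ J1 n n, (g i + g i.rev) := by
  rw [Finset.sum_add_distrib, ← Finset.sum_filter_add_sum_filter_not Finset.univ
    (fun a : Fin (2 * n) => a.val < n)]
  congr 1
  refine Finset.sum_equiv Fin.revPerm (fun i => ?_) (fun i _ => by simp)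
  have := i.2
  simp only [Finset.mem_filter, Finset.mem_univ, true_and, mem_J1, Fin.revPerm_apply, Fin.val_rev]
  omega

/-- The contraction with the symplectic form commutes with the symplectic Lie algebra. -/
lemma conB_derE_of_mem_spLie {X : Module.End ℂ (W n)} (hX : X ∈ spLie n)
    (x : ExteriorAlgebra ℂ (W n)) :
    conB (J1 n n) (derE X x) = derE X (conB (J1 n n) x) := by
  rw [conB_derE, add_eq_left]
  have h0 := mem_spLie.1 hX
  -- the sum over the pairs of dual coordinates is a sum over all coordinates
  have h1 : ∀ i ∈ J1 n n, ctr ((LinearMap.proj i : Module.Dual ℂ (W n)) ∘ₗ X) (an i.rev x) +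
      an i (ctr ((LinearMap.proj i.rev : Module.Dual ℂ (W n)) ∘ₗ X) x) =
      ctr (form n (X (Pi.single i 1))) (an i x) +
        ctr (form n (X (Pi.single i.rev 1))) (an i.rev x) := by
    intro i hi
    rw [mem_J1] at hi
    have e1 : (LinearMap.proj i : Module.Dual ℂ (W n)) ∘ₗ X = form n (X (Pi.single i.rev 1)) := by
      refine LinearMap.ext fun y => ?_
      rw [h0, form_single, if_neg (by rw [Fin.val_rev]; omega), Fin.rev_rev]
      simp
    have e2 : (LinearMap.proj i.rev : Module.Dual ℂ (W n)) ∘ₗ X =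
        (-1 : ℂ) • form n (X (Pi.single i 1)) := by
      refine LinearMap.ext fun y => ?_
      rw [LinearMap.smul_apply, h0, form_single, if_pos hi]
      simp
    have e3 : an i (ctr (form n (X (Pi.single i 1))) x) =
        - ctr (form n (X (Pi.single i 1))) (an i x) := ctr_ctr _ _ _
    rw [e1, e2, ctr_smul, LinearMap.smul_apply, map_smul, neg_one_smul, e3, neg_neg]
    exact add_comm _ _
  rw [Finset.sum_congr rfl h1, ← sum_univ_eq_sum_J1
    (fun a => ctr (form n (X (Pi.single a 1))) (an a x))]
  -- the coefficients are symmetric, while contractions anticommute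
  have h2 : ∀ a, ctr (form n (X (Pi.single a 1))) (an a x) =
      ∑ b, form n (X (Pi.single a 1)) (Pi.single b 1) • an b (an a x) := by
    intro a
    have : form n (X (Pi.single a 1)) = ∑ b, form n (X (Pi.single a 1)) (Pi.single b 1) •
        (LinearMap.proj b : Module.Dual ℂ (W n)) := by
      refine LinearMap.ext fun y => ?_
      conv_lhs => rw [pi_eq_sum_univ' y, map_sum]
      simp [mul_comm]
    conv_lhs => rw [this, ctr_sum]
    simp only [LinearMap.sum_apply, ctr_smul, LinearMap.smul_apply]
    rfl
  simp only [h2]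
  set T := ∑ a, ∑ b, form n (X (Pi.single a 1)) (Pi.single b 1) • an b (an a x) with hT
  have h3 : T = -T := by
    conv_lhs => rw [hT, Finset.sum_comm]
    rw [hT, ← Finset.sum_neg_distrib]
    refine Finset.sum_congr rfl fun a _ => ?_
    rw [← Finset.sum_neg_distrib]
    refine Finset.sum_congr rfl fun b _ => ?_
    have e1 : form n (X (Pi.single b 1)) (Pi.single a 1) =
        form n (X (Pi.single a 1)) (Pi.single b 1) := by
      rw [h0, form_swap, neg_neg]
    have e2 : an a (an b x) = - an b (an a x) := LinearMap.congr_fun (an_an a b) x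
    rw [e1, e2, smul_neg]
  have h4 : (2 : ℂ) • T = 0 := by
    rw [two_smul]
    nth_rewrite 1 [h3]
    exact neg_add_cancel T
  exact (smul_eq_zero.1 h4).resolve_left two_ne_zero

lemma J1_subset (hkn : k ≤ n) : J1 n k ⊆ J1 n n := by
  intro i hi
  rw [mem_J1] at hi ⊢
  omega

lemma conB_sdiff (hkn : k ≤ n) (x : ExteriorAlgebra ℂ (W n)) :
    conB (J1 n n \ J1 n k) x + conB (J1 n k) x = conB (J1 n n) x := by
  rw [conB, conB, conB, ← Finset.sum_sdiff (J1_subset hkn)]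
  rfl

lemma proj_comp_coordProj (S : Set ℕ) [DecidablePred (· ∈ S)] (i : Fin (2 * n)) :
    (LinearMap.proj i : Module.Dual ℂ (W n)) ∘ₗ coordProj n S =
      if i.val ∈ S then LinearMap.proj i else 0 := by
  refine LinearMap.ext fun x => ?_
  rw [LinearMap.comp_apply, LinearMap.proj_apply, coordProj_apply]
  split_ifs <;> rfl

lemma mem_idx23_iff {i : ℕ} (hkn : k ≤ n) (hi : i < 2 * n) : i ∈ idx2 n k ∪ idx3 n k ↔ k ≤ i := by
  rw [Set.mem_union, mem_idx2, mem_idx3]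
  omega

/-- The pairing of `W_{k,1}` with `W_{k,3}` lowers the degree by one. -/
lemma conB_pr23 (hkn : k ≤ n) (x : ExteriorAlgebra ℂ (W n)) :
    conB (J1 n k) (derE (pr23 n k) x) =
      derE (pr23 n k) (conB (J1 n k) x) + conB (J1 n k) x := by
  classical
  rw [conB_derE]
  congr 1
  rw [conB, LinearMap.sum_apply]
  refine Finset.sum_congr rfl fun i hi => ?_
  rw [mem_J1] at hi
  rw [proj_comp_coordProj, proj_comp_coordProj, if_neg, if_pos, ctr_zero, LinearMap.zero_apply,
    zero_add]
  · rfl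
  · rw [mem_idx23_iff hkn i.rev.2, Fin.val_rev]; omega
  · rw [mem_idx23_iff hkn i.2]; omega

/-- The rest of the symplectic form pairs `W_{k,2}` with itself and lowers the degree by two. -/
lemma conB_sdiff_pr23 (hkn : k ≤ n) (x : ExteriorAlgebra ℂ (W n)) :
    conB (J1 n n \ J1 n k) (derE (pr23 n k) x) =
      derE (pr23 n k) (conB (J1 n n \ J1 n k) x) + (2 : ℂ) • conB (J1 n n \ J1 n k) x := by
  classical
  rw [conB_derE]
  congr 1
  rw [conB, LinearMap.sum_apply, Finset.smul_sum]
  refine Finset.sum_congr rfl fun i hi => ?_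
  rw [Finset.mem_sdiff, mem_J1, mem_J1] at hi
  rw [proj_comp_coordProj, proj_comp_coordProj, if_pos, if_pos, two_smul]
  · rfl
  · rw [mem_idx23_iff hkn i.rev.2, Fin.val_rev]; omega
  · rw [mem_idx23_iff hkn i.2]; omega

/-- The component of highest degree `s` of a vector annihilated by the contraction with the whole
symplectic form is annihilated by the contraction `conB (J1 n k)`: the latter lowers the degree by
one, and the rest of the former lowers it by two. -/
lemma conB_fal (hkn : k ≤ n) (s : ℕ) (x : ExteriorAlgebra ℂ (W n))
    (hC : conB (J1 n n) x = 0) (hs : fal (derE (pr23 n k)) (s + 1) x = 0) :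
    conB (J1 n k) (fal (derE (pr23 n k)) s x) = 0 := by
  set N := derE (pr23 n k) with hN
  set u := conB (J1 n k) (fal N s x) with hu
  have h1 : N u = ((s : ℂ) - 1) • u := by
    rw [fal_succ_apply, sub_eq_zero] at hs
    have := conB_pr23 hkn (fal N s x)
    rw [← hN, hs, map_smul] at this
    rw [sub_smul, one_smul, hu, this, add_sub_cancel_right]
  have h2 : u = - conB (J1 n n \ J1 n k) (fal (N - 1) s x) := by
    have e1 := fal_semiconj (N := N) (N' := N + 1) (conB (J1 n k))
      (fun y => ((conB_pr23 hkn y)).symm) s x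
    have e2 := fal_semiconj (N := N - 1) (N' := N + 1) (conB (J1 n n \ J1 n k))
      (fun y => by
        rw [LinearMap.sub_apply, map_sub, conB_sdiff_pr23 hkn, LinearMap.add_apply,
          Module.End.one_apply, Module.End.one_apply]
        module) s x
    rw [hu, ← e1, ← e2, eq_neg_iff_add_eq_zero, ← map_add, add_comm (conB (J1 n k) x),
      conB_sdiff hkn, hC, map_zero]
  have h3 : N (fal (N - 1) s x) = 0 := by
    have := fal_add_one (N - 1) s x
    rw [sub_add_cancel, hs, LinearMap.sub_apply, Module.End.one_apply, sub_add_cancel] at this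
    exact this.symm
  have h4 : N u = (-2 : ℂ) • u := by
    have := conB_sdiff_pr23 hkn (fal (N - 1) s x)
    rw [← hN, h3, map_zero] at this
    rw [h2, map_neg, eq_neg_of_add_eq_zero_left this.symm, smul_neg, neg_smul]
  -- the eigenvalues `s - 1` and `-2` are different
  have h5 : ((s : ℂ) + 1) • u = 0 := by
    have := h1.symm.trans h4
    rw [← sub_eq_zero, ← sub_smul] at this
    rw [← this]
    congr 1
    ring
  exact (smul_eq_zero.1 h5).resolve_left (by exact_mod_cast Nat.succ_ne_zero s)

/-- As elements of `𝔫⁻` are lower triangular, they differ from their lower block by an operator of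
degree zero. -/
lemma pr23_mul_nMinus (hkn : k ≤ n) (f : nMinus n) :
    pr23 n k * f.1 - f.1 * pr23 n k = lowerBlock n k f := by
  classical
  have h1 : pr1 n k * f.1 * pr23 n k = 0 := by
    refine LinearMap.pi_ext' fun j => LinearMap.ext_ring (funext fun i => ?_)
    simp only [LinearMap.comp_apply, Module.End.mul_apply]
    rw [coordProj_apply]
    split_ifs with hi
    · have h2 : pr23 n k (LinearMap.single ℂ (fun _ => ℂ) j 1) =
          if j.val ∈ idx2 n k ∪ idx3 n k then Pi.single j 1 else 0 := by
        funext a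
        rw [coordProj_apply]
        by_cases ha : a = j
        · subst ha; split_ifs <;> simp
        · split_ifs <;> simp [ha]
      rw [h2]
      split_ifs with hj
      · rw [mem_idx23_iff hkn j.2] at hj
        exact f.2.2 i j (le_of_lt (Fin.lt_def.2 (lt_of_lt_of_le hi hj)))
      · simp
    · rfl
  have h3 : lowerBlock n k f = pr23 n k * f.1 * pr1 n k := rfl
  have h4 : pr23 n k * f.1 = pr23 n k * f.1 * pr1 n k + pr23 n k * f.1 * pr23 n k := by
    rw [← mul_add, pr1_add_pr23 hkn, mul_one]
  have h5 : f.1 * pr23 n k = pr1 n k * f.1 * pr23 n k + pr23 n k * f.1 * pr23 n k := by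
    rw [mul_assoc, mul_assoc, ← add_mul, pr1_add_pr23 hkn, one_mul]
  rw [h4, h5, h1, h3, zero_add, add_sub_cancel_right]

lemma pr23_mul_lowerBlock (hkn : k ≤ n) (f : Module.End ℂ (W n)) :
    pr23 n k * lowerBlock n k f - lowerBlock n k f * pr23 n k = lowerBlock n k f := by
  have h3 : lowerBlock n k f = pr23 n k * f * pr1 n k := rfl
  have h4 : pr23 n k * pr23 n k = pr23 n k := by rw [coordProj_mul, Set.inter_self]
  have h5 : pr1 n k * pr23 n k = 0 := by
    rw [coordProj_mul, ← coordProj_empty]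
    refine coordProj_congr fun i hi => ?_
    rw [Set.mem_inter_iff, mem_idx23_iff hkn hi, mem_idx1, Set.mem_empty_iff_false, iff_false]
    omega
  rw [h3, mul_assoc _ _ (pr23 n k), h5, mul_zero, sub_zero, ← mul_assoc, ← mul_assoc, h4]

lemma der_pr23_lowerBlock (hkn : k ≤ n) (f : Module.End ℂ (W n)) (x : ⋀[ℂ]^k (W n)) :
    der k (pr23 n k) (der k (lowerBlock n k f) x) =
      der k (lowerBlock n k f) (der k (pr23 n k) x) + der k (lowerBlock n k f) x := by
  rw [der_comm, pr23_mul_lowerBlock hkn]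

/-- The component of degree `s + 1` of `f x` depends only on the component of degree `s` of `x`, if
`x` has degree at most `s`. -/
lemma fal_nMinus (hkn : k ≤ n) (f : nMinus n) (s : ℕ) (x : ⋀[ℂ]^k (W n))
    (hx : fal (der k (pr23 n k)) (s + 1) x = 0) :
    fal (der k (pr23 n k)) (s + 1) (der k f.1 x) =
      ((s + 1 : ℕ) : ℂ) • der k (lowerBlock n k f) (fal (der k (pr23 n k)) s x) := by
  set N := der k (pr23 n k) with hN
  have h0 : der k f.1 x = (der k f.1 - der k (lowerBlock n k f)) x + der k (lowerBlock n k f) x := by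
    simp
  have h1 := fal_semiconj (N := N) (N' := N) (der k f.1 - der k (lowerBlock n k f)) (fun y => by
    rw [LinearMap.sub_apply, LinearMap.sub_apply, map_sub, hN, der_pr23_lowerBlock hkn, der_comm,
      pr23_mul_nMinus hkn]
    abel) (s + 1) x
  have h2 := fal_shift (N := N) (N' := N) (der k (lowerBlock n k f))
    (der_pr23_lowerBlock hkn f) s x
  rw [h0, map_add, h1, h2, hx, map_zero, zero_add]
  rw [fal_succ_apply, sub_eq_zero] at hx
  rw [map_add, hx, map_smul]
  push_cast
  module

lemma fal_nMinus_eq_zero (hkn : k ≤ n) (f : nMinus n) (s : ℕ) (x : ⋀[ℂ]^k (W n))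
    (hx : fal (der k (pr23 n k)) (s + 1) x = 0) :
    fal (der k (pr23 n k)) (s + 2) (der k f.1 x) = 0 := by
  rw [fal_succ_apply, fal_nMinus hkn f s x hx, map_smul, der_pr23_lowerBlock hkn]
  rw [fal_succ_apply, sub_eq_zero] at hx
  rw [hx, map_smul]
  push_cast
  module

lemma der_pr23_hwVec (hkn : k ≤ n) : der k (pr23 n k) (hwVec n k hkn) = 0 := by
  classical
  rw [hwVec, der_ιMulti]
  refine Finset.sum_eq_zero fun i _ => ?_
  refine AlternatingMap.map_coord_zero _ i ?_
  rw [Function.update_self]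
  funext a
  rw [coordProj_apply]
  by_cases ha : a = Fin.castLE (by omega : k ≤ 2 * n) i
  · subst ha
    rw [if_neg]
    · rfl
    · rw [mem_idx23_iff hkn (Fin.castLE (by omega : k ≤ 2 * n) i).2]
      simp
  · simp [ha]

/-- A word of length `s` in `𝔫⁻`, applied to the highest weight vector, has degree at most `s`, and its
component of degree `s` is given by the lower blocks. -/
lemma fal_word (hkn : k ≤ n) (l : List (nMinus n)) :
    fal (der k (pr23 n k)) (l.length + 1) ((l.map (rho n k)).prod (hwVec n k hkn)) = 0 ∧
    fal (der k (pr23 n k)) l.length ((l.map (rho n k)).prod (hwVec n k hkn)) =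
      ((l.length.factorial : ℕ) : ℂ) •
        (l.map fun f => der k (lowerBlock n k f)).prod (hwVec n k hkn) := by
  induction l with
  | nil => simp [fal, der_pr23_hwVec hkn]
  | cons f l ih =>
    simp only [List.map_cons, List.prod_cons, List.length_cons, Module.End.mul_apply]
    refine ⟨fal_nMinus_eq_zero hkn f _ _ ih.1, (fal_nMinus hkn f _ _ ih.1).trans ?_⟩
    rw [ih.2, map_smul, ← smul_assoc, Nat.factorial_succ, Nat.cast_mul]
    rfl

lemma pbwLT_le_fal (hkn : k ≤ n) (s : ℕ) {x : ⋀[ℂ]^k (W n)}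
    (hx : x ∈ pbwLT (rho n k) (hwVec n k hkn) s) : fal (der k (pr23 n k)) s x = 0 := by
  suffices H : pbwLT (rho n k) (hwVec n k hkn) s ≤ LinearMap.ker (fal (der k (pr23 n k)) s) from
    H hx
  refine Submodule.span_le.2 ?_
  rintro _ ⟨l, hl, rfl⟩
  exact fal_mono hl (fal_word hkn l).1

lemma conB_hwVec (hkn : k ≤ n) :
    conB (J1 n n) (hwVec n k hkn : ExteriorAlgebra ℂ (W n)) = 0 := by
  rw [conB, LinearMap.sum_apply]
  refine Finset.sum_eq_zero fun i hi => ?_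
  rw [mem_J1] at hi
  rw [Module.End.mul_apply]
  have h : an i.rev (hwVec n k hkn : ExteriorAlgebra ℂ (W n)) = 0 := by
    refine ctr_ιMulti_eq_zero _ _ fun j => ?_
    rw [LinearMap.proj_apply, Pi.single_apply, if_neg]
    intro h
    have := congrArg Fin.val h
    rw [Fin.val_rev, Fin.val_castLE] at this
    omega
  rw [h, map_zero]

lemma conB_of_mem_pbwLT (hkn : k ≤ n) (s : ℕ) {x : ⋀[ℂ]^k (W n)}
    (hx : x ∈ pbwLT (rho n k) (hwVec n k hkn) s) :
    conB (J1 n n) (x : ExteriorAlgebra ℂ (W n)) = 0 := by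
  suffices H : pbwLT (rho n k) (hwVec n k hkn) s ≤
      LinearMap.ker (conB (J1 n n) ∘ₗ (⋀[ℂ]^k (W n)).subtype) from H hx
  refine Submodule.span_le.2 ?_
  rintro _ ⟨l, -, rfl⟩
  change conB (J1 n n) (((l.map (rho n k)).prod (hwVec n k hkn) : ⋀[ℂ]^k (W n)) :
    ExteriorAlgebra ℂ (W n)) = 0
  induction l with
  | nil => exact conB_hwVec hkn
  | cons f l ih =>
    rw [List.map_cons, List.prod_cons, Module.End.mul_apply]
    have h : rho n k f = der k f.1 := rfl
    rw [h, coe_der, conB_derE_of_mem_spLie f.2.1, ih, map_zero]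

lemma conB_fal_der (hkn : k ≤ n) (s : ℕ) (x : ⋀[ℂ]^k (W n))
    (hC : conB (J1 n n) (x : ExteriorAlgebra ℂ (W n)) = 0)
    (hs : fal (der k (pr23 n k)) (s + 1) x = 0) :
    conB (J1 n k) (fal (der k (pr23 n k)) s x : ExteriorAlgebra ℂ (W n)) = 0 := by
  have h := fun s => fal_semiconj (N := der k (pr23 n k)) (N' := derE (pr23 n k))
    (⋀[ℂ]^k (W n)).subtype (fun y => (coe_der k _ y).symm) s x
  simp only [Submodule.subtype_apply] at h
  rw [← h]
  refine conB_fal hkn s x hC ?_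
  rw [h, hs]
  rfl

/-- The component of degree `s` of an element of `F_s` vanishes only if it lies in `F_{s-1}`. More
precisely, `F_{s-1}` consists of all vectors of degree less than `s` annihilated by the contraction
with the symplectic form. -/
lemma mem_pbwLT_of_fal (hkn : k ≤ n) (s : ℕ) (x : ⋀[ℂ]^k (W n))
    (hC : conB (J1 n n) (x : ExteriorAlgebra ℂ (W n)) = 0)
    (hs : fal (der k (pr23 n k)) s x = 0) : x ∈ pbwLT (rho n k) (hwVec n k hkn) s := by
  induction s generalizing x with
  | zero =>
    rw [show x = 0 from hs]
    exact zero_mem _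
  | succ s ih =>
    have h1 : fal (der k (pr23 n k)) s x ∈ lowWords n k hkn s := by
      refine mem_lowWords hkn s _ (conB_fal_der hkn s x hC hs) ?_
      rwa [fal_succ_apply, sub_eq_zero] at hs
    have h2 : lowWords n k hkn s ≤
        (pbwLT (rho n k) (hwVec n k hkn) (s + 1)).map (fal (der k (pr23 n k)) s) := by
      refine Submodule.span_le.2 ?_
      rintro _ ⟨l, rfl, rfl⟩
      refine ⟨((l.length.factorial : ℕ) : ℂ)⁻¹ • (l.map (rho n k)).prod (hwVec n k hkn),
        Submodule.smul_mem _ _ (word_mem_pbwLT _ _ l (Nat.lt_succ_self _)), ?_⟩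
      rw [map_smul, (fal_word hkn l).2, inv_smul_smul₀]
      exact_mod_cast Nat.factorial_ne_zero _
    obtain ⟨y, hy, hxy⟩ := h2 h1
    have h3 : x - y ∈ pbwLT (rho n k) (hwVec n k hkn) s := by
      refine ih _ ?_ ?_
      · rw [Submodule.coe_sub, map_sub, hC, conB_of_mem_pbwLT hkn _ hy, sub_zero]
      · rw [map_sub, hxy, sub_self]
    have h4 := add_mem (pbwLT_mono _ _ (Nat.le_succ s) h3) hy
    rwa [sub_add_cancel] at h4

/-- The map that sends the class of `y ∈ F_s` to the component of degree `s` of `y`, where the degree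
counts the factors outside of `W_{k,1}`. As `y` has degree at most `s`, this component can be
computed from the number operator `N` as the binomial coefficient `N (N - 1) ⋯ (N - s + 1) / s!`. -/
def iotaPiece (n k : ℕ) (hkn : k ≤ n) (s : ℕ) :
    PBWPiece (rho n k) (hwVec n k hkn) s →ₗ[ℂ] ⋀[ℂ]^k (W n) :=
  Submodule.liftQ _ ((((s.factorial : ℕ) : ℂ)⁻¹ • fal (der k (pr23 n k)) s) ∘ₗ
    (pbwLT (rho n k) (hwVec n k hkn) (s + 1)).subtype) (fun x hx => by
      have h : fal (der k (pr23 n k)) s (x : ⋀[ℂ]^k (W n)) = 0 := pbwLT_le_fal hkn s hx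
      rw [LinearMap.mem_ker, LinearMap.comp_apply, LinearMap.smul_apply, Submodule.subtype_apply, h,
        smul_zero])

/-- The embedding of `V_{ω_k}ᵃ` into `Λᵏ W`. -/
def iota (n k : ℕ) (hkn : k ≤ n) : Va n k hkn →ₗ[ℂ] ⋀[ℂ]^k (W n) :=
  grLift (rho n k) (hwVec n k hkn) (iotaPiece n k hkn)

lemma iota_of (hkn : k ≤ n) (s : ℕ) (y : pbwLT (rho n k) (hwVec n k hkn) (s + 1)) :
    iota n k hkn (grOf (rho n k) (hwVec n k hkn) s (Submodule.Quotient.mk y)) =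
      ((s.factorial : ℕ) : ℂ)⁻¹ • fal (der k (pr23 n k)) s (y : ⋀[ℂ]^k (W n)) := by
  rw [iota, grLift_of]
  rfl

lemma iota_hwA (hkn : k ≤ n) : iota n k hkn (hwA n k hkn) = hwVec n k hkn := by
  refine (iota_of hkn 0 _).trans ?_
  simp [fal]

lemma iota_actA (hkn : k ≤ n) (f : nMinus n) (x : Va n k hkn) :
    iota n k hkn (actA n k hkn f x) = der k (lowerBlock n k f) (iota n k hkn x) := by
  suffices H : iota n k hkn ∘ₗ actA n k hkn f = der k (lowerBlock n k f) ∘ₗ iota n k hkn from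
    LinearMap.congr_fun H x
  refine gr_ext _ _ fun s y => ?_
  obtain ⟨y, rfl⟩ := Submodule.mkQ_surjective _ y
  rw [LinearMap.comp_apply, LinearMap.comp_apply, actA, grAct, grOp_of]
  refine (iota_of hkn (s + 1) ⟨der k f.1 y, pbwLT_act (rho n k) (hwVec n k hkn) f _ y.2⟩).trans ?_
  rw [Submodule.mkQ_apply, iota_of, fal_nMinus hkn f s _ (pbwLT_le_fal hkn _ y.2), map_smul,
    ← smul_assoc, Nat.factorial_succ]
  congr 1
  have h1 : ((s + 1 : ℕ) : ℂ) ≠ 0 := by exact_mod_cast Nat.succ_ne_zero s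
  have h2 : ((s.factorial : ℕ) : ℂ) ≠ 0 := by exact_mod_cast Nat.factorial_ne_zero s
  rw [Nat.cast_mul, smul_eq_mul]
  field_simp

lemma iotaPiece_injective (hkn : k ≤ n) (s : ℕ) : Function.Injective (iotaPiece n k hkn s) := by
  rw [injective_iff_map_eq_zero]
  intro y hy
  obtain ⟨y, rfl⟩ := Submodule.mkQ_surjective _ y
  have h1 : ((s.factorial : ℕ) : ℂ)⁻¹ • fal (der k (pr23 n k)) s (y : ⋀[ℂ]^k (W n)) = 0 := hy
  have h2 : fal (der k (pr23 n k)) s (y : ⋀[ℂ]^k (W n)) = 0 :=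
    (smul_eq_zero.1 h1).resolve_left
      (inv_ne_zero (by exact_mod_cast Nat.factorial_ne_zero s))
  exact (Submodule.Quotient.mk_eq_zero _).2
    (mem_pbwLT_of_fal hkn s _ (conB_of_mem_pbwLT hkn _ y.2) h2)

lemma iotaPiece_mem_eigenspace (hkn : k ≤ n) (s : ℕ)
    (y : PBWPiece (rho n k) (hwVec n k hkn) s) :
    iotaPiece n k hkn s y ∈ Module.End.eigenspace (der k (pr23 n k)) ((s : ℕ) : ℂ) := by
  obtain ⟨y, rfl⟩ := Submodule.mkQ_surjective _ y
  rw [Module.End.mem_eigenspace_iff]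
  have h1 : iotaPiece n k hkn s (Submodule.mkQ _ y) =
      ((s.factorial : ℕ) : ℂ)⁻¹ • fal (der k (pr23 n k)) s (y : ⋀[ℂ]^k (W n)) := rfl
  have h2 := pbwLT_le_fal hkn _ y.2
  rw [fal_succ_apply, sub_eq_zero] at h2
  rw [h1, map_smul, h2, smul_comm]

/-- The map is injective on each homogeneous component, and maps different components to different
eigenspaces of the number operator. -/
lemma iota_injective (hkn : k ≤ n) : Function.Injective (iota n k hkn) := by
  let e : ℕ → Submodule ℂ (⋀[ℂ]^k (W n)) :=
    fun s => Module.End.eigenspace (der k (pr23 n k)) ((s : ℕ) : ℂ)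
  have he : iSupIndep e :=
    (Module.End.eigenspaces_iSupIndep (der k (pr23 n k))).comp Nat.cast_injective
  let T : ∀ s, PBWPiece (rho n k) (hwVec n k hkn) s →ₗ[ℂ] e s := fun s =>
    (iotaPiece n k hkn s).codRestrict (e s) (iotaPiece_mem_eigenspace hkn s)
  have hT : ∀ s, Function.Injective (T s) := fun s x y h =>
    iotaPiece_injective hkn s (congrArg Subtype.val h)
  let g : Va n k hkn →ₗ[ℂ] Π₀ s, e s := DFinsupp.mapRange.linearMap T
  have hg : Function.Injective g :=
    (DFinsupp.mapRange_injective (fun s => T s) (fun s => map_zero (T s))).2 hT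
  have h : iota n k hkn = (DFinsupp.lsum ℕ (fun s => (e s).subtype)) ∘ₗ g := by
    refine gr_ext _ _ fun s y => ?_
    rw [iota, grLift_of, LinearMap.comp_apply]
    have h1 : g (grOf (rho n k) (hwVec n k hkn) s y) = DFinsupp.single s (T s y) :=
      DFinsupp.mapRange_single (hf := fun s => map_zero (T s))
    rw [h1, DFinsupp.lsum_single]
    rfl
  rw [h]
  exact (he.dfinsupp_lsum_injective).comp hg

lemma lowWords_le_range (hkn : k ≤ n) (s : ℕ) :
    lowWords n k hkn s ≤ LinearMap.range (iota n k hkn) := by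
  refine Submodule.span_le.2 ?_
  rintro _ ⟨l, -, rfl⟩
  induction l with
  | nil => exact ⟨_, iota_hwA hkn⟩
  | cons f l ih =>
    obtain ⟨y, hy⟩ := ih
    refine ⟨actA n k hkn f y, ?_⟩
    rw [iota_actA, hy]
    simp

lemma mem_range_iota_of_conB (hkn : k ≤ n) (x : ⋀[ℂ]^k (W n))
    (hC : conB (J1 n k) (x : ExteriorAlgebra ℂ (W n)) = 0) :
    x ∈ LinearMap.range (iota n k hkn) := by
  have key : ∀ m, ∀ x : ⋀[ℂ]^k (W n), conB (J1 n k) (x : ExteriorAlgebra ℂ (W n)) = 0 →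
      fal (der k (pr23 n k)) m x = 0 → x ∈ LinearMap.range (iota n k hkn) := by
    intro m
    induction m with
    | zero =>
      intro x _ hx
      rw [show x = 0 from hx]
      exact zero_mem _
    | succ m ih =>
      intro x hC hx
      have h0 : der k (pr23 n k) (fal (der k (pr23 n k)) m x) =
          (m : ℂ) • fal (der k (pr23 n k)) m x := by
        rwa [fal_succ_apply, sub_eq_zero] at hx
      -- split off the component of degree `m`
      have h1 : conB (J1 n k) (fal (der k (pr23 n k)) m x : ExteriorAlgebra ℂ (W n)) = 0 := by
        have e1 := fal_semiconj (N := der k (pr23 n k)) (N' := derE (pr23 n k) + 1)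
          (conB (J1 n k) ∘ₗ (⋀[ℂ]^k (W n)).subtype) (fun y => by
            simp only [LinearMap.comp_apply, Submodule.subtype_apply, coe_der, conB_pr23 hkn]
            rfl) m x
        simp only [LinearMap.comp_apply, Submodule.subtype_apply, hC, map_zero] at e1
        exact e1.symm
      have h2 : fal (der k (pr23 n k)) m x ∈ LinearMap.range (iota n k hkn) :=
        lowWords_le_range hkn m (mem_lowWords hkn m _ h1 h0)
      have hm : ((m.factorial : ℕ) : ℂ) ≠ 0 := by exact_mod_cast Nat.factorial_ne_zero m
      have h3 : x - ((m.factorial : ℕ) : ℂ)⁻¹ • fal (der k (pr23 n k)) m x ∈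
          LinearMap.range (iota n k hkn) := by
        refine ih _ ?_ ?_
        · rw [Submodule.coe_sub, Submodule.coe_smul, map_sub, map_smul, hC, h1, smul_zero, sub_zero]
        · rw [map_sub, map_smul, fal_eigen h0, Nat.descFactorial_self, inv_smul_smul₀ hm, sub_self]
      have h4 := add_mem h3 (Submodule.smul_mem _ ((m.factorial : ℕ) : ℂ)⁻¹ h2)
      rwa [sub_add_cancel] at h4
  exact key (k + 1) x hC (fal_coordProj_eq_zero _ x)

/-- The image of `V_{ω_k}ᵃ` in `Λᵏ W` is the kernel of the contraction with the part of the symplectic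
form that pairs `W_{k,1}` with `W_{k,3}`. -/
lemma mem_range_iota (hkn : k ≤ n) (x : ⋀[ℂ]^k (W n)) :
    x ∈ LinearMap.range (iota n k hkn) ↔
      conB (J1 n k) (x : ExteriorAlgebra ℂ (W n)) = 0 := by
  refine ⟨?_, mem_range_iota_of_conB hkn x⟩
  rintro ⟨y, rfl⟩
  suffices H : conB (J1 n k) ∘ₗ (⋀[ℂ]^k (W n)).subtype ∘ₗ iota n k hkn = 0 from
    LinearMap.congr_fun H y
  refine gr_ext _ _ fun s y => ?_
  obtain ⟨y, rfl⟩ := Submodule.mkQ_surjective _ y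
  rw [LinearMap.comp_apply, LinearMap.comp_apply, Submodule.mkQ_apply, iota_of, map_smul, map_smul,
    LinearMap.zero_apply, Submodule.subtype_apply,
    conB_fal_der hkn s _ (conB_of_mem_pbwLT hkn _ y.2) (pbwLT_le_fal hkn _ y.2), smul_zero]

end Embedding

/-! ### The orbit of the highest weight line -/

section Orbit

variable {n k : ℕ}

/-- The exponential series of the derivation given by an endomorphism of square zero. -/
lemma sum_derE_pow_ιMulti {X : Module.End ℂ (W n)} (hX : X * X = 0) {m : ℕ} (w : Fin m → W n)
    {N : ℕ} (hN : m < N) :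
    ∑ j ∈ Finset.range N, ((j.factorial : ℂ)⁻¹) • (derE X ^ j) (ExteriorAlgebra.ιMulti ℂ m w) =
      ExteriorAlgebra.ιMulti ℂ m fun i => w i + X (w i) := by
  induction m generalizing N with
  | zero =>
    obtain ⟨N, rfl⟩ := Nat.exists_eq_succ_of_ne_zero hN.ne'
    rw [Finset.sum_range_succ', Finset.sum_eq_zero]
    · simp
    · intro j _
      rw [pow_succ, Module.End.mul_apply, ExteriorAlgebra.ιMulti_zero_apply, derE_one, map_zero,
        smul_zero]
  | succ m ih =>
    obtain ⟨N, rfl⟩ := Nat.exists_eq_succ_of_ne_zero (by omega : N ≠ 0)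
    have hX' : ∀ v, X (X v) = 0 := fun v => LinearMap.congr_fun hX v
    -- the Leibniz rule
    have h1 : ∀ (j : ℕ) (v : W n) (y : ExteriorAlgebra ℂ (W n)),
        (derE X ^ (j + 1)) (ExteriorAlgebra.ι ℂ v * y) =
          ExteriorAlgebra.ι ℂ v * (derE X ^ (j + 1)) y +
            ((j + 1 : ℕ) : ℂ) • (ExteriorAlgebra.ι ℂ (X v) * (derE X ^ j) y) := by
      intro j v y
      induction j with
      | zero => simp [derE_ι_mul, add_comm]
      | succ j ihj =>
        rw [pow_succ', Module.End.mul_apply, ihj, map_add, map_smul, derE_ι_mul, derE_ι_mul, hX',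
          map_zero, zero_mul, zero_add, ← Module.End.mul_apply, ← Module.End.mul_apply,
          ← pow_succ', ← pow_succ', add_comm (ExteriorAlgebra.ι ℂ (X v) * _), add_assoc]
        congr 1
        push_cast
        module
    rw [ExteriorAlgebra.ιMulti_succ_apply, ExteriorAlgebra.ιMulti_succ_apply]
    set y := ExteriorAlgebra.ιMulti ℂ m (Matrix.vecTail w) with hy
    have e1 := ih (Matrix.vecTail w) (N := N + 1) (by omega)
    have e2 := ih (Matrix.vecTail w) (N := N) (by omega)
    rw [← hy] at e1 e2
    have e3 : (ExteriorAlgebra.ιMulti ℂ m (Matrix.vecTail fun i => w i + X (w i))) =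
      ExteriorAlgebra.ιMulti ℂ m fun i => Matrix.vecTail w i + X (Matrix.vecTail w i) := rfl
    rw [e3, map_add, add_mul]
    nth_rewrite 1 [← e1]
    rw [← e2, Finset.mul_sum, Finset.mul_sum, Finset.sum_range_succ', Finset.sum_range_succ',
      add_right_comm, ← Finset.sum_add_distrib]
    congr 1
    · refine Finset.sum_congr rfl fun j _ => ?_
      have hj : ((j + 1 : ℕ) : ℂ) ≠ 0 := by exact_mod_cast Nat.succ_ne_zero j
      rw [h1, smul_add, mul_smul_comm, mul_smul_comm, ← smul_assoc]
      congr 2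
      rw [Nat.factorial_succ, Nat.cast_mul, mul_inv, smul_eq_mul, mul_comm, mul_inv_cancel_left₀ hj]
    · simp

lemma lowerBlock_mul (hkn : k ≤ n) (f g : Module.End ℂ (W n)) :
    lowerBlock n k f * lowerBlock n k g = 0 := by
  have h : pr1 n k * pr23 n k = 0 := by
    rw [coordProj_mul, ← coordProj_empty]
    refine coordProj_congr fun i hi => ?_
    rw [Set.mem_inter_iff, mem_idx23_iff hkn hi, mem_idx1, Set.mem_empty_iff_false, iff_false]
    omega
  have h1 : lowerBlock n k f * lowerBlock n k g =
      pr23 n k * f * (pr1 n k * pr23 n k) * g * pr1 n k := rfl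
  rw [h1, h, mul_zero, zero_mul, zero_mul]

lemma actA_commute (hkn : k ≤ n) (f g : nMinus n) :
    Commute (actA n k hkn f) (actA n k hkn g) := by
  refine LinearMap.ext fun x => iota_injective hkn ?_
  rw [Module.End.mul_apply, Module.End.mul_apply, iota_actA, iota_actA, iota_actA, iota_actA,
    der_comm, lowerBlock_mul hkn, lowerBlock_mul hkn, sub_zero, map_zero, LinearMap.zero_apply,
    add_zero]

lemma actA_add (hkn : k ≤ n) (f g : nMinus n) :
    actA n k hkn (f + g) = actA n k hkn f + actA n k hkn g := by
  refine LinearMap.ext fun x => iota_injective hkn ?_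
  have h : lowerBlock n k (f + g : nMinus n).1 = lowerBlock n k f.1 + lowerBlock n k g.1 := by
    simp [lowerBlock, LinearMap.add_comp, LinearMap.comp_add]
  rw [LinearMap.add_apply, map_add, iota_actA, iota_actA, iota_actA, h, map_add,
    LinearMap.add_apply]

lemma coe_expA (hkn : k ≤ n) (f : nMinus n) :
    (expA n k hkn f : Module.End ℂ (Va n k hkn)) = IsNilpotent.exp (actA n k hkn f) := rfl

lemma expA_add (hkn : k ≤ n) (f g : nMinus n) :
    expA n k hkn (f + g) = expA n k hkn f * expA n k hkn g := by
  refine Units.ext ?_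
  rw [Units.val_mul, coe_expA, coe_expA, coe_expA, actA_add]
  exact IsNilpotent.exp_add_of_commute (actA_commute hkn f g) (grAct_isNilpotent _ _ f)
    (grAct_isNilpotent _ _ g)

lemma expA_neg (hkn : k ≤ n) (f : nMinus n) : expA n k hkn (-f) = (expA n k hkn f)⁻¹ := by
  have h0 : expA n k hkn 0 * expA n k hkn 0 = expA n k hkn 0 := by rw [← expA_add, add_zero]
  have h1 : -f + f = 0 := neg_add_cancel f
  rw [eq_inv_iff_mul_eq_one, ← expA_add, h1]
  simpa using h0

/-- The vectors `w₁, …, w_k`. -/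
abbrev bas (n k : ℕ) (hkn : k ≤ n) (i : Fin k) : W n :=
  Pi.single (Fin.castLE (by omega : k ≤ 2 * n) i) 1

/-- As a lower block has square zero, its exponential acts on `Λᵏ W` by the `k`-th exterior power of
`1 + f_k`. -/
lemma iota_expA (hkn : k ≤ n) (f : nMinus n) :
    iota n k hkn ((expA n k hkn f : Module.End ℂ (Va n k hkn)) (hwA n k hkn)) =
      exteriorPower.ιMulti ℂ k fun i => bas n k hkn i + lowerBlock n k f (bas n k hkn i) := by
  obtain ⟨N, hN⟩ := grAct_isNilpotent (rho n k) (hwVec n k hkn) f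
  have hN' : actA n k hkn f ^ (N + k + 1) = 0 := pow_eq_zero_of_le (by omega) hN
  have hq : ∀ (q : ℚ) (T : Module.End ℂ (Va n k hkn)) (x : Va n k hkn),
      (q • T) x = (q : ℂ) • T x := fun _ _ _ => rfl
  have hp : ∀ j, iota n k hkn ((actA n k hkn f ^ j) (hwA n k hkn)) =
      (der k (lowerBlock n k f) ^ j) (hwVec n k hkn) := by
    intro j
    induction j with
    | zero => exact iota_hwA hkn
    | succ j ih =>
      rw [pow_succ', pow_succ', Module.End.mul_apply, Module.End.mul_apply, iota_actA, ih]
  have hd : ∀ j, (((der k (lowerBlock n k f) ^ j) (hwVec n k hkn) : ⋀[ℂ]^k (W n)) :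
      ExteriorAlgebra ℂ (W n)) = (derE (lowerBlock n k f) ^ j)
        (ExteriorAlgebra.ιMulti ℂ k (bas n k hkn)) := by
    intro j
    induction j with
    | zero => rfl
    | succ j ih =>
      rw [pow_succ', pow_succ', Module.End.mul_apply, Module.End.mul_apply, coe_der, ih]
  rw [coe_expA, IsNilpotent.exp_eq_sum hN', LinearMap.sum_apply, map_sum]
  simp only [hq, map_smul, hp]
  refine Subtype.ext ?_
  rw [Submodule.coe_sum]
  simp only [Submodule.coe_smul, hd]
  rw [exteriorPower.ιMulti_apply_coe,
    ← sum_derE_pow_ιMulti (lowerBlock_mul hkn f f) (bas n k hkn) (by omega : k < N + k + 1)]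
  push_cast
  rfl

/-- The elements of the Lie algebra of the stabilizer of the highest weight line preserve the
filtration. -/
lemma der_mem_pbwLT (hkn : k ≤ n) {Z : Module.End ℂ (W n)} (hZ : Z ∈ spLie n)
    (hZ1 : ∀ x ∈ W1 n k, Z x ∈ W1 n k) (s : ℕ) :
    pbwLT (rho n k) (hwVec n k hkn) s ≤ (pbwLT (rho n k) (hwVec n k hkn) s).comap (der k Z) := by
  refine Submodule.span_le.2 ?_
  rintro _ ⟨l, hl, rfl⟩
  have h := spLT_upper hkn hZ hZ1 (l.map fun f : nMinus n => (⟨f.1, f.2.1⟩ : spLie n))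
  rw [List.map_map, List.length_map] at h
  exact pbwLT_mono _ _ hl (spLT_le hkn _ h)

section General

variable {N M : Type*} [AddCommMonoid N] [Module ℂ N] [AddCommGroup M] [Module ℂ M]
  (ρ : N →ₗ[ℂ] Module.End ℂ M) (v : M)

lemma grOp_mul_grAct (T : Module.End ℂ M) (h : ∀ s, pbwLT ρ v s ≤ (pbwLT ρ v (s + 0)).comap T)
    {x x' : N} (hT : ∀ s, ∀ y ∈ pbwLT ρ v (s + 1), T (ρ x y) - ρ x' (T y) ∈ pbwLT ρ v (s + 1)) :
    grOp ρ v T 0 h * grAct ρ v x = grAct ρ v x' * grOp ρ v T 0 h := by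
  refine gr_ext ρ v fun s y => ?_
  obtain ⟨y, rfl⟩ := Submodule.mkQ_surjective _ y
  rw [Module.End.mul_apply, Module.End.mul_apply, grAct, grAct, grOp_of, grOp_of, grOp_of, grOp_of]
  exact congrArg (grOf ρ v (s + 1)) ((Submodule.Quotient.eq _).2 (hT s y y.2))

lemma grUnit_inv (T T' : LinearMap.GeneralLinearGroup ℂ M) (hTT' : T⁻¹ = T') (h h' h'' h''') :
    (grUnit ρ v T h h')⁻¹ = grUnit ρ v T' h'' h''' := by
  subst hTT'
  exact Units.ext rfl

lemma grOp_grVec (T : Module.End ℂ M) (h : ∀ s, pbwLT ρ v s ≤ (pbwLT ρ v (s + 0)).comap T) (c : ℂ)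
    (hc : T v = c • v) : grOp ρ v T 0 h (grVec ρ v) = c • grVec ρ v := by
  refine (grOp_of _ _ _ _ _ _ _).trans ?_
  rw [grVec, pbwClass, ← map_smul]
  exact congrArg (grOf ρ v 0) (congrArg Submodule.Quotient.mk (Subtype.ext hc))

lemma mul_grExp [Module.Finite ℂ M] (T : LinearMap.GeneralLinearGroup ℂ (PBWGraded ρ v)) {x x' : N}
    (h : (T : Module.End ℂ (PBWGraded ρ v)) * grAct ρ v x = grAct ρ v x' * T) :
    T * grExp ρ v x = grExp ρ v x' * T := by
  obtain ⟨m, hm⟩ := grAct_isNilpotent ρ v x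
  obtain ⟨m', hm'⟩ := grAct_isNilpotent ρ v x'
  have e1 : grAct ρ v x ^ (m + m') = 0 := pow_eq_zero_of_le (by omega) hm
  have e2 : grAct ρ v x' ^ (m + m') = 0 := pow_eq_zero_of_le (by omega) hm'
  have hq : ∀ (q : ℚ) (T : Module.End ℂ (PBWGraded ρ v)), q • T = (q : ℂ) • T := fun _ _ => rfl
  have h3 : ∀ x, (grExp ρ v x : Module.End ℂ (PBWGraded ρ v)) = IsNilpotent.exp (grAct ρ v x) :=
    fun _ => rfl
  refine Units.ext ?_
  rw [Units.val_mul, Units.val_mul, h3, h3, IsNilpotent.exp_eq_sum e1,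
    IsNilpotent.exp_eq_sum e2, Finset.mul_sum, Finset.sum_mul]
  refine Finset.sum_congr rfl fun j _ => ?_
  have h : SemiconjBy (T : Module.End ℂ (PBWGraded ρ v)) (grAct ρ v x) (grAct ρ v x') := h
  rw [hq, hq, mul_smul_comm, smul_mul_assoc, (h.pow_right j).eq]

lemma smul_mem_of_mem_closure {G X : Type*} [Group G] [MulAction G X] {A : Set G} {S : Set X}
    (h : ∀ a ∈ A, ∀ x ∈ S, a • x ∈ S) (h' : ∀ a ∈ A, ∀ x ∈ S, a⁻¹ • x ∈ S) {g : G}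
    (hg : g ∈ Subgroup.closure A) : ∀ x ∈ S, g • x ∈ S := by
  induction hg using Subgroup.closure_induction'' with
  | mem g hg => exact h g hg
  | inv_mem g hg => exact h' g hg
  | one => intro x hx; rwa [one_smul]
  | mul g h _ _ ihg ihh =>
    intro x hx
    rw [mul_smul]
    exact ihg _ (ihh x hx)

end General

/-- `B` normalizes `(𝔫⁻)ᵃ`: the conjugate of `f` by `b` is the sum of an element of `𝔫⁻` and an upper
triangular one, and the latter acts by zero on the graded space in degree one. -/
lemma borelA_mul_actA (hkn : k ≤ n) (b : Borel n) (f : nMinus n) :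
    ∃ f' : nMinus n, (borelA n k hkn b : Module.End ℂ (Va n k hkn)) * actA n k hkn f =
      actA n k hkn f' * (borelA n k hkn b : Module.End ℂ (Va n k hkn)) := by
  obtain ⟨Y, hY, Z, hZ, hZ1, hYZ⟩ := spLie_decomp (conj_mem_spLie f.2.1 b.2.1)
  refine ⟨⟨Y, hY⟩, grOp_mul_grAct _ _ _ _ fun s y hy => ?_⟩
  have h1 : exteriorPower.map k (b.1 : W n →ₗ[ℂ] W n) (der k f.1 y) =
      der k Y (exteriorPower.map k (b.1 : W n →ₗ[ℂ] W n) y) +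
        der k Z (exteriorPower.map k (b.1 : W n →ₗ[ℂ] W n) y) := by
    rw [← LinearMap.add_apply, ← map_add, ← hYZ]
    exact der_natural k _ _ _ (by ext; simp [LinearEquiv.conj_apply]) _
  have h2 : exteriorPower.map k (b.1 : W n →ₗ[ℂ] W n) (der k f.1 y) -
      der k Y (exteriorPower.map k (b.1 : W n →ₗ[ℂ] W n) y) ∈
        pbwLT (rho n k) (hwVec n k hkn) (s + 1) := by
    rw [h1, add_sub_cancel_left]
    exact der_mem_pbwLT hkn hZ (hZ1 k) _ (borel_pbwLT hkn b.2 _ hy)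
  exact h2

lemma borelA_mul_expA (hkn : k ≤ n) (b : Borel n) (f : nMinus n) :
    ∃ f' : nMinus n, borelA n k hkn b * expA n k hkn f =
      expA n k hkn f' * borelA n k hkn b := by
  obtain ⟨f', hf'⟩ := borelA_mul_actA hkn b f
  exact ⟨f', mul_grExp _ _ _ hf'⟩

lemma borelA_hwA (hkn : k ≤ n) (b : Borel n) :
    ∃ c : ℂ, (borelA n k hkn b : Module.End ℂ (Va n k hkn)) (hwA n k hkn) = c • hwA n k hkn := by
  obtain ⟨c, hc⟩ := Submodule.mem_span_singleton.1 (map_hwVec n k hkn b.1 (fun x hx => by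
    rw [← b.2.2 k]
    exact Submodule.mem_map_of_mem hx))
  exact ⟨c, grOp_grVec _ _ _ _ c hc.symm⟩

lemma borelA_inv (hkn : k ≤ n) (b : Borel n) :
    (borelA n k hkn b)⁻¹ = borelA n k hkn b⁻¹ :=
  grUnit_inv _ _ _ _ (Units.ext rfl) _ _ _ _

/-- The line spanned by `exp(f) v`. -/
def cellPt (n k : ℕ) (hkn : k ≤ n) (f : nMinus n) : ℙ ℂ (Va n k hkn) :=
  expA n k hkn f • Projectivization.mk ℂ (hwA n k hkn) (hwA_ne_zero n k hkn)

lemma borelA_smul_mk (hkn : k ≤ n) (b : Borel n) :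
    borelA n k hkn b • Projectivization.mk ℂ (hwA n k hkn) (hwA_ne_zero n k hkn) =
      Projectivization.mk ℂ (hwA n k hkn) (hwA_ne_zero n k hkn) := by
  obtain ⟨c, hc⟩ := borelA_hwA hkn b
  rw [Projectivization.smul_mk, Projectivization.mk_eq_mk_iff']
  exact ⟨c, hc.symm⟩

lemma borelA_smul_cellPt (hkn : k ≤ n) (b : Borel n) (f : nMinus n) :
    borelA n k hkn b • cellPt n k hkn f ∈ Set.range (cellPt n k hkn) := by
  obtain ⟨f', hf'⟩ := borelA_mul_expA hkn b f
  refine ⟨f', ?_⟩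
  rw [cellPt, cellPt, ← mul_smul, hf', mul_smul, borelA_smul_mk]

lemma expA_smul_cellPt (hkn : k ≤ n) (g f : nMinus n) :
    expA n k hkn g • cellPt n k hkn f = cellPt n k hkn (g + f) := by
  rw [cellPt, cellPt, expA_add, mul_smul]

lemma expA_inv_smul_cellPt (hkn : k ≤ n) (g f : nMinus n) :
    (expA n k hkn g)⁻¹ • cellPt n k hkn f = cellPt n k hkn (-g + f) := by
  rw [← expA_neg, expA_smul_cellPt]

lemma cellPt_zero (hkn : k ≤ n) :
    cellPt n k hkn 0 = Projectivization.mk ℂ (hwA n k hkn) (hwA_ne_zero n k hkn) := by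
  have h0 : expA n k hkn 0 * expA n k hkn 0 = expA n k hkn 0 := by rw [← expA_add, add_zero]
  rw [cellPt, mul_eq_left.1 h0, one_smul]

/-- As `B` fixes the highest weight line and normalizes `(N⁻)ᵃ`, the orbit of the line under `Gᵃ` is
the orbit under `(N⁻)ᵃ`. -/
lemma orbit_eq_range (hkn : k ≤ n) :
    MulAction.orbit (Ga n k hkn) (Projectivization.mk ℂ (hwA n k hkn) (hwA_ne_zero n k hkn)) =
      Set.range (cellPt n k hkn) := by
  refine Set.Subset.antisymm ?_ ?_
  · rintro _ ⟨g, rfl⟩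
    refine smul_mem_of_mem_closure (S := Set.range (cellPt n k hkn)) ?_ ?_ g.2 _
      ⟨0, cellPt_zero hkn⟩
    · rintro _ (⟨b, rfl⟩ | ⟨g, rfl⟩) _ ⟨f, rfl⟩
      · exact borelA_smul_cellPt hkn b f
      · exact ⟨_, (expA_smul_cellPt hkn g f).symm⟩
    · rintro _ (⟨b, rfl⟩ | ⟨g, rfl⟩) _ ⟨f, rfl⟩
      · have h := borelA_smul_cellPt hkn b⁻¹ f
        rwa [← borelA_inv] at h
      · exact ⟨_, (expA_inv_smul_cellPt hkn g f).symm⟩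
  · rintro _ ⟨f, rfl⟩
    exact ⟨⟨expA n k hkn f, Subgroup.subset_closure (Or.inr ⟨f, rfl⟩)⟩, rfl⟩

lemma expA_hwA_ne_zero (hkn : k ≤ n) (f : nMinus n) :
    (expA n k hkn f : Module.End ℂ (Va n k hkn)) (hwA n k hkn) ≠ 0 :=
  (smul_ne_zero_iff_ne (expA n k hkn f)).2 (hwA_ne_zero n k hkn)

lemma cellPt_eq_mk (hkn : k ≤ n) (f : nMinus n) : cellPt n k hkn f =
    Projectivization.mk ℂ ((expA n k hkn f : Module.End ℂ (Va n k hkn)) (hwA n k hkn))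
      (expA_hwA_ne_zero hkn f) := rfl

end Orbit

/-! ### Zariski closures, irreducibility and polynomial curves -/

section Zariski

variable {V V' : Type*} [AddCommGroup V] [Module ℂ V] [AddCommGroup V'] [Module ℂ V']

lemma polyVal_mul (p q : MvPolynomial (Module.Dual ℂ V) ℂ) (v : V) :
    polyVal (p * q) v = polyVal p v * polyVal q v := map_mul _ _ _

lemma polyVal_smul {d : ℕ} {p : MvPolynomial (Module.Dual ℂ V) ℂ} (hp : p.IsHomogeneous d) (c : ℂ)
    (v : V) : polyVal p (c • v) = c ^ d * polyVal p v := by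
  have h : (fun φ : Module.Dual ℂ V => φ (c • v)) = c • fun φ : Module.Dual ℂ V => φ v := by
    funext φ
    simp
  rw [polyVal, h, polyVal]
  simp only [MvPolynomial.eval_eq, Finset.mul_sum]
  refine Finset.sum_congr rfl fun m hm => ?_
  have hm' := hp (MvPolynomial.mem_support_iff.1 hm)
  rw [Finsupp.weight_apply, Finsupp.sum] at hm'
  simp only [Pi.smul_apply, smul_eq_mul, mul_pow, Finset.prod_mul_distrib]
  rw [Finset.prod_pow_eq_pow_sum, ← hm']
  simp only [Pi.one_apply, mul_one, smul_eq_mul]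
  ring

lemma polyVal_rep_mk {d : ℕ} {p : MvPolynomial (Module.Dual ℂ V) ℂ} (hp : p.IsHomogeneous d) {v : V}
    (hv : v ≠ 0) : polyVal p (Projectivization.mk ℂ v hv).rep = 0 ↔ polyVal p v = 0 := by
  obtain ⟨a, ha⟩ := Projectivization.exists_smul_eq_mk_rep ℂ v hv
  rw [← ha, Units.smul_def, polyVal_smul hp]
  simp

/-- The pullback of a polynomial function along a linear map. -/
def polyComap (T : V →ₗ[ℂ] V') (p : MvPolynomial (Module.Dual ℂ V') ℂ) :
    MvPolynomial (Module.Dual ℂ V) ℂ :=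
  MvPolynomial.rename (fun φ => φ ∘ₗ T) p

lemma polyVal_polyComap (T : V →ₗ[ℂ] V') (p : MvPolynomial (Module.Dual ℂ V') ℂ) (v : V) :
    polyVal (polyComap T p) v = polyVal p (T v) := by
  rw [polyVal, polyComap, MvPolynomial.eval_rename]
  rfl

lemma isHomogeneous_polyComap (T : V →ₗ[ℂ] V') {d : ℕ} {p : MvPolynomial (Module.Dual ℂ V') ℂ}
    (hp : p.IsHomogeneous d) : (polyComap T p).IsHomogeneous d := hp.rename_isHomogeneous

lemma isTopologicalBasis_zariski :
    @TopologicalSpace.IsTopologicalBasis _ (zariski V)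
      {O | ∃ (d : ℕ) (p : MvPolynomial (Module.Dual ℂ V) ℂ), p.IsHomogeneous d ∧
        O = {x | polyVal p x.rep ≠ 0}} := by
  let _ := zariski V
  refine ⟨?_, ?_, rfl⟩
  · rintro _ ⟨d, p, hp, rfl⟩ _ ⟨e, q, hq, rfl⟩ x ⟨hx1, hx2⟩
    refine ⟨_, ⟨d + e, p * q, hp.mul hq, rfl⟩, ?_, ?_⟩
    · rw [Set.mem_ofPred_eq, polyVal_mul]
      exact mul_ne_zero hx1 hx2
    · intro y hy
      rw [Set.mem_ofPred_eq, polyVal_mul] at hy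
      exact ⟨left_ne_zero_of_mul hy, right_ne_zero_of_mul hy⟩
  · refine Set.eq_univ_of_univ_subset fun x _ => ?_
    refine Set.mem_sUnion.2 ⟨_, ⟨0, 1, MvPolynomial.isHomogeneous_one _ _, rfl⟩, ?_⟩
    simp [polyVal]

lemma mem_closure_zariski {S : Set (ℙ ℂ V)} {x : ℙ ℂ V} :
    x ∈ @closure _ (zariski V) S ↔ ∀ (d : ℕ) (p : MvPolynomial (Module.Dual ℂ V) ℂ),
      p.IsHomogeneous d → (∀ y ∈ S, polyVal p y.rep = 0) → polyVal p x.rep = 0 := by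
  let _ := zariski V
  rw [isTopologicalBasis_zariski.mem_closure_iff]
  constructor
  · intro h d p hp hS
    by_contra hx
    obtain ⟨y, hy, hyS⟩ := h _ ⟨d, p, hp, rfl⟩ hx
    exact hy (hS y hyS)
  · rintro h _ ⟨d, p, hp, rfl⟩ hx
    by_contra hne
    refine hx (h d p hp fun y hy => ?_)
    by_contra hy'
    exact hne ⟨y, hy', hy⟩

lemma continuous_map_zariski (T : V →ₗ[ℂ] V') (hT : Function.Injective T) :
    @Continuous _ _ (zariski V) (zariski V') (Projectivization.map T hT) := by
  let _ := zariski V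
  let _ := zariski V'
  refine continuous_generateFrom_iff.2 ?_
  rintro _ ⟨d, p, hp, rfl⟩
  refine TopologicalSpace.isOpen_generateFrom_of_mem ⟨d, polyComap T p,
    isHomogeneous_polyComap T hp, ?_⟩
  ext x
  rw [Set.mem_preimage, Set.mem_ofPred_eq, Set.mem_ofPred_eq, polyVal_polyComap]
  conv_lhs => rw [← x.mk_rep]
  rw [Projectivization.map_mk, Ne, polyVal_rep_mk hp]

/-- A curve in `V` is polynomial if its composites with all linear forms are polynomials. -/
def PolyCurve (γ : ℂ → V) : Prop :=
  ∀ φ : Module.Dual ℂ V, ∃ P : Polynomial ℂ, ∀ t, φ (γ t) = P.eval t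

lemma PolyCurve.polyVal {γ : ℂ → V} (hγ : PolyCurve γ) (p : MvPolynomial (Module.Dual ℂ V) ℂ) :
    ∃ P : Polynomial ℂ, ∀ t, polyVal p (γ t) = P.eval t := by
  choose F hF using hγ
  refine ⟨MvPolynomial.eval₂ Polynomial.C F p, fun t => ?_⟩
  rw [← Polynomial.coe_evalRingHom, MvPolynomial.hom_eval₂, DegSymp.polyVal, MvPolynomial.eval,
    MvPolynomial.coe_eval₂Hom]
  congr 1
  · ext c
    simp
  · funext φ
    simp [hF]

lemma polyCurve_of_comp {T : V →ₗ[ℂ] V'} (hT : Function.Injective T) {γ : ℂ → V}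
    (h : PolyCurve fun t => T (γ t)) : PolyCurve γ := by
  intro φ
  obtain ⟨S, hS⟩ := LinearMap.exists_leftInverse_of_injective T (LinearMap.ker_eq_bot.2 hT)
  obtain ⟨P, hP⟩ := h (φ ∘ₗ S)
  refine ⟨P, fun t => ?_⟩
  rw [← hP, LinearMap.comp_apply, ← LinearMap.comp_apply S T, hS, LinearMap.id_apply]

lemma polyCurve_ιMulti {m : ℕ} (a b : Fin m → V) :
    PolyCurve fun t => exteriorPower.ιMulti ℂ m fun i => a i + t • b i := by
  classical
  intro φ
  let f : MultilinearMap ℂ (fun _ : Fin m => V) ℂ :=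
    (φ.compAlternatingMap (exteriorPower.ιMulti ℂ m)).toMultilinearMap
  refine ⟨∑ s : Finset (Fin m), Polynomial.C (f (s.piecewise a b)) * Polynomial.X ^ (sᶜ).card,
    fun t => ?_⟩
  have h1 : φ (exteriorPower.ιMulti ℂ m fun i => a i + t • b i) =
    f (a + fun i => t • b i) := rfl
  rw [h1, f.map_add_univ, Polynomial.eval_finsetSum]
  refine Finset.sum_congr rfl fun s _ => ?_
  have h2 : s.piecewise a (fun i => t • b i) =
      (sᶜ).piecewise (fun i => t • s.piecewise a b i) (s.piecewise a b) := by
    funext i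
    by_cases hi : i ∈ s <;> simp [hi]
  rw [h2, f.map_piecewise_smul (fun _ => t), Finset.prod_const, smul_eq_mul, mul_comm,
    Polynomial.eval_mul, Polynomial.eval_C, Polynomial.eval_pow, Polynomial.eval_X]

/-- A set of points of a projective space is irreducible if any two of its points lie on a polynomial
curve in the set. -/
lemma isPreirreducible_of_polyCurve {S : Set (ℙ ℂ V)}
    (h : ∀ x ∈ S, ∀ y ∈ S, ∃ γ : ℂ → V, PolyCurve γ ∧ ∃ hγ : ∀ t, γ t ≠ 0,
      (∀ t, Projectivization.mk ℂ (γ t) (hγ t) ∈ S) ∧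
        Projectivization.mk ℂ (γ 0) (hγ 0) = x ∧ Projectivization.mk ℂ (γ 1) (hγ 1) = y) :
    @IsPreirreducible _ (zariski V) S := by
  let _ := zariski V
  rintro u v hu hv ⟨x, hxS, hxu⟩ ⟨y, hyS, hyv⟩
  obtain ⟨_, ⟨d, p, hp, rfl⟩, hxp, hpu⟩ :=
    isTopologicalBasis_zariski.exists_subset_of_mem_open hxu hu
  obtain ⟨_, ⟨e, q, hq, rfl⟩, hyq, hqv⟩ :=
    isTopologicalBasis_zariski.exists_subset_of_mem_open hyv hv
  obtain ⟨γ, hγ, hγ0, hγS, hγx, hγy⟩ := h x hxS y hyS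
  obtain ⟨P, hP⟩ := hγ.polyVal p
  obtain ⟨Q, hQ⟩ := hγ.polyVal q
  have hP0 : P ≠ 0 := by
    rintro rfl
    rw [← hγx, Set.mem_ofPred_eq, Ne, polyVal_rep_mk hp, hP] at hxp
    simp at hxp
  have hQ0 : Q ≠ 0 := by
    rintro rfl
    rw [← hγy, Set.mem_ofPred_eq, Ne, polyVal_rep_mk hq, hQ] at hyq
    simp at hyq
  -- a nonzero polynomial has a non-root
  obtain ⟨t, ht⟩ : ∃ t, (P * Q).eval t ≠ 0 := by
    by_contra! hne
    exact mul_ne_zero hP0 hQ0 (Polynomial.funext fun t => by rw [hne t, Polynomial.eval_zero])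
  rw [Polynomial.eval_mul] at ht
  refine ⟨_, hγS t, hpu ?_, hqv ?_⟩
  · rw [Set.mem_ofPred_eq, Ne, polyVal_rep_mk hp, hP]
    exact left_ne_zero_of_mul ht
  · rw [Set.mem_ofPred_eq, Ne, polyVal_rep_mk hq, hQ]
    exact right_ne_zero_of_mul ht

/-- The Zariski closure of the cone over a set of vectors. -/
def coneClosure (S : Set V) : Set V :=
  {v | ∀ (d : ℕ) (p : MvPolynomial (Module.Dual ℂ V) ℂ), p.IsHomogeneous d →
    (∀ w ∈ S, polyVal p w = 0) → polyVal p v = 0}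

lemma smul_mem_coneClosure {S : Set V} {v : V} (hv : v ∈ S) (c : ℂ) : c • v ∈ coneClosure S := by
  intro d p hp hS
  rw [polyVal_smul hp, hS v hv, mul_zero]

/-- Limits along polynomial curves. -/
lemma PolyCurve.mem_coneClosure {γ : ℂ → V} (hγ : PolyCurve γ) {S : Set V} {F : Set ℂ}
    (hF : F.Finite) (h : ∀ t, t ∉ F → γ t ∈ coneClosure S) (t : ℂ) : γ t ∈ coneClosure S := by
  intro d p hp hS
  obtain ⟨P, hP⟩ := hγ.polyVal p
  have h0 : P = 0 := by
    refine Polynomial.eq_zero_of_infinite_isRoot P (hF.infinite_compl.mono fun t ht => ?_)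
    rw [Set.mem_ofPred_eq, Polynomial.IsRoot, ← hP]
    exact h t ht d p hp hS
  rw [hP, h0, Polynomial.eval_zero]

/-- Under an injective linear map the closure of a set of points in projective space becomes the
closure of the cone over its image. -/
lemma mem_closure_range_iff {T : V →ₗ[ℂ] V'} (hT : Function.Injective T) {α : Type*} (g : α → V)
    (hg : ∀ a, g a ≠ 0) {v : V} (hv : v ≠ 0) :
    Projectivization.mk ℂ v hv ∈ @closure _ (zariski V)
      (Set.range fun a => Projectivization.mk ℂ (g a) (hg a)) ↔
      T v ∈ coneClosure (Set.range fun a => T (g a)) := by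
  rw [mem_closure_zariski]
  constructor
  · intro h d p hp hS
    have := h d (polyComap T p) (isHomogeneous_polyComap T hp) (by
      rintro _ ⟨a, rfl⟩
      rw [polyVal_rep_mk (isHomogeneous_polyComap T hp), polyVal_polyComap]
      exact hS _ ⟨a, rfl⟩)
    rwa [polyVal_rep_mk (isHomogeneous_polyComap T hp), polyVal_polyComap] at this
  · intro h d p hp hS
    obtain ⟨S, hTS⟩ := LinearMap.exists_leftInverse_of_injective T (LinearMap.ker_eq_bot.2 hT)
    have hTS' : ∀ v, S (T v) = v := LinearMap.congr_fun hTS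
    have := h d (polyComap S p) (isHomogeneous_polyComap S hp) (by
      rintro _ ⟨a, rfl⟩
      rw [polyVal_polyComap, hTS', ← polyVal_rep_mk hp (hg a)]
      exact hS _ ⟨a, rfl⟩)
    rwa [polyVal_polyComap, hTS', ← polyVal_rep_mk hp hv] at this

end Zariski

/-! ### Irreducibility of the degenerate Grassmannian -/

section Irreducible

variable {n k : ℕ}

lemma SpGrA_eq (hkn : k ≤ n) :
    SpGrA n k hkn = @closure _ (zariski (Va n k hkn)) (Set.range (cellPt n k hkn)) := by
  rw [SpGrA, orbit_eq_range]

/-- The vectors `(1 + f) w₁ ∧ ⋯ ∧ (1 + f) w_k`, where `f` is the lower block of an element of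
`𝔫⁻`. -/
def cellVecs (n k : ℕ) (hkn : k ≤ n) : Set (⋀[ℂ]^k (W n)) :=
  Set.range fun f : nMinus n =>
    exteriorPower.ιMulti ℂ k fun i => bas n k hkn i + lowerBlock n k f (bas n k hkn i)

lemma mk_mem_SpGrA (hkn : k ≤ n) {v : Va n k hkn} (hv : v ≠ 0) :
    Projectivization.mk ℂ v hv ∈ SpGrA n k hkn ↔
      iota n k hkn v ∈ coneClosure (cellVecs n k hkn) := by
  rw [SpGrA_eq]
  have h := mem_closure_range_iff (iota_injective hkn)
    (fun f : nMinus n => (expA n k hkn f : Module.End ℂ (Va n k hkn)) (hwA n k hkn))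
    (expA_hwA_ne_zero hkn) hv
  simp only [iota_expA] at h
  exact h

lemma isIrreducible_SpGrA (hkn : k ≤ n) :
    @IsIrreducible _ (zariski (Va n k hkn)) (SpGrA n k hkn) := by
  rw [SpGrA_eq]
  let _ := zariski (Va n k hkn)
  refine IsIrreducible.closure ⟨⟨_, 0, rfl⟩, isPreirreducible_of_polyCurve ?_⟩
  rintro _ ⟨f, rfl⟩ _ ⟨g, rfl⟩
  refine ⟨fun t => (expA n k hkn (f + t • (g - f)) : Module.End ℂ (Va n k hkn)) (hwA n k hkn),
    polyCurve_of_comp (iota_injective hkn) ?_, fun t => expA_hwA_ne_zero hkn _,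
    fun t => ⟨_, cellPt_eq_mk hkn _⟩, ?_, ?_⟩
  · simp only [iota_expA]
    have h : ∀ t : ℂ, lowerBlock n k (f + t • (g - f) : nMinus n).1 =
        lowerBlock n k f.1 + t • lowerBlock n k (g - f : nMinus n).1 := by
      intro t
      simp [lowerBlock, LinearMap.add_comp, LinearMap.comp_add, LinearMap.smul_comp,
        LinearMap.comp_smul]
    simp only [h, LinearMap.add_apply, LinearMap.smul_apply, ← add_assoc]
    exact polyCurve_ιMulti _ _
  · rw [← cellPt_eq_mk]
    congr 1
    module
  · rw [← cellPt_eq_mk]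
    congr 1
    module

end Irreducible

/-! ### Plücker relations -/

section Pluecker

variable {V : Type*} [AddCommGroup V] [Module ℂ V]

/-- The composite of the contractions with the linear forms in a list. -/
def ctrL (L : List (Module.Dual ℂ V)) : Module.End ℂ (ExteriorAlgebra ℂ V) := (L.map ctr).prod

lemma ctrL_cons (φ : Module.Dual ℂ V) (L : List (Module.Dual ℂ V)) (x : ExteriorAlgebra ℂ V) :
    ctrL (φ :: L) x = ctr φ (ctrL L x) := by
  rw [ctrL, List.map_cons, List.prod_cons]
  rfl

lemma ctrL_mem {m l : ℕ} (L : List (Module.Dual ℂ V)) (hL : L.length = l) {x : ExteriorAlgebra ℂ V}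
    (hx : x ∈ ⋀[ℂ]^(m + l) V) : ctrL L x ∈ ⋀[ℂ]^m V := by
  subst hL
  induction L generalizing m with
  | nil => exact hx
  | cons φ L ih =>
    rw [ctrL_cons]
    refine ctr_mem φ (ih ?_)
    rwa [List.length_cons, ← add_assoc, add_right_comm] at hx

lemma ctr_ctrL_of_mem {φ : Module.Dual ℂ V} {L : List (Module.Dual ℂ V)} (h : φ ∈ L)
    (x : ExteriorAlgebra ℂ V) : ctr φ (ctrL L x) = 0 := by
  induction L with
  | nil => simp at h
  | cons ψ L ih =>
    rw [ctrL_cons]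
    rcases List.mem_cons.1 h with rfl | h
    · exact ctr_ctr_self _ _
    · rw [ctr_ctr, ih h, map_zero, neg_zero]

lemma ctr_ctrL_eraseIdx (L : List (Module.Dual ℂ V)) (j : ℕ) (hj : j < L.length)
    (x : ExteriorAlgebra ℂ V) :
    ctr L[j] (ctrL (L.eraseIdx j) x) = ((-1 : ℂ) ^ j) • ctrL L x := by
  induction L generalizing j with
  | nil => simp at hj
  | cons ψ L ih =>
    cases j with
    | zero => simp [ctrL_cons]
    | succ j =>
      rw [List.length_cons, Nat.add_lt_add_iff_right] at hj
      have h := ih j hj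
      rw [List.eraseIdx_cons_succ, ctrL_cons, ctrL_cons, List.getElem_cons_succ, ctr_ctr, h,
        map_smul, pow_succ, mul_neg_one, neg_smul]

/-- The span of the products of `m` vectors of a subspace. -/
def multiSpan (U : Submodule ℂ V) (m : ℕ) : Submodule ℂ (ExteriorAlgebra ℂ V) :=
  Submodule.span ℂ {y | ∃ v : Fin m → V, (∀ i, v i ∈ U) ∧ y = ExteriorAlgebra.ιMulti ℂ m v}

lemma ι_mul_mem_multiSpan {U : Submodule ℂ V} {m : ℕ} {u : V} (hu : u ∈ U) :
    multiSpan U m ≤ (multiSpan U (m + 1)).comap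
      (LinearMap.mulLeft ℂ (ExteriorAlgebra.ι ℂ u)) := by
  refine Submodule.span_le.2 ?_
  rintro _ ⟨v, hv, rfl⟩
  refine Submodule.subset_span ⟨Matrix.vecCons u v, ?_, ?_⟩
  · intro i
    refine Fin.cases ?_ (fun i => ?_) i
    · exact hu
    · exact hv i
  · rw [ExteriorAlgebra.ιMulti_succ_apply]
    rfl

lemma ctr_mem_multiSpan {U : Submodule ℂ V} (φ : Module.Dual ℂ V) (m : ℕ) :
    multiSpan U (m + 1) ≤ (multiSpan U m).comap (ctr φ) := by
  refine Submodule.span_le.2 ?_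
  rintro _ ⟨v, hv, rfl⟩
  change ctr φ _ ∈ multiSpan U m
  induction m with
  | zero =>
    rw [ExteriorAlgebra.ιMulti_succ_apply, ctr_ι_mul, ExteriorAlgebra.ιMulti_zero_apply, ctr_one,
      mul_zero, sub_zero]
    exact Submodule.smul_mem _ _ (Submodule.subset_span
      ⟨Fin.elim0, fun i => i.elim0, (ExteriorAlgebra.ιMulti_zero_apply _).symm⟩)
  | succ m ih =>
    rw [ExteriorAlgebra.ιMulti_succ_apply, ctr_ι_mul]
    exact sub_mem (Submodule.smul_mem _ _ (Submodule.subset_span ⟨_, fun i => hv i.succ, rfl⟩))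
      (ι_mul_mem_multiSpan (hv 0) (ih (Matrix.vecTail v) (fun i => hv i.succ)))

lemma ctrL_mem_multiSpan {U : Submodule ℂ V} (L : List (Module.Dual ℂ V)) {m : ℕ}
    {x : ExteriorAlgebra ℂ V} (hx : x ∈ multiSpan U (m + L.length)) : ctrL L x ∈ multiSpan U m := by
  induction L generalizing m with
  | nil => exact hx
  | cons φ L ih =>
    rw [ctrL_cons]
    refine ctr_mem_multiSpan φ m (ih ?_)
    rwa [List.length_cons, ← add_assoc, add_right_comm] at hx

lemma ι_mul_ιMulti_eq_zero {m : ℕ} (u : Fin m → V) {a : V}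
    (ha : a ∈ Submodule.span ℂ (Set.range u)) :
    ExteriorAlgebra.ι ℂ a * ExteriorAlgebra.ιMulti ℂ m u = 0 := by
  induction ha using Submodule.span_induction with
  | zero => rw [map_zero, zero_mul]
  | add x y _ _ hx hy => rw [map_add, add_mul, hx, hy, add_zero]
  | smul c x _ hx => rw [map_smul, smul_mul_assoc, hx, smul_zero]
  | mem x hx =>
    obtain ⟨i, rfl⟩ := hx
    have h := ExteriorAlgebra.ιMulti_succ_apply (R := ℂ) (Matrix.vecCons (u i) u)
    have h0 : ExteriorAlgebra.ιMulti ℂ (m + 1) (Matrix.vecCons (u i) u) = 0 :=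
      AlternatingMap.map_eq_zero_of_eq _ _ (i := 0) (j := i.succ) (by simp) (Fin.succ_ne_zero i).symm
    rw [h0] at h
    exact h.symm

/-- The Plücker relations: the contraction of a decomposable vector to a vector lies in the
corresponding subspace. -/
lemma ctrL_ιMulti_mul {m : ℕ} (u : Fin (m + 1) → V) (L : List (Module.Dual ℂ V))
    (hL : L.length = m) :
    ctrL L (ExteriorAlgebra.ιMulti ℂ (m + 1) u) * ExteriorAlgebra.ιMulti ℂ (m + 1) u = 0 := by
  subst hL
  have h1 : ExteriorAlgebra.ιMulti ℂ (L.length + 1) u ∈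
      multiSpan (Submodule.span ℂ (Set.range u)) (1 + L.length) := by
    rw [add_comm 1]
    exact Submodule.subset_span ⟨u, fun i => Submodule.subset_span ⟨i, rfl⟩, rfl⟩
  have h2 := ctrL_mem_multiSpan L h1
  generalize ctrL L (ExteriorAlgebra.ιMulti ℂ (L.length + 1) u) = y at h2
  induction h2 using Submodule.span_induction with
  | zero => rw [zero_mul]
  | add x y _ _ hx hy => rw [add_mul, hx, hy, add_zero]
  | smul c x _ hx => rw [smul_mul_assoc, hx, smul_zero]
  | mem x hx =>
    obtain ⟨v, hv, rfl⟩ := hx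
    rw [ExteriorAlgebra.ιMulti_succ_apply, ExteriorAlgebra.ιMulti_zero_apply, mul_one]
    exact ι_mul_ιMulti_eq_zero u (hv 0)

/-- A bilinear form, restricted to the diagonal, is a quadratic polynomial. -/
lemma exists_polyVal_eq_bilin [FiniteDimensional ℂ V] (B : V →ₗ[ℂ] V →ₗ[ℂ] ℂ) :
    ∃ p : MvPolynomial (Module.Dual ℂ V) ℂ, p.IsHomogeneous 2 ∧ ∀ v, polyVal p v = B v v := by
  let b := Module.finBasis ℂ V
  refine ⟨∑ i, ∑ j, MvPolynomial.C (B (b i) (b j)) *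
    (MvPolynomial.X (b.coord i) * MvPolynomial.X (b.coord j)), ?_, fun v => ?_⟩
  · refine MvPolynomial.IsHomogeneous.sum _ _ _ fun i _ =>
      MvPolynomial.IsHomogeneous.sum _ _ _ fun j _ => ?_
    have := (MvPolynomial.isHomogeneous_C (Module.Dual ℂ V) (B (b i) (b j))).mul
      ((MvPolynomial.isHomogeneous_X ℂ (b.coord i)).mul (MvPolynomial.isHomogeneous_X ℂ (b.coord j)))
    exact this
  · conv_rhs => rw [← b.sum_repr v]
    simp only [polyVal, map_sum, map_mul, MvPolynomial.eval_C, MvPolynomial.eval_X, map_smul,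
      LinearMap.sum_apply, LinearMap.smul_apply, smul_eq_mul, Module.Basis.coord_apply]
    rw [Finset.sum_comm]
    refine Finset.sum_congr rfl fun i _ => ?_
    rw [Finset.mul_sum]
    exact Finset.sum_congr rfl fun j _ => by ring

lemma ctrL_mul_self_of_mem_coneClosure [FiniteDimensional ℂ V] {m : ℕ} {S : Set (⋀[ℂ]^(m + 1) V)}
    (hS : ∀ x ∈ S, ∃ u, x = exteriorPower.ιMulti ℂ (m + 1) u) {x : ⋀[ℂ]^(m + 1) V}
    (hx : x ∈ coneClosure S) (L : List (Module.Dual ℂ V)) (hL : L.length = m) :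
    ctrL L (x : ExteriorAlgebra ℂ V) * (x : ExteriorAlgebra ℂ V) = 0 := by
  refine (Module.forall_dual_apply_eq_zero_iff ℂ _).1 fun ψ => ?_
  obtain ⟨p, hp, hpv⟩ := exists_polyVal_eq_bilin
    (((LinearMap.mul ℂ (ExteriorAlgebra ℂ V)).compl₁₂
      (ctrL L ∘ₗ (⋀[ℂ]^(m + 1) V).subtype) (⋀[ℂ]^(m + 1) V).subtype).compr₂ ψ)
  refine (hpv x).symm.trans (hx 2 p hp fun w hw => (hpv w).trans ?_)
  obtain ⟨u, rfl⟩ := hS w hw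
  exact (congrArg ψ (ctrL_ιMulti_mul u L hL)).trans (map_zero ψ)

lemma exists_ctrL_ne_zero {n m : ℕ} {x : ExteriorAlgebra ℂ (W n)} (hx : x ∈ ⋀[ℂ]^m (W n))
    (hx0 : x ≠ 0) : ∃ L : List (Module.Dual ℂ (W n)), L.length = m ∧ ctrL L x ≠ 0 := by
  induction m generalizing x with
  | zero => exact ⟨[], rfl, hx0⟩
  | succ m ih =>
    obtain ⟨j, hj⟩ : ∃ j, an j x ≠ 0 := by
      by_contra! h
      -- the derivation that extends the identity multiplies by the degree
      have h1 : derE (1 : Module.End ℂ (W n)) x = 0 := by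
        simp only [derE, LinearMap.sum_apply, LinearMap.smul_apply, Module.End.mul_apply, h,
          map_zero, smul_zero, Finset.sum_const_zero]
      have h2 := coe_der (m + 1) (1 : Module.End ℂ (W n)) ⟨x, hx⟩
      rw [der_one, h1] at h2
      have h3 : ((m + 1 : ℕ) : ℂ) • x = 0 := h2
      exact hx0 ((smul_eq_zero.1 h3).resolve_left (by exact_mod_cast Nat.succ_ne_zero m))
    obtain ⟨L, hL, hLx⟩ := ih (ctr_mem _ hx) hj
    refine ⟨L ++ [LinearMap.proj j], by simp [hL], ?_⟩
    have h : ctrL (L ++ [(LinearMap.proj j : Module.Dual ℂ (W n))]) x = ctrL L (an j x) := by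
      simp [ctrL, an]
    rwa [h]

/-- A solution of the Plücker relations is decomposable. -/
lemma exists_eq_smul_ιMulti {n m : ℕ} {x : ⋀[ℂ]^(m + 1) (W n)} (hx0 : x ≠ 0)
    (hx : ∀ L : List (Module.Dual ℂ (W n)), L.length = m →
      ctrL L (x : ExteriorAlgebra ℂ (W n)) * (x : ExteriorAlgebra ℂ (W n)) = 0) :
    ∃ (c : ℂ) (u : Fin (m + 1) → W n), x = c • exteriorPower.ιMulti ℂ (m + 1) u := by
  obtain ⟨L, hL, hLx⟩ := exists_ctrL_ne_zero x.2 (fun h => hx0 (Subtype.ext h))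
  have h0 : ctrL L (x : ExteriorAlgebra ℂ (W n)) ∈ ⋀[ℂ]^0 (W n) :=
    ctrL_mem L hL (by rw [zero_add]; exact x.2)
  rw [ExteriorAlgebra.exteriorPower, pow_zero, Submodule.mem_one] at h0
  obtain ⟨c, hc⟩ := h0
  have hc0 : c ≠ 0 := by
    rintro rfl
    exact hLx (by rw [← hc, map_zero])
  have h1 : ∀ j : Fin (m + 1), ∃ a : W n, ExteriorAlgebra.ι ℂ a = ctrL (L.eraseIdx j) x := by
    intro j
    have h : ctrL (L.eraseIdx j) (x : ExteriorAlgebra ℂ (W n)) ∈ ⋀[ℂ]^1 (W n) := by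
      refine ctrL_mem _ (l := m) ?_ (by rw [add_comm 1]; exact x.2)
      rw [List.length_eraseIdx_of_lt (by omega), hL, Nat.add_sub_cancel]
    rw [ExteriorAlgebra.exteriorPower, pow_one] at h
    exact h
  choose a ha using h1
  -- up to signs, the forms in `L` are `c` times the dual system of the vectors `a j`
  have h2 : ∀ (φ : Module.Dual ℂ (W n)) j, algebraMap ℂ (ExteriorAlgebra ℂ (W n)) (φ (a j)) =
      ctr φ (ctrL (L.eraseIdx j) x) := by
    intro φ j
    have h := ctr_ι_mul φ (a j) 1
    rw [ctr_one, mul_zero, sub_zero, mul_one, ha, ← Algebra.algebraMap_eq_smul_one] at h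
    exact h.symm
  have hinj : Function.Injective (algebraMap ℂ (ExteriorAlgebra ℂ (W n))) :=
    ExteriorAlgebra.algebraMap_leftInverse (W n) |>.injective
  obtain ⟨c', hc'⟩ := eq_smul_ιMulti a
    (fun i : Fin (m + 1) => (((-1 : ℂ) ^ (i : ℕ)) * c)⁻¹ • L[i.val]'(by omega)) (fun i j => by
      rw [LinearMap.smul_apply]
      split_ifs with hij
      · subst hij
        have h : algebraMap ℂ (ExteriorAlgebra ℂ (W n)) ((L[i.val]'(by omega)) (a i)) =
            algebraMap ℂ (ExteriorAlgebra ℂ (W n)) (((-1 : ℂ) ^ (i : ℕ)) * c) := by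
          rw [h2, ctr_ctrL_eraseIdx, map_mul, hc, ← Algebra.smul_def]
        rw [hinj h, smul_eq_mul, inv_mul_cancel₀]
        exact mul_ne_zero (pow_ne_zero _ (by norm_num)) hc0
      · have h : algebraMap ℂ (ExteriorAlgebra ℂ (W n)) ((L[i.val]'(by omega)) (a j)) =
            algebraMap ℂ (ExteriorAlgebra ℂ (W n)) 0 := by
          rw [h2, ctr_ctrL_of_mem, map_zero]
          rw [List.mem_eraseIdx_iff_getElem]
          exact ⟨i, by omega, fun h => hij (Fin.ext h), rfl⟩
        rw [hinj h, smul_zero]) x (fun i => by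
      rw [ha]
      refine hx _ ?_
      rw [List.length_eraseIdx_of_lt (by omega), hL, Nat.add_sub_cancel])
  exact ⟨c', a, hc'⟩

end Pluecker

/-! ### Points of the Grassmannian as decomposable vectors -/

section Gr

variable {n k : ℕ}

lemma ιMulti_ne_zero {U : Submodule ℂ (W n)} (hU : Module.finrank ℂ U = k) {u : Fin k → W n}
    (hu : Submodule.span ℂ (Set.range u) = U) : exteriorPower.ιMulti ℂ k u ≠ 0 := by
  have hli : LinearIndependent ℂ u := by
    rw [linearIndependent_iff_card_eq_finrank_span, Set.finrank, hu, hU, Fintype.card_fin]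
  have h := exteriorPower.ιMulti_family_linearIndependent_field k hli
  have h1 := h.ne_zero (Set.powersetCard.ofFinEmbEquiv (RelEmbedding.refl (· ≤ ·)))
  rw [exteriorPower.ιMulti_family, Equiv.symm_apply_apply] at h1
  exact h1

lemma plucker_eq_mk (U : Gr n k) {u : Fin k → W n} (hu : Submodule.span ℂ (Set.range u) = U.1) :
    plucker n k U = Projectivization.mk ℂ (exteriorPower.ιMulti ℂ k u) (ιMulti_ne_zero U.2 hu) := by
  apply Projectivization.submodule_injective
  rw [plucker, Projectivization.submodule_mk'', Projectivization.submodule_mk]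
  symm
  refine Submodule.eq_of_le_of_finrank_eq ?_ ?_
  · rw [Submodule.span_singleton_le_iff_mem]
    refine ⟨exteriorPower.ιMulti ℂ k fun i => ⟨u i, hu ▸ Submodule.subset_span ⟨i, rfl⟩⟩, ?_⟩
    rw [exteriorPower.map_apply_ιMulti]
    rfl
  · rw [finrank_range_map k _ U.2, finrank_span_singleton (ιMulti_ne_zero U.2 hu)]

lemma exists_span_range_eq {U : Submodule ℂ (W n)} (hU : Module.finrank ℂ U = k) :
    ∃ u : Fin k → W n, Submodule.span ℂ (Set.range u) = U := by
  let b := Module.finBasisOfFinrankEq ℂ U hU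
  refine ⟨fun i => b i, ?_⟩
  have h : (Set.range fun i => (b i : W n)) = U.subtype '' Set.range b := by
    rw [← Set.range_comp]
    rfl
  rw [h, Submodule.span_image, b.span_eq, Submodule.map_top, Submodule.range_subtype]

lemma finrank_span_of_ιMulti_ne_zero {u : Fin k → W n} (hu : exteriorPower.ιMulti ℂ k u ≠ 0) :
    Module.finrank ℂ (Submodule.span ℂ (Set.range u)) = k := by
  have hli : LinearIndependent ℂ u := by
    by_contra h
    exact hu (AlternatingMap.map_linearDependent _ _ h)
  rw [finrank_span_eq_card hli, Fintype.card_fin]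

end Gr

/-! ### Isotropy of the projection -/

section Isotropy

variable {n k : ℕ}

lemma form_apply (x y : W n) :
    form n x y = ∑ i ∈ J1 n n, (x i * y i.rev - x i.rev * y i) := by
  conv_lhs => rw [pi_eq_sum_univ' x, map_sum, LinearMap.sum_apply]
  simp only [map_smul, LinearMap.smul_apply, form_single, smul_eq_mul]
  rw [sum_univ_eq_sum_J1]
  refine Finset.sum_congr rfl fun i hi => ?_
  rw [mem_J1] at hi
  rw [if_pos hi, if_neg (by rw [Fin.val_rev]; omega), Fin.rev_rev]
  ring

/-- The pullback of the symplectic form under the projection to `W_{k,1} ⊕ W_{k,3}`. -/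
def om (n k : ℕ) : LinearMap.BilinForm ℂ (W n) := (form n).compl₁₂ (pr13 n k) (pr13 n k)

lemma om_apply_form (x y : W n) : om n k x y = form n (pr13 n k x) (pr13 n k y) := rfl

lemma mem_idx13_iff {i : ℕ} (hi : i < 2 * n) :
    i ∈ idx1 k ∪ idx3 n k ↔ i < k ∨ 2 * n ≤ i + k := by
  rw [Set.mem_union, mem_idx1, mem_idx3]
  omega

lemma pr13_apply_of_mem {x : W n} {i : Fin (2 * n)} (hi : i.val < k ∨ 2 * n ≤ i.val + k) :
    pr13 n k x i = x i := by
  classical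
  rw [pr13, coordProj_apply, if_pos ((mem_idx13_iff i.2).2 hi)]

lemma pr13_apply_of_not_mem {x : W n} {i : Fin (2 * n)} (hi : ¬ (i.val < k ∨ 2 * n ≤ i.val + k)) :
    pr13 n k x i = 0 := by
  classical
  rw [pr13, coordProj_apply, if_neg (fun h => hi ((mem_idx13_iff i.2).1 h))]

lemma om_apply (hkn : k ≤ n) (x y : W n) :
    om n k x y = ∑ i ∈ J1 n k, (x i * y i.rev - x i.rev * y i) := by
  rw [om_apply_form, form_apply]
  symm
  refine Finset.sum_subset_zero_on_sdiff (J1_subset hkn) (fun i hi => ?_) (fun i hi => ?_)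
  · rw [Finset.mem_sdiff, mem_J1, mem_J1] at hi
    rw [pr13_apply_of_not_mem (i := i) (by omega), pr13_apply_of_not_mem (i := i) (by omega)]
    ring
  · rw [mem_J1] at hi
    have h : i.rev.val < k ∨ 2 * n ≤ i.rev.val + k := by rw [Fin.val_rev]; omega
    rw [pr13_apply_of_mem (Or.inl hi), pr13_apply_of_mem (Or.inl hi), pr13_apply_of_mem h,
      pr13_apply_of_mem h]

lemma isIsotropic_map_iff (U : Submodule ℂ (W n)) :
    IsIsotropic (U.map (pr13 n k)) ↔ ∀ x ∈ U, ∀ y ∈ U, om n k x y = 0 := by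
  constructor
  · intro h x hx y hy
    exact h _ ⟨x, hx, rfl⟩ _ ⟨y, hy, rfl⟩
  · rintro h _ ⟨x, hx, rfl⟩ _ ⟨y, hy, rfl⟩
    exact h x hx y hy

lemma om_eq_zero_of_mem_span {m : ℕ} {u : Fin m → W n} (h : ∀ i j, om n k (u i) (u j) = 0) {x y : W n}
    (hx : x ∈ Submodule.span ℂ (Set.range u)) (hy : y ∈ Submodule.span ℂ (Set.range u)) :
    om n k x y = 0 := by
  have h1 : ∀ i, om n k (u i) y = 0 := by
    intro i
    have : Submodule.span ℂ (Set.range u) ≤ LinearMap.ker (om n k (u i)) := by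
      refine Submodule.span_le.2 ?_
      rintro _ ⟨j, rfl⟩
      exact h i j
    exact this hy
  have : Submodule.span ℂ (Set.range u) ≤ LinearMap.ker ((om n k).flip y) := by
    refine Submodule.span_le.2 ?_
    rintro _ ⟨j, rfl⟩
    exact h1 j
  exact this hx

/-- The commutator of the contraction with the form and the exterior multiplication with `u` is the
contraction with the linear form `⟨u, -⟩`. -/
lemma conB_ι_mul (hkn : k ≤ n) (u : W n) (x : ExteriorAlgebra ℂ (W n)) :
    conB (J1 n k) (ExteriorAlgebra.ι ℂ u * x) =
      ExteriorAlgebra.ι ℂ u * conB (J1 n k) x - ctr (om n k u) x := by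
  have h1 : om n k u = ∑ i ∈ J1 n k, (u i • (LinearMap.proj i.rev : Module.Dual ℂ (W n)) -
      u i.rev • (LinearMap.proj i : Module.Dual ℂ (W n))) := by
    refine LinearMap.ext fun y => ?_
    rw [om_apply hkn, LinearMap.sum_apply]
    rfl
  rw [h1, ctr_sum, conB, LinearMap.sum_apply, LinearMap.sum_apply, LinearMap.sum_apply,
    Finset.mul_sum, ← Finset.sum_sub_distrib]
  refine Finset.sum_congr rfl fun i _ => ?_
  have h2 : ∀ j (y : ExteriorAlgebra ℂ (W n)), an j (ExteriorAlgebra.ι ℂ u * y) =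
      u j • y - ExteriorAlgebra.ι ℂ u * an j y := fun j y => ctr_ι_mul _ u y
  have h3 : ctr (u i • (LinearMap.proj i.rev : Module.Dual ℂ (W n)) -
      u i.rev • (LinearMap.proj i : Module.Dual ℂ (W n))) x = u i • an i.rev x - u i.rev • an i x := by
    simp [ctr, an]
  rw [Module.End.mul_apply, Module.End.mul_apply, h2, map_sub, map_smul, h2, h3]
  abel

lemma conB_ιMulti_eq_zero (hkn : k ≤ n) {m : ℕ} (w : Fin m → W n)
    (hw : ∀ i j, om n k (w i) (w j) = 0) :
    conB (J1 n k) (ExteriorAlgebra.ιMulti ℂ m w) = 0 := by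
  induction m with
  | zero =>
    rw [ExteriorAlgebra.ιMulti_zero_apply, conB, LinearMap.sum_apply]
    refine Finset.sum_eq_zero fun i _ => ?_
    have h : an i.rev (1 : ExteriorAlgebra ℂ (W n)) = 0 := ctr_one _
    rw [Module.End.mul_apply, h, map_zero]
  | succ m ih =>
    rw [ExteriorAlgebra.ιMulti_succ_apply, conB_ι_mul hkn,
      ih (Matrix.vecTail w) (fun i j => hw i.succ j.succ),
      ctr_ιMulti_eq_zero _ (Matrix.vecTail w) (fun j => hw 0 j.succ), mul_zero, sub_zero]

/-- If `x` is the decomposable vector of a subspace and lies in the kernel of the contraction, then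
the subspace has isotropic projection. Applied to `a ∧ x = 0`, the commutator formula gives
`⟨a, -⟩ ⌟ x = 0`, and then `b ∧ x = 0` gives `⟨a, b⟩ x = 0`. -/
lemma om_eq_zero_of_conB (hkn : k ≤ n) {x : ExteriorAlgebra ℂ (W n)} (hx0 : x ≠ 0)
    (hx : conB (J1 n k) x = 0) {a b : W n} (ha : ExteriorAlgebra.ι ℂ a * x = 0)
    (hb : ExteriorAlgebra.ι ℂ b * x = 0) : om n k a b = 0 := by
  have h1 := conB_ι_mul hkn a x
  rw [ha, hx, mul_zero, map_zero, zero_sub, eq_comm, neg_eq_zero] at h1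
  have h2 := ctr_ι_mul (om n k a) b x
  rw [hb, h1, map_zero, mul_zero, sub_zero, eq_comm] at h2
  exact (smul_eq_zero.1 h2).resolve_right hx0

/-- Every point of the degenerate Grassmannian is a point of `Z_k`. -/
lemma exists_plucker_eq (hk : 1 ≤ k) (hkn : k ≤ n) {y : ℙ ℂ (Va n k hkn)}
    (hy : y ∈ SpGrA n k hkn) :
    ∃ U ∈ Zk n k, plucker n k U =
      Projectivization.map (iota n k hkn) (iota_injective hkn) y := by
  obtain ⟨m, rfl⟩ := Nat.exists_eq_succ_of_ne_zero (by omega : k ≠ 0)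
  induction y using Projectivization.ind with
  | h v hv =>
    have hx0 : iota n (m + 1) hkn v ≠ 0 := fun h =>
      hv (iota_injective hkn (h.trans (map_zero _).symm))
    have hx := (mk_mem_SpGrA hkn hv).1 hy
    have hcon := (mem_range_iota hkn _).1 ⟨v, rfl⟩
    obtain ⟨c, u, hu⟩ := exists_eq_smul_ιMulti hx0
      (ctrL_mul_self_of_mem_coneClosure (by rintro _ ⟨f, rfl⟩; exact ⟨_, rfl⟩) hx)
    have hc : c ≠ 0 := by
      rintro rfl
      exact hx0 (by rw [hu, zero_smul])
    have hu0 : exteriorPower.ιMulti ℂ (m + 1) u ≠ 0 := by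
      intro h
      exact hx0 (by rw [hu, h, smul_zero])
    rw [hu, Submodule.coe_smul, map_smul] at hcon
    have hcon' := (smul_eq_zero.1 hcon).resolve_left hc
    refine ⟨⟨Submodule.span ℂ (Set.range u), finrank_span_of_ιMulti_ne_zero hu0⟩, ?_, ?_⟩
    · refine (isIsotropic_map_iff _).2 fun a ha b hb => ?_
      exact om_eq_zero_of_conB hkn (fun h => hu0 (Subtype.ext h)) hcon'
        (ι_mul_ιMulti_eq_zero u ha) (ι_mul_ιMulti_eq_zero u hb)
    · rw [plucker_eq_mk _ rfl, Projectivization.map_mk, Projectivization.mk_eq_mk_iff']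
      exact ⟨c⁻¹, by rw [hu, inv_smul_smul₀ hc]⟩

end Isotropy

/-! ### Moving a subspace with isotropic projection into the big cell -/

section Moving

variable {n k : ℕ}

lemma mem_coordSpan {S : Set ℕ} {x : W n} :
    x ∈ coordSpan n S ↔ ∀ i : Fin (2 * n), i.val ∉ S → x i = 0 := by
  constructor
  · intro hx i hi
    have h : coordSpan n S ≤ LinearMap.ker (LinearMap.proj i : W n →ₗ[ℂ] ℂ) := by
      refine Submodule.span_le.2 ?_
      rintro _ ⟨j, hj, rfl⟩
      have hij : i ≠ j := fun h => hi (h ▸ hj)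
      simp [hij]
    exact h hx
  · intro h
    rw [pi_eq_sum_univ' x]
    refine sum_mem fun i _ => ?_
    by_cases hi : i.val ∈ S
    · exact Submodule.smul_mem _ _ (Submodule.subset_span ⟨i, hi, rfl⟩)
    · rw [h i hi, zero_smul]
      exact zero_mem _

lemma coordSpan_sup (S T : Set ℕ) : coordSpan n S ⊔ coordSpan n T = coordSpan n (S ∪ T) := by
  rw [coordSpan, coordSpan, coordSpan, ← Submodule.span_union]
  congr 1
  ext w
  constructor
  · rintro (⟨i, hi, rfl⟩ | ⟨i, hi, rfl⟩)
    · exact ⟨i, Or.inl hi, rfl⟩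
    · exact ⟨i, Or.inr hi, rfl⟩
  · rintro ⟨i, hi | hi, rfl⟩
    · exact Or.inl ⟨i, hi, rfl⟩
    · exact Or.inr ⟨i, hi, rfl⟩

lemma mem_W1_sup_W2 (hkn : k ≤ n) {x : W n} : x ∈ W1 n k ⊔ W2 n k ↔ ∀ i, i.val ∈ idx3 n k → x i = 0 := by
  rw [W1, W2, coordSpan_sup, mem_coordSpan]
  refine forall_congr' fun i => ?_
  rw [Set.mem_union, mem_idx1, mem_idx2, mem_idx3]
  have h : ¬ (i.val < k ∨ k ≤ i.val ∧ i.val + k < 2 * n) ↔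
      2 * n ≤ i.val + k ∧ i.val < 2 * n := by omega
  rw [h]

lemma mem_W1_sup_W3 {x : W n} : x ∈ W1 n k ⊔ W3 n k ↔ pr13 n k x = x := by
  classical
  rw [W1, W3, coordSpan_sup, mem_coordSpan, pr13, funext_iff]
  refine forall_congr' fun i => ?_
  rw [coordProj_apply]
  split_ifs with h
  · simp [h]
  · simp [h, eq_comm]

lemma pr13_eq_zero_of_mem {x : W n} (hx : x ∈ W2 n k) : pr13 n k x = 0 := by
  classical
  rw [W2, mem_coordSpan] at hx
  funext i
  by_cases hi : i.val < k ∨ 2 * n ≤ i.val + k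
  · rw [pr13_apply_of_mem hi]
    exact hx i (by rw [mem_idx2]; omega)
  · rw [pr13_apply_of_not_mem hi]
    rfl

lemma pr13_mul_self : pr13 n k * pr13 n k = pr13 n k := by
  rw [pr13, coordProj_mul, Set.inter_self]

/-- An element of square zero of the Lie algebra of `Sp_{2k}` gives an element `1 + Y` of
`Sp_{2k}`. -/
lemma exists_SpSub {Y : Module.End ℂ (W n)} (hY : Y ∈ spLie n) (hYY : Y * Y = 0)
    (hl : pr13 n k * Y = Y) (hr : Y * pr13 n k = Y) :
    ∃ g ∈ SpSub n k, (g : W n →ₗ[ℂ] W n) = 1 + Y := by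
  have h1 : ∀ x, Y (Y x) = 0 := LinearMap.congr_fun hYY
  have h2 : ∀ x, pr13 n k (Y x) = Y x := LinearMap.congr_fun hl
  have h3 : ∀ x, Y (pr13 n k x) = Y x := LinearMap.congr_fun hr
  let g : W n ≃ₗ[ℂ] W n := LinearEquiv.ofLinearMap (1 + Y) (1 - Y)
    (LinearMap.ext fun x => by simp [h1]) (LinearMap.ext fun x => by simp [h1])
  have hg : ∀ x, g x = x + Y x := fun x => rfl
  refine ⟨g, ⟨?_, ?_, ?_⟩, rfl⟩
  · intro x y
    rw [mem_spLie] at hY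
    rw [hg, hg, map_add, map_add, LinearMap.add_apply, LinearMap.add_apply, hY x y, hY x (Y y), h1,
      map_zero]
    ring
  · intro x hx
    rw [hg, ← h3, pr13_eq_zero_of_mem hx, map_zero, add_zero]
  · refine le_antisymm ?_ ?_
    · rintro _ ⟨x, hx, rfl⟩
      rw [SetLike.mem_coe, mem_W1_sup_W3] at hx
      rw [mem_W1_sup_W3]
      change pr13 n k (x + Y x) = x + Y x
      rw [map_add, hx, h2]
    · intro x hx
      rw [mem_W1_sup_W3] at hx
      refine ⟨x - Y x, ?_, ?_⟩
      · rw [SetLike.mem_coe, mem_W1_sup_W3, map_sub, hx, h2]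
      · change (x - Y x) + Y (x - Y x) = x
        rw [map_sub, h1]
        abel

lemma om_add_apply {Y : Module.End ℂ (W n)} (hY : Y ∈ spLie n) (hYY : Y * Y = 0)
    (hl : pr13 n k * Y = Y) (hr : Y * pr13 n k = Y) (x y : W n) :
    om n k (x + Y x) (y + Y y) = om n k x y := by
  have h1 : ∀ x, Y (Y x) = 0 := LinearMap.congr_fun hYY
  have h2 : ∀ x, pr13 n k (Y x) = Y x := LinearMap.congr_fun hl
  have h3 : ∀ x, Y (pr13 n k x) = Y x := LinearMap.congr_fun hr
  rw [mem_spLie] at hY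
  have e1 : form n (Y x) (pr13 n k y) = - form n (pr13 n k x) (Y y) := by rw [← h3 x, hY, h3]
  have e2 : form n (Y x) (Y y) = 0 := by rw [hY, h1, map_zero, neg_zero]
  rw [om_apply_form, om_apply_form, map_add (pr13 n k) x, map_add (pr13 n k) y, h2, h2, map_add,
    map_add, LinearMap.add_apply, LinearMap.add_apply, e1, e2]
  ring

/-- The transvections `1 + t E_{i,2n+1-i}` of `Sp_{2k}`. -/
lemma transvection (hkn : k ≤ n) {i : Fin (2 * n)} (hi : i ∈ J1 n k) (t : ℂ) :
    t • eu i i.rev ∈ spLie n ∧ (t • eu i i.rev) * (t • eu i i.rev) = 0 ∧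
      pr13 n k * (t • eu i i.rev) = t • eu i i.rev ∧
      (t • eu i i.rev) * pr13 n k = t • eu i i.rev := by
  classical
  have hne := ne_rev_of_mem hkn hi hi
  rw [mem_J1] at hi
  refine ⟨Submodule.smul_mem _ _ (mem_spLie.2 fun x y => ?_), ?_, ?_, ?_⟩
  · rw [form_swap n x, neg_neg, eu_apply, eu_apply, map_smul, map_smul, LinearMap.smul_apply,
      LinearMap.smul_apply, form_single, form_single, smul_eq_mul, smul_eq_mul]
    ring
  · rw [smul_mul_smul_comm, eu_mul, if_neg hne.symm, smul_zero]
  · rw [mul_smul_comm, pr13, coordProj_mul_eu, if_pos]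
    exact Or.inl hi
  · rw [smul_mul_assoc, pr13, eu_mul_coordProj, if_pos]
    refine Or.inr ?_
    rw [mem_idx3, Fin.val_rev]
    omega

/-- If the projection of `U` to `W_{k,1} ⊕ W_{k,3}` is isotropic and meets `W_{k,3}`, then there are
transvections that make this intersection smaller. -/
lemma exists_transvection (hkn : k ≤ n) {U : Submodule ℂ (W n)}
    (hU : ∀ x ∈ U, ∀ y ∈ U, om n k x y = 0) (h0 : U.map (pr13 n k) ⊓ W3 n k ≠ ⊥) :
    ∃ i ∈ J1 n k, ∀ t : ℂ, t ≠ 0 →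
      (U.map (1 + t • eu i i.rev)).map (pr13 n k) ⊓ W3 n k < U.map (pr13 n k) ⊓ W3 n k := by
  obtain ⟨w, ⟨⟨a, ha, rfl⟩, hw3⟩, hw0⟩ := (Submodule.ne_bot_iff _).1 h0
  have hw3' : ∀ j ∈ J1 n k, a j = 0 := by
    intro j hj
    rw [mem_J1] at hj
    rw [W3, SetLike.mem_coe, mem_coordSpan] at hw3
    have := hw3 j (by rw [mem_idx3]; omega)
    rwa [pr13_apply_of_mem (Or.inl hj)] at this
  obtain ⟨i, hi, hwi⟩ : ∃ i ∈ J1 n k, a i.rev ≠ 0 := by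
    by_contra! h
    refine hw0 (funext fun j => ?_)
    by_cases hj : j.val < k ∨ 2 * n ≤ j.val + k
    · rw [pr13_apply_of_mem hj]
      rcases hj with hj | hj
      · exact hw3' j (mem_J1.2 hj)
      · have := h j.rev (by rw [mem_J1, Fin.val_rev]; omega)
        rwa [Fin.rev_rev] at this
    · exact pr13_apply_of_not_mem hj
  have hi' : i.val < k := mem_J1.1 hi
  have hir : i.rev.val < k ∨ 2 * n ≤ i.rev.val + k := by rw [Fin.val_rev]; omega
  refine ⟨i, hi, fun t ht => ?_⟩
  -- the elements of the new intersection are fixed by the transvection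
  have key : ∀ y ∈ (U.map (1 + t • eu i i.rev)).map (pr13 n k) ⊓ W3 n k,
      y ∈ U.map (pr13 n k) ⊓ W3 n k ∧ y i.rev = 0 := by
    rintro _ ⟨⟨_, ⟨x, hx, rfl⟩, rfl⟩, hy3⟩
    have e1 : (1 + t • eu i i.rev) x = x + (t * x i.rev) • Pi.single i 1 := by
      simp [eu_apply, smul_smul]
    rw [e1] at hy3 ⊢
    have hy3' : ∀ j ∈ J1 n k, x j + t * x i.rev * (Pi.single i 1 : W n) j = 0 := by
      intro j hj
      rw [mem_J1] at hj
      rw [W3, SetLike.mem_coe, mem_coordSpan] at hy3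
      have := hy3 j (by rw [mem_idx3]; omega)
      rwa [pr13_apply_of_mem (Or.inl hj)] at this
    have e2 : om n k x a = x i * a i.rev := by
      rw [om_apply hkn, Finset.sum_eq_single i]
      · rw [hw3' i hi, mul_zero, sub_zero]
      · intro j hj hji
        have := hy3' j hj
        rw [Pi.single_eq_of_ne hji, mul_zero, add_zero] at this
        rw [this, hw3' j hj]
        ring
      · exact fun h => absurd hi h
    have e3 : x i = 0 := (mul_eq_zero.1 (e2.symm.trans (hU x hx a ha))).resolve_right hwi
    have e4 : x i.rev = 0 := by
      have := hy3' i hi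
      rw [e3, Pi.single_eq_same, mul_one, zero_add] at this
      exact (mul_eq_zero.1 this).resolve_left ht
    rw [e4, mul_zero, zero_smul, add_zero] at hy3 ⊢
    exact ⟨⟨⟨x, hx, rfl⟩, hy3⟩, by rw [pr13_apply_of_mem hir, e4]⟩
  refine lt_of_le_of_ne (fun y hy => (key y hy).1) fun heq => hwi ?_
  have h1 : pr13 n k a ∈ U.map (pr13 n k) ⊓ W3 n k := ⟨⟨a, ha, rfl⟩, hw3⟩
  rw [← heq] at h1
  have h2 := (key _ h1).2
  rwa [pr13_apply_of_mem hir] at h2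

end Moving

section Shear

variable {n k : ℕ}

lemma pr1_apply_of_mem {x : W n} {i : Fin (2 * n)} (hi : i ∈ J1 n k) : pr1 n k x i = x i := by
  classical
  rw [coordProj_apply]
  exact if_pos (mem_J1.1 hi)

lemma pr1_apply_of_not_mem {x : W n} {i : Fin (2 * n)} (hi : i ∉ J1 n k) : pr1 n k x i = 0 := by
  classical
  rw [coordProj_apply]
  exact if_neg (fun h => hi (mem_J1.2 h))

lemma pr1_pr13 (x : W n) : pr1 n k (pr13 n k x) = pr1 n k x := by
  funext i
  by_cases hi : i ∈ J1 n k
  · rw [pr1_apply_of_mem hi, pr1_apply_of_mem hi, pr13_apply_of_mem (Or.inl (mem_J1.1 hi))]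
  · rw [pr1_apply_of_not_mem hi, pr1_apply_of_not_mem hi]

/-- If the projection of `U` to `W_{k,1} ⊕ W_{k,3}` is isotropic and does not meet `W_{k,3}`, then it
is contained in the graph of a symmetric map `S` from `W_{k,1}` to `W_{k,3}`. -/
lemma exists_shear (hkn : k ≤ n) {U : Submodule ℂ (W n)}
    (hU : ∀ x ∈ U, ∀ y ∈ U, om n k x y = 0) (h0 : U.map (pr13 n k) ⊓ W3 n k = ⊥) :
    ∃ S : Module.End ℂ (W n), S ∈ spLie n ∧ S * S = 0 ∧ pr13 n k * S = S ∧ S * pr13 n k = S ∧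
      (∀ x, ∀ i ∈ J1 n k, S x i = 0) ∧ ∀ x ∈ U, ∀ i ∈ J1 n k, S x i.rev = x i.rev := by
  set K := U.map (pr13 n k) with hK
  have hinj : Function.Injective ((pr1 n k).domRestrict K) := by
    rw [injective_iff_map_eq_zero]
    rintro ⟨x, hx⟩ hx1
    have hx1' : pr1 n k x = 0 := hx1
    refine Subtype.ext ?_
    have hx3 : x ∈ K ⊓ W3 n k := by
      refine ⟨hx, ?_⟩
      obtain ⟨a, -, rfl⟩ := hx
      rw [W3, SetLike.mem_coe, mem_coordSpan]
      intro i hi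
      by_cases hi1 : i.val < k
      · have h := congrFun hx1' i
        rwa [pr1_apply_of_mem (mem_J1.2 hi1)] at h
      · have hi2 := i.2
        rw [mem_idx3] at hi
        exact pr13_apply_of_not_mem (by omega)
    rw [h0] at hx3
    exact hx3
  obtain ⟨g, hg⟩ := LinearMap.exists_leftInverse_of_injective _ (LinearMap.ker_eq_bot.2 hinj)
  -- a linear map `q` to `K` that is determined by the `W_{k,1}`-component and fixes `K`
  let q : Module.End ℂ (W n) := K.subtype ∘ₗ g ∘ₗ pr1 n k
  have hq1 : ∀ x, q (pr1 n k x) = q x := by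
    intro x
    have : pr1 n k * pr1 n k = pr1 n k := by rw [coordProj_mul, Set.inter_self]
    exact congrArg (fun y => (g y : W n)) (LinearMap.congr_fun this x)
  have hq2 : ∀ a ∈ U, q a = pr13 n k a := by
    intro a ha
    have h1 : pr1 n k a = (pr1 n k).domRestrict K ⟨pr13 n k a, a, ha, rfl⟩ := (pr1_pr13 a).symm
    change (g (pr1 n k a) : W n) = _
    rw [h1, ← LinearMap.comp_apply, hg]
    rfl
  have hq3 : ∀ x y, om n k (q x) (q y) = 0 := by
    intro x y
    obtain ⟨a, ha, hax⟩ := (g (pr1 n k x)).2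
    obtain ⟨b, hb, hby⟩ := (g (pr1 n k y)).2
    have e1 : q x = pr13 n k a := hax.symm
    have e2 : q y = pr13 n k b := hby.symm
    have h := hU a ha b hb
    have e3 : ∀ z, pr13 n k (pr13 n k z) = pr13 n k z := LinearMap.congr_fun pr13_mul_self
    rw [om_apply_form] at h ⊢
    rwa [e1, e2, e3, e3]
  let B : LinearMap.BilinForm ℂ (W n) :=
    ∑ i ∈ J1 n k, (LinearMap.proj i : Module.Dual ℂ (W n)).smulRight
      (LinearMap.proj i.rev : Module.Dual ℂ (W n))
  have hB : ∀ x y, B x y = ∑ i ∈ J1 n k, x i * y i.rev := by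
    intro x y
    simp [B]
  have hB1 : ∀ x y, B (pr1 n k x) y = B x y := by
    intro x y
    rw [hB, hB]
    exact Finset.sum_congr rfl fun i hi => by rw [pr1_apply_of_mem hi]
  have hBs : ∀ x y, B (q x) (q y) = B (q y) (q x) := by
    intro x y
    have h := hq3 x y
    rw [om_apply hkn, Finset.sum_sub_distrib, ← hB, sub_eq_zero] at h
    rw [h, hB]
    exact Finset.sum_congr rfl fun i _ => mul_comm _ _
  -- the symmetric form `b` agrees with `(x, y) ↦ B y (q x)` for `x` in `U`
  let b : LinearMap.BilinForm ℂ (W n) := B.compl₂ q + (B.compl₂ q).flip - B.compl₁₂ q q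
  have hb : ∀ x y, b x y = B x (q y) + B y (q x) - B (q x) (q y) := fun x y => rfl
  have hbs : ∀ x y, b x y = b y x := by
    intro x y
    rw [hb, hb, hBs]
    ring
  have hb1 : ∀ x y, b (pr1 n k x) y = b x y := by
    intro x y
    rw [hb, hb, hB1, hq1]
  let S : Module.End ℂ (W n) :=
    ∑ i ∈ J1 n k, (b.flip (Pi.single i 1)).smulRight (Pi.single i.rev 1)
  have hS : ∀ x, S x = ∑ i ∈ J1 n k, b x (Pi.single i 1) • (Pi.single i.rev 1 : W n) := by
    intro x
    simp [S]
  have hS1 : ∀ x, ∀ i ∈ J1 n k, S x i = 0 := by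
    intro x i hi
    rw [hS, Finset.sum_apply]
    refine Finset.sum_eq_zero fun j hj => ?_
    rw [Pi.smul_apply, Pi.single_eq_of_ne (ne_rev_of_mem hkn hi hj), smul_zero]
  have hS3 : ∀ x, ∀ i ∈ J1 n k, S x i.rev = b x (Pi.single i 1) := by
    intro x i hi
    rw [hS, Finset.sum_apply, Finset.sum_eq_single i]
    · simp
    · intro j _ hji
      rw [Pi.smul_apply, Pi.single_eq_of_ne (fun h => hji (Fin.rev_injective h).symm), smul_zero]
    · exact fun h => absurd hi h
  have hSp : ∀ x, S (pr1 n k x) = S x := by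
    intro x
    rw [hS, hS]
    simp only [hb1]
  have hp1S : ∀ x, pr1 n k (S x) = 0 := by
    intro x
    funext i
    by_cases hi : i ∈ J1 n k
    · rw [pr1_apply_of_mem hi, hS1 x i hi]
      rfl
    · exact pr1_apply_of_not_mem hi
  refine ⟨S, ?_, ?_, ?_, ?_, hS1, ?_⟩
  · have h1 : ∀ x y, form n (S x) y = - b x y := by
      intro x y
      have e1 : pr1 n k y = ∑ i ∈ J1 n k, y i • (Pi.single i 1 : W n) := by
        rw [pr1_eq_sum, LinearMap.sum_apply]
        rfl
      rw [hbs x y, ← hb1, hbs, e1, map_sum, hS, map_sum, LinearMap.sum_apply,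
        ← Finset.sum_neg_distrib]
      refine Finset.sum_congr rfl fun i hi => ?_
      rw [mem_J1] at hi
      rw [map_smul, map_smul, LinearMap.smul_apply, form_single,
        if_neg (by rw [Fin.val_rev]; omega), Fin.rev_rev, smul_eq_mul, smul_eq_mul]
      ring
    refine mem_spLie.2 fun x y => ?_
    rw [form_swap n x, h1, h1, hbs]
    ring
  · refine LinearMap.ext fun x => ?_
    rw [Module.End.mul_apply, ← hSp, hp1S, map_zero]
    rfl
  · refine LinearMap.ext fun x => funext fun i => ?_
    rw [Module.End.mul_apply]
    by_cases hi : i.val < k ∨ 2 * n ≤ i.val + k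
    · rw [pr13_apply_of_mem hi]
    · rw [pr13_apply_of_not_mem hi, hS, Finset.sum_apply, Finset.sum_eq_zero]
      intro j hj
      rw [Pi.smul_apply, Pi.single_eq_of_ne, smul_zero]
      rintro rfl
      rw [mem_J1] at hj
      rw [Fin.val_rev] at hi
      omega
  · refine LinearMap.ext fun x => ?_
    rw [Module.End.mul_apply, ← hSp, ← hSp x, pr1_pr13]
  · intro x hx i hi
    have e1 : ∀ y, B (q x) y = B x y := by
      intro y
      rw [hq2 x hx, ← hB1, ← hB1 x, pr1_pr13]
    rw [hS3 x i hi, hb, e1, add_sub_cancel_left, hq2 x hx, hB, Finset.sum_eq_single i]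
    · rw [mem_J1] at hi
      rw [Pi.single_eq_same, one_mul, pr13_apply_of_mem]
      rw [Fin.val_rev]
      omega
    · intro j _ hji
      rw [Pi.single_eq_of_ne hji, zero_mul]
    · exact fun h => absurd hi h

/-- If the `W_{k,3}`-components of `x` and `y` are those prescribed by `S`, then `1 - S` maps `x` and `y`
to vectors without `W_{k,3}`-component, so that they are orthogonal. -/
lemma om_eq_zero_of_graph (hkn : k ≤ n) {S : Module.End ℂ (W n)} (hS : S ∈ spLie n)
    (hSS : S * S = 0) (hl : pr13 n k * S = S) (hr : S * pr13 n k = S) {x y : W n}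
    (hx : ∀ i ∈ J1 n k, S x i.rev = x i.rev) (hy : ∀ i ∈ J1 n k, S y i.rev = y i.rev) :
    om n k x y = 0 := by
  have h1 : ∀ z, S (S z) = 0 := LinearMap.congr_fun hSS
  have h2 := om_add_apply hS hSS hl hr (x - S x) (y - S y)
  rw [map_sub, map_sub, h1, h1, sub_zero, sub_zero, sub_add_cancel, sub_add_cancel] at h2
  rw [h2, om_apply hkn]
  refine Finset.sum_eq_zero fun i hi => ?_
  rw [Pi.sub_apply, Pi.sub_apply y, Pi.sub_apply x, Pi.sub_apply, hx i hi, hy i hi]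
  ring

end Shear

/-! ### The big cell -/

section Chart

variable {n k : ℕ}

lemma castLE_mem_J1 (h : k ≤ 2 * n) (i : Fin k) : Fin.castLE h i ∈ J1 n k := mem_J1.2 i.2

lemma pr1_bas (hkn : k ≤ n) (i : Fin k) : pr1 n k (bas n k hkn i) = bas n k hkn i := by
  funext j
  by_cases hj : j ∈ J1 n k
  · rw [pr1_apply_of_mem hj]
  · rw [pr1_apply_of_not_mem hj, bas, Pi.single_eq_of_ne]
    rintro rfl
    exact hj (castLE_mem_J1 _ i)

/-- The big cell of `Z_k` consists of the graphs of the lower blocks of the elements of `𝔫⁻`. -/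
lemma ιMulti_mem_of_pr1_injective (hkn : k ≤ n) {u : Fin k → W n}
    (hu : ∀ i j, om n k (u i) (u j) = 0)
    (hfin : Module.finrank ℂ (Submodule.span ℂ (Set.range u)) = k)
    (hinj : ∀ x ∈ Submodule.span ℂ (Set.range u), pr1 n k x = 0 → x = 0) :
    exteriorPower.ιMulti ℂ k u ∈ coneClosure (cellVecs n k hkn) := by
  set U := Submodule.span ℂ (Set.range u) with hU
  have hmem : ∀ x, pr1 n k x ∈ W1 n k := by
    intro x
    rw [W1, mem_coordSpan]
    exact fun i hi => pr1_apply_of_not_mem fun h => hi (mem_J1.1 h)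
  let φ : U →ₗ[ℂ] W1 n k := ((pr1 n k).domRestrict U).codRestrict (W1 n k) fun x => hmem x
  have hφ : Function.Surjective φ := by
    rw [← LinearMap.injective_iff_surjective_of_finrank_eq_finrank
      (hfin.trans (finrank_W1 n k hkn).symm), injective_iff_map_eq_zero]
    intro x hx
    exact Subtype.ext (hinj x x.2 (congrArg Subtype.val hx))
  have hz : ∀ i : Fin k, ∃ z ∈ U, pr1 n k z = bas n k hkn i := by
    intro i
    obtain ⟨z, hz⟩ := hφ ⟨bas n k hkn i, by rw [← pr1_bas]; exact hmem _⟩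
    exact ⟨z, z.2, congrArg Subtype.val hz⟩
  choose z hzU hz1 using hz
  have hzc : ∀ i, ∀ j ∈ J1 n k, z i j = bas n k hkn i j := by
    intro i j hj
    rw [← hz1, pr1_apply_of_mem hj]
  -- the linear map with `w_i ↦ z_i`
  let T : Module.End ℂ (W n) := ∑ i : Fin k,
    (LinearMap.proj (Fin.castLE (by omega : k ≤ 2 * n) i) : W n →ₗ[ℂ] ℂ).smulRight (z i)
  have hT : ∀ i, T (bas n k hkn i) = z i := by
    intro i
    simp only [T, LinearMap.sum_apply, LinearMap.smulRight_apply, LinearMap.proj_apply]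
    rw [Finset.sum_eq_single i]
    · rw [bas, Pi.single_eq_same, one_smul]
    · intro j _ hji
      rw [bas, Pi.single_eq_of_ne, zero_smul]
      exact fun h => hji (Fin.castLE_injective _ h)
    · simp
  have hom : ∀ i j, om n k (z i) (z j) = 0 := fun i j =>
    om_eq_zero_of_mem_span hu (hzU i) (hzU j)
  have hsym : ∀ i j : Fin k, z i (Fin.castLE (by omega : k ≤ 2 * n) j).rev =
      z j (Fin.castLE (by omega : k ≤ 2 * n) i).rev := by
    intro i j
    have h := hom i j
    rw [om_apply hkn, Finset.sum_sub_distrib,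
      Finset.sum_eq_single (Fin.castLE (by omega : k ≤ 2 * n) i),
      Finset.sum_eq_single (Fin.castLE (by omega : k ≤ 2 * n) j),
      hzc i _ (castLE_mem_J1 _ i), hzc j _ (castLE_mem_J1 _ j), bas, bas, Pi.single_eq_same,
      Pi.single_eq_same, one_mul, mul_one, sub_eq_zero] at h
    · exact h.symm
    · intro l hl hlj
      rw [hzc j l hl, bas, Pi.single_eq_of_ne hlj, mul_zero]
    · exact fun h => absurd (castLE_mem_J1 _ j) h
    · intro l hl hli
      rw [hzc i l hl, bas, Pi.single_eq_of_ne hli, zero_mul]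
    · exact fun h => absurd (castLE_mem_J1 _ i) h
  obtain ⟨f, hf⟩ := exists_lowerBlock hkn T (by
    intro i hi j hj
    rw [mem_J1] at hi hj
    have e1 : (Pi.single i 1 : W n) = bas n k hkn ⟨i, hi⟩ := rfl
    have e2 : (Pi.single j 1 : W n) = bas n k hkn ⟨j, hj⟩ := rfl
    rw [e1, e2, hT, hT]
    exact hsym ⟨i, hi⟩ ⟨j, hj⟩)
  have hcell : (fun i => bas n k hkn i + lowerBlock n k f (bas n k hkn i)) = z := by
    funext i
    rw [hf, Module.End.mul_apply, Module.End.mul_apply, pr1_bas, hT, ← hz1 i, ← LinearMap.add_apply,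
      pr1_add_pr23 hkn]
    rfl
  have hzmem : exteriorPower.ιMulti ℂ k z ∈ cellVecs n k hkn := ⟨f, by rw [← hcell]⟩
  have hli : LinearIndependent ℂ z := by
    refine LinearIndependent.of_comp (pr1 n k) ?_
    have e1 : (pr1 n k) ∘ z = fun i => bas n k hkn i := funext hz1
    rw [e1]
    have h := (Pi.basisFun ℂ (Fin (2 * n))).linearIndependent.comp _
      (Fin.castLE_injective (by omega : k ≤ 2 * n))
    convert h using 2 with i
    simp [bas]
  have hspan : Submodule.span ℂ (Set.range z) = U := by
    refine Submodule.eq_of_le_of_finrank_eq (Submodule.span_le.2 ?_) ?_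
    · rintro _ ⟨i, rfl⟩
      exact hzU i
    · rw [finrank_span_eq_card hli, Fintype.card_fin, hfin]
  have h1 := plucker_eq_mk (⟨U, hfin⟩ : Gr n k) (u := u) rfl
  rw [plucker_eq_mk (⟨U, hfin⟩ : Gr n k) (u := z) hspan, Projectivization.mk_eq_mk_iff'] at h1
  obtain ⟨c, hc⟩ := h1
  have hc0 : c ≠ 0 := by
    rintro rfl
    rw [zero_smul] at hc
    exact ιMulti_ne_zero hfin hspan hc.symm
  have h2 : exteriorPower.ιMulti ℂ k u = c⁻¹ • exteriorPower.ιMulti ℂ k z := by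
    rw [← hc, inv_smul_smul₀ hc0]
  rw [h2]
  exact smul_mem_coneClosure hzmem _

end Chart

/-! ### The closure of the big cell -/

section Final

variable {n k : ℕ}

lemma map_span_range (T : Module.End ℂ (W n)) {m : ℕ} (u : Fin m → W n) :
    (Submodule.span ℂ (Set.range u)).map T = Submodule.span ℂ (Set.range fun i => T (u i)) := by
  rw [Submodule.map_span, ← Set.range_comp]
  rfl

/-- A subspace whose projection to `W_{k,1} ⊕ W_{k,3}` is contained in the graph of a symmetric map `S`
is joined to the graph of `S` over `W_{k,1}` by a polynomial curve, almost all of whose points lie in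
the big cell. -/
lemma ιMulti_mem_of_inf_eq_bot (hkn : k ≤ n) {u : Fin k → W n}
    (hu : ∀ i j, om n k (u i) (u j) = 0)
    (h0 : (Submodule.span ℂ (Set.range u)).map (pr13 n k) ⊓ W3 n k = ⊥) :
    exteriorPower.ιMulti ℂ k u ∈ coneClosure (cellVecs n k hkn) := by
  obtain ⟨S, hS, hSS, hl, hr, hS1, hSU⟩ := exists_shear hkn
    (fun x hx y hy => om_eq_zero_of_mem_span hu hx hy) h0
  let a : Fin k → W n := fun i => bas n k hkn i + S (bas n k hkn i)
  let c : ℂ → Fin k → W n := fun t i => u i + t • (a i - u i)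
  -- all points of the curve lie in the graph of `S`
  have hgraph : ∀ t i, ∀ j ∈ J1 n k, S (c t i) j.rev = c t i j.rev := by
    intro t i j hj
    have e1 := hSU (u i) (Submodule.subset_span ⟨i, rfl⟩) j hj
    have e2 : S (a i) = S (bas n k hkn i) := by
      have : S (S (bas n k hkn i)) = 0 := LinearMap.congr_fun hSS _
      rw [map_add, this, add_zero]
    have e3 : a i j.rev = S (bas n k hkn i) j.rev := by
      change bas n k hkn i j.rev + S (bas n k hkn i) j.rev = _
      rw [bas, Pi.single_eq_of_ne (ne_rev_of_mem hkn (castLE_mem_J1 _ i) hj).symm, zero_add]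
    simp only [c, map_add, map_smul, map_sub, Pi.add_apply, Pi.smul_apply, Pi.sub_apply, e1, e2, e3]
  have hom : ∀ t i j, om n k (c t i) (c t j) = 0 := fun t i j =>
    om_eq_zero_of_graph hkn hS hSS hl hr (hgraph t i) (hgraph t j)
  -- the minor that has to be nonzero on the big cell
  let A : ℂ → Matrix (Fin k) (Fin k) ℂ := fun t =>
    Matrix.of fun i j => c t i (Fin.castLE (by omega : k ≤ 2 * n) j)
  let P : Polynomial ℂ := (Matrix.of fun i j : Fin k =>
    Polynomial.C (u i (Fin.castLE (by omega : k ≤ 2 * n) j)) + Polynomial.X *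
      Polynomial.C ((a i - u i) (Fin.castLE (by omega : k ≤ 2 * n) j))).det
  have hP : ∀ t, P.eval t = (A t).det := by
    intro t
    rw [← Polynomial.coe_evalRingHom, RingHom.map_det]
    congr 1
    ext i j
    simp [A, c]
  have hA1 : A 1 = 1 := by
    ext i j
    have hc1 : c 1 i = a i := by simp [c]
    change c 1 i _ = _
    rw [hc1]
    change bas n k hkn i _ + S (bas n k hkn i) _ = _
    rw [hS1 _ _ (castLE_mem_J1 _ j), add_zero, bas, Pi.single_apply, Matrix.one_apply]
    simp [Fin.ext_iff, eq_comm]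
  have hP0 : P ≠ 0 := by
    intro h
    have h1 := hP 1
    rw [h, hA1] at h1
    simp at h1
  have hdet : ∀ t, (A t).det ≠ 0 → ∀ r : Fin k → ℂ,
      pr1 n k (∑ i, r i • c t i) = 0 → r = 0 := by
    intro t ht r hr0
    refine Matrix.eq_zero_of_vecMul_eq_zero ht (funext fun j => ?_)
    have h1 := congrFun hr0 (Fin.castLE (by omega : k ≤ 2 * n) j)
    rw [pr1_apply_of_mem (castLE_mem_J1 _ j), Finset.sum_apply] at h1
    exact h1
  have key : exteriorPower.ιMulti ℂ k (c 0) ∈ coneClosure (cellVecs n k hkn) := by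
    refine (polyCurve_ιMulti u fun i => a i - u i).mem_coneClosure
      (F := {t | P.IsRoot t}) (Polynomial.finite_setOfPred_isRoot hP0) (fun t ht => ?_) 0
    have ht' : (A t).det ≠ 0 := by
      rw [← hP]
      exact ht
    refine ιMulti_mem_of_pr1_injective hkn (hom t) ?_ ?_
    · have hli : LinearIndependent ℂ (c t) := by
        rw [Fintype.linearIndependent_iff]
        intro r hr0 i
        exact congrFun (hdet t ht' r (by rw [hr0, map_zero])) i
      rw [finrank_span_eq_card hli, Fintype.card_fin]
    · intro x hx hx1
      obtain ⟨r, rfl⟩ := (Submodule.mem_span_range_iff_exists_fun ℂ).1 hx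
      rw [hdet t ht' r hx1]
      simp
  have hc0 : c 0 = u := funext fun i => by simp [c]
  rwa [hc0] at key

/-- `Z_k` is contained in the closure of the big cell: the intersection of the projection of a
subspace with `W_{k,3}` can be reduced by arbitrarily small transvections. -/
lemma ιMulti_mem_coneClosure (hkn : k ≤ n) (u : Fin k → W n)
    (hu : ∀ i j, om n k (u i) (u j) = 0) :
    exteriorPower.ιMulti ℂ k u ∈ coneClosure (cellVecs n k hkn) := by
  induction hd : Module.finrank ℂ
    ↥((Submodule.span ℂ (Set.range u)).map (pr13 n k) ⊓ W3 n k) using Nat.strong_induction_on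
    generalizing u with
  | _ d ih =>
    by_cases h0 : (Submodule.span ℂ (Set.range u)).map (pr13 n k) ⊓ W3 n k = ⊥
    · exact ιMulti_mem_of_inf_eq_bot hkn hu h0
    obtain ⟨i, hi, hit⟩ := exists_transvection hkn
      (fun x hx y hy => om_eq_zero_of_mem_span hu hx hy) h0
    have h1 := (polyCurve_ιMulti u fun j => eu i i.rev (u j)).mem_coneClosure
      (S := cellVecs n k hkn) (Set.finite_singleton 0) (fun t ht => ?_) 0
    · simpa using h1
    obtain ⟨e1, e2, e3, e4⟩ := transvection hkn hi t
    refine ih _ ?_ _ (fun j l => ?_) rfl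
    · have h2 := Submodule.finrank_lt_finrank_of_lt (hit t ht)
      rw [map_span_range, hd] at h2
      exact h2
    · exact (om_add_apply e1 e2 e3 e4 (u j) (u l)).trans (hu j l)

lemma map_image_SpGrA (hk : 1 ≤ k) (hkn : k ≤ n) :
    Projectivization.map (iota n k hkn) (iota_injective hkn) '' SpGrA n k hkn =
      plucker n k '' Zk n k := by
  refine Set.Subset.antisymm ?_ ?_
  · rintro _ ⟨y, hy, rfl⟩
    obtain ⟨U, hU, hUy⟩ := exists_plucker_eq hk hkn hy
    exact ⟨U, hU, hUy⟩
  · rintro _ ⟨U, hU, rfl⟩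
    obtain ⟨u, hu⟩ := exists_span_range_eq U.2
    have hUom := (isIsotropic_map_iff U.1).1 hU
    have hom : ∀ i j, om n k (u i) (u j) = 0 := fun i j =>
      hUom _ (hu ▸ Submodule.subset_span ⟨i, rfl⟩) _ (hu ▸ Submodule.subset_span ⟨j, rfl⟩)
    obtain ⟨v, hv⟩ := (mem_range_iota hkn (exteriorPower.ιMulti ℂ k u)).2
      (conB_ιMulti_eq_zero hkn u hom)
    have hv0 : v ≠ 0 := by
      rintro rfl
      rw [map_zero] at hv
      exact ιMulti_ne_zero U.2 hu hv.symm
    refine ⟨Projectivization.mk ℂ v hv0, (mk_mem_SpGrA hkn hv0).2 ?_, ?_⟩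
    · rw [hv]
      exact ιMulti_mem_coneClosure hkn u hom
    · rw [plucker_eq_mk U hu, Projectivization.map_mk]
      simp only [hv]

/-! ### The variety `Z_k` as a union of translates -/

lemma mem_SpDotGr_of_map (U : Gr n k) {g : W n ≃ₗ[ℂ] W n} (hg : g ∈ SpSub n k) (U' : Gr n k)
    (hU' : U'.1 = U.1.map (g : W n →ₗ[ℂ] W n)) (h : U' ∈ SpDotGr n k) : U ∈ SpDotGr n k := by
  obtain ⟨g', hg', Y, hY, hYU⟩ := h
  refine ⟨g⁻¹ * g', mul_mem (inv_mem hg) hg', Y, hY, ?_⟩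
  have h1 : ((g⁻¹ * g' : W n ≃ₗ[ℂ] W n) : W n →ₗ[ℂ] W n) =
    ((g⁻¹ : W n ≃ₗ[ℂ] W n) : W n →ₗ[ℂ] W n) ∘ₗ (g' : W n →ₗ[ℂ] W n) := rfl
  have h2 : ((g⁻¹ : W n ≃ₗ[ℂ] W n) : W n →ₗ[ℂ] W n) ∘ₗ (g : W n →ₗ[ℂ] W n) = LinearMap.id :=
    LinearMap.ext fun x => g.symm_apply_apply x
  rw [h1, Submodule.map_comp, ← hYU, hU', ← Submodule.map_comp, h2, Submodule.map_id]

/-- The image of a point of the Grassmannian under an automorphism of `W`. -/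
def grMap (g : W n ≃ₗ[ℂ] W n) (U : Gr n k) : Gr n k :=
  ⟨U.1.map (g : W n →ₗ[ℂ] W n), (LinearEquiv.finrank_map_eq g U.1).trans U.2⟩

lemma Zk_subset (hkn : k ≤ n) (U : Gr n k) (hU : U ∈ Zk n k) : U ∈ SpDotGr n k := by
  induction hd : Module.finrank ℂ ↥(U.1.map (pr13 n k) ⊓ W3 n k) using Nat.strong_induction_on
    generalizing U with
  | _ d ih =>
    have hUom := (isIsotropic_map_iff U.1).1 hU
    by_cases h0 : U.1.map (pr13 n k) ⊓ W3 n k = ⊥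
    · obtain ⟨S, hS, hSS, hl, hr, hS1, hSU⟩ := exists_shear hkn hUom h0
      obtain ⟨g, hg, hgS⟩ := exists_SpSub (n := n) (k := k) (Y := (-1 : ℂ) • S)
        (Submodule.smul_mem _ _ hS) (by rw [smul_mul_smul_comm, hSS, smul_zero])
        (by rw [mul_smul_comm, hl]) (by rw [smul_mul_assoc, hr])
      refine mem_SpDotGr_of_map U hg (grMap g U) rfl ⟨1, one_mem _, grMap g U, ?_, ?_⟩
      · rintro _ ⟨x, hx, rfl⟩
        rw [mem_W1_sup_W2 hkn, hgS]
        intro i hi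
        have h1 := hSU x hx i.rev (by
          rw [mem_idx3] at hi
          rw [mem_J1, Fin.val_rev]
          omega)
        rw [Fin.rev_rev] at h1
        change x i + -1 * S x i = 0
        rw [h1]
        ring
      · exact (Submodule.map_id _).symm
    · obtain ⟨i, hi, hit⟩ := exists_transvection hkn hUom h0
      obtain ⟨e1, e2, e3, e4⟩ := transvection hkn hi 1
      obtain ⟨g, hg, hgS⟩ := exists_SpSub e1 e2 e3 e4
      have h1 : (grMap g U).1 = U.1.map (1 + (1 : ℂ) • eu i i.rev) := by
        rw [← hgS]
        rfl
      refine mem_SpDotGr_of_map U hg (grMap g U) rfl (ih _ ?_ _ ?_ rfl)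
      · rw [← hd, h1]
        exact Submodule.finrank_lt_finrank_of_lt (hit 1 one_ne_zero)
      · refine (isIsotropic_map_iff _).2 ?_
        rw [h1]
        rintro _ ⟨x, hx, rfl⟩ _ ⟨y, hy, rfl⟩
        exact (om_add_apply e1 e2 e3 e4 x y).trans (hUom x hx y hy)

lemma pr13_apply_SpSub {g : W n ≃ₗ[ℂ] W n} (hg : g ∈ SpSub n k) (x : W n) :
    pr13 n k (g x) = g (pr13 n k x) := by
  have h1 : pr13 n k x ∈ W1 n k ⊔ W3 n k := by
    rw [mem_W1_sup_W3]
    exact LinearMap.congr_fun pr13_mul_self x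
  have h2 : x - pr13 n k x ∈ W2 n k := by
    rw [W2, mem_coordSpan]
    intro i hi
    have hi2 := i.2
    rw [mem_idx2] at hi
    rw [Pi.sub_apply, pr13_apply_of_mem (by omega), sub_self]
  have h3 : g (pr13 n k x) ∈ W1 n k ⊔ W3 n k := by
    rw [← hg.2.2]
    exact Submodule.mem_map_of_mem h1
  have h4 : g x = g (pr13 n k x) + (x - pr13 n k x) := by
    rw [← hg.2.1 _ h2, ← map_add, add_sub_cancel]
  rw [h4, map_add, mem_W1_sup_W3.1 h3, pr13_eq_zero_of_mem h2, add_zero]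

lemma Zk_eq_SpDotGr (hkn : k ≤ n) : Zk n k = SpDotGr n k := by
  refine Set.Subset.antisymm (Zk_subset hkn) ?_
  rintro U ⟨g, hg, Y, hY, hU⟩
  refine (isIsotropic_map_iff _).2 ?_
  rw [hU]
  rintro _ ⟨x, hx, rfl⟩ _ ⟨y, hy, rfl⟩
  have hgs : ∀ x y, form n (g x) (g y) = form n x y := hg.1
  have h0 : ∀ z ∈ Y.1, ∀ i ∈ J1 n k, z i.rev = 0 := by
    intro z hz i hi
    refine (mem_W1_sup_W2 hkn).1 (hY hz) _ ?_
    rw [mem_J1] at hi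
    rw [mem_idx3, Fin.val_rev]
    omega
  have h1 : om n k (g x) (g y) = om n k x y := by
    rw [om_apply_form, pr13_apply_SpSub hg, pr13_apply_SpSub hg, hgs, om_apply_form]
  refine h1.trans ?_
  rw [om_apply hkn]
  refine Finset.sum_eq_zero fun i hi => ?_
  rw [h0 x hx i hi, h0 y hy i hi]
  ring

lemma isIrreducible_plucker_Zk (hk : 1 ≤ k) (hkn : k ≤ n) :
    @IsIrreducible _ (zariski (⋀[ℂ]^k (W n))) (plucker n k '' Zk n k) := by
  rw [← map_image_SpGrA hk hkn]
  let _ := zariski (Va n k hkn)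
  let _ := zariski (⋀[ℂ]^k (W n))
  exact (isIrreducible_SpGrA hkn).image _
    (continuous_map_zariski (iota n k hkn) (iota_injective hkn)).continuousOn

end Final

end DegSymp

end

theorem mainTheorem2 (n k : ℕ) (hk : 1 ≤ k) (hkn : k ≤ n) :
    (∃ (ι : DegSymp.Va n k hkn →ₗ[ℂ] ⋀[ℂ]^k (DegSymp.W n)) (hι : Function.Injective ι),
      ι (DegSymp.hwA n k hkn) = DegSymp.hwVec n k hkn ∧
      (∀ (f : DegSymp.nMinus n) (x : DegSymp.Va n k hkn),
        ι (DegSymp.actA n k hkn f x) = DegSymp.der k (DegSymp.lowerBlock n k f) (ι x)) ∧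
      Projectivization.map ι hι '' DegSymp.SpGrA n k hkn =
        DegSymp.plucker n k '' DegSymp.Zk n k) ∧
    @IsIrreducible _ (DegSymp.zariski (DegSymp.Va n k hkn)) (DegSymp.SpGrA n k hkn) ∧
    @IsIrreducible _ (DegSymp.zariski (⋀[ℂ]^k (DegSymp.W n)))
      (DegSymp.plucker n k '' DegSymp.Zk n k) ∧
    DegSymp.Zk n k = DegSymp.SpDotGr n k :=
  ⟨⟨DegSymp.iota n k hkn, DegSymp.iota_injective hkn, DegSymp.iota_hwA hkn, DegSymp.iota_actA hkn,
    DegSymp.map_image_SpGrA hk hkn⟩, DegSymp.isIrreducible_SpGrA hkn,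
    DegSymp.isIrreducible_plucker_Zk hk hkn, DegSymp.Zk_eq_SpDotGr hkn⟩
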